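/- Let $n\ge 2$ and let $\mathbf a=(a_\gamma)_{\gamma\in\mathbb N^n,|\gamma|\le 2}$ be complex numbers. Put $a_{lj}=\tfrac12 a_{e_l+e_j}$ for $l\ne j$, $a_{jj}=a_{2e_j}$, $a_j=a_{e_j}$, $a^{(2)}=(a_{lj})$, $a^{(1)}=(a_j)$, $a=a_0$. Assume that $a_{lj}\in\mathbb R$ for all $l,j$ and that $\inf_{|\xi|=1}\mathrm{Re}\sum_{|\gamma|=2}a_\gamma\xi^\gamma>0$. Let $S$ be a fundamental solution of $P[\mathbf a,D]=\sum_{l,j}a_{lj}\partial_l\partial_j+\sum_l a_l\partial_l+a$, i.e. a locally integrable function on $\mathbb R^n$, continuous on $\mathbb R^n\setminus\{0\}$, with $P[\mathbf a,D]S=\delta_0$ in the sense of distributions. Let $\alpha\in\,]0,1]$ and let $\Omega\subseteq\mathbb R^n$ be a bounded open set of class $C^{1,\alpha}$ with outer unit normal $\nu$. For $y\in\partial\Omega$ and $x\in\mathbb R^n\setminus\{y\}$ consider the double layer kernel $$K(x,y)=-\sum_{l,j=1}^n a_{jl}\nu_l(y)\frac{\partial S}{\partial x_j}(x-y)-\sum_{l=1}^n\nu_l(y)a_l\,S(x-y).$$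 Let $s_n$ be the $(n-1)$-dimensional measure of the unit sphere $\partial\mathbb B$ of $\mathbb R^n$, and let $S_n(x)=\frac1{s_n}\ln|x|$ if $n=2$, $S_n(x)=\frac{1}{(2-n)s_n}|x|^{2-n}$ if $n>2$. A function on $\partial\mathbb B\times\mathbb R$ is called real analytic if it has a real analytic extension to an open neighbourhood of $\partial\mathbb B\times\mathbb R$ in $\mathbb R^{n+1}$. We say that $(T,A_1,b_0,B_1,C,A_2)$ are expansion data for $S$ if $T$ is an invertible real $n\times n$ matrix with $a^{(2)}=TT^t$; $A_1:\partial\mathbb B\times\mathbb R\to\mathbb C$ and $A_2:\partial\mathbb B\times\mathbb R\to\mathbb C^n$ (row vectors) are real analytic, $A_1(\cdot,0)$ is odd and $A_2(\cdot,0)$ is even; $b_0\in\mathbb C$; $B_1,C:\mathbb R^n\to\mathbb C$ are real analytic and $B_1(0)=0$; $b_0=0$ and $B_1=0$ if $n$ is odd; and for all $x\ne0$ $$S(x)=\frac{S_n(T^{-1}x)}{\sqrt{\det a^{(2)}}}+|x|^{3-n}A_1\Big(\frac x{|x|},|x|\Big)+\big(B_1(x)+b_0(1-\delta_{2,n})\big)\ln|x|+C(x),$$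 $$DS(x)=\frac{|T^{-1}x|^{-n}x^t(a^{(2)})^{-1}}{s_n\sqrt{\det a^{(2)}}}+|x|^{2-n}A_2\Big(\frac x{|x|},|x|\Big)+DB_1(x)\ln|x|+DC(x).$$ For $x\in\partial\Omega$ and $F=(F_1,\dots,F_n)\in\mathbb C^n$ write $[F]_h^x=\sum_{l=1}^n\nu_l(x)\big[\nu_l(x)F_h-\nu_h(x)F_l\big]$. The tangential gradient at $x$ of a function $f$ on $\partial\Omega$ is the vector $v\in\mathbb C^n$ with $\sum_l\nu_l(x)v_l=0$ and $f(x')-f(x)-\sum_l v_l(x'_l-x_l)=o(|x'-x|)$ as $x'\to x$ in $\partial\Omega$. Then expansion data for $S$ exist, and the following statements hold. (i) For all $x,y\in\partial\Omega$ with $x\ne y$, the function $K(\cdot,y)$ is differentiable at $x$, its restriction to $\partial\Omega$ has a tangential gradient at $x$, and, for all $h\in\{1,\dots,n\}$ and for all expansion data (and every analytic extension of $A_2$ used to compute its partial derivatives $\partial A_2/\partial y_j$ in the first $n$ variables and $\partial A_2/\partial r$ in the last one), with $w=x-y$ and with $A_2$ and its derivatives evaluated at $(\frac{w}{|w|},|w|)$,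 $$\begin{aligned} (\mathrm{grad}_{\partial\Omega,x}K(x,y))_h&=\frac{\partial K}{\partial x_h}(x,y)-\nu_h(x)\sum_{l=1}^n\nu_l(x)\frac{\partial K}{\partial x_l}(x,y)\\ &=\frac{n}{s_n\sqrt{\det a^{(2)}}}\,\frac{w^t\nu(y)}{|T^{-1}w|^n}\Big[\Big(\frac{\sum_{j,z}(T^{-1})_{jz}w_z(T^{-1})_{jl}}{|T^{-1}w|^2}\Big)_{l}\Big]^x_h-\frac{[\nu(y)]_h^x}{s_n\sqrt{\det a^{(2)}}\,|T^{-1}w|^n}\\ &\quad-(2-n)|w|^{1-n}A_2\,a^{(2)}\nu(y)\Big[\frac{w}{|w|}\Big]^x_h-\sum_{j=1}^n\frac{\partial A_2}{\partial y_j}a^{(2)}\nu(y)\,|w|^{-n}\Big[\Big(\delta_{jl}|w|-\frac{w_jw_l}{|w|}\Big)_l\Big]_h^x\\ &\quad-\frac{\partial A_2}{\partial r}a^{(2)}\nu(y)\Big[\frac{w}{|w|^{n-1}}\Big]_h^x-\sum_{j,z=1}^n\Big[\Big(\frac{\partial^2B_1}{\partial x_l\partial x_j}(w)\Big)_l\Big]_h^x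 a_{jz}\nu_z(y)\ln|w|\\ &\quad-DB_1(w)a^{(2)}\nu(y)\Big[\frac{w}{|w|^2}\Big]_h^x-\sum_{j,z=1}^n\Big[\Big(\frac{\partial^2C}{\partial x_l\partial x_j}(w)\Big)_l\Big]_h^x a_{jz}\nu_z(y)-\nu(y)^ta^{(1)}\Big[\Big(\frac{\partial S}{\partial x_l}(w)\Big)_l\Big]_h^x . \end{aligned}$$ (ii) For every $h$, the kernel $G(x,y)=(\mathrm{grad}_{\partial\Omega,x}K(x,y))_h$ belongs to $\mathcal K_{n-\alpha,n,\alpha}(\partial\Omega\times\partial\Omega)$: it is continuous on $\{(x,y)\in\partial\Omega\times\partial\Omega:x\ne y\}$, and $$\sup_{x\ne y}|x-y|^{n-\alpha}|G(x,y)|<\infty,\qquad \sup\frac{|x'-y|^{n}}{|x'-x''|^{\alpha}}|G(x',y)-G(x'',y)|<\infty,$$ the second supremum being over $x',x'',y\in\partial\Omega$ with $x'\ne x''$ and $|x'-y|\ge2|x'-x''|$. -/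

import Mathlib

open MeasureTheory Filter Topology
open scoped ContDiff

noncomputable section

/-- `ℝⁿ` with the Euclidean norm. -/
abbrev RSpace (n : ℕ) : Type := EuclideanSpace ℝ (Fin n)

/-- The partial derivative `∂f/∂x_j`. -/
def partialD {n : ℕ} (j : Fin n) (f : RSpace n → ℂ) (x : RSpace n) : ℂ :=
  fderiv ℝ f x (EuclideanSpace.single j 1)

/-! ### The differential operator

The coefficients are a family `a γ` indexed by multi-indices `γ : Fin n → ℕ`; only the entries with
`|γ| ≤ 2` are ever used. -/

/-- The matrix `a⁽²⁾`: `a_{lj} = a_{e_l + e_j} / 2` for `l ≠ j` and `a_{jj} = a_{2 e_j}`. -/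
def coeffTwo {n : ℕ} (a : (Fin n → ℕ) → ℂ) : Matrix (Fin n) (Fin n) ℂ := fun l j =>
  if l = j then a (Pi.single l 1 + Pi.single j 1) else a (Pi.single l 1 + Pi.single j 1) / 2

/-- The vector `a⁽¹⁾`. -/
def coeffOne {n : ℕ} (a : (Fin n → ℕ) → ℂ) : Fin n → ℂ := fun j => a (Pi.single j 1)

/-- The real matrix of the real parts of `a⁽²⁾`
(it is `a⁽²⁾` itself when the second order coefficients are real). -/
def realCoeffTwo {n : ℕ} (a : (Fin n → ℕ) → ℂ) : Matrix (Fin n) (Fin n) ℝ := fun l j =>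
  (coeffTwo a l j).re

/-- `∑_{|γ| = 2} a_γ ξ^γ`. -/
def principalSymbol {n : ℕ} (a : (Fin n → ℕ) → ℂ) (ξ : RSpace n) : ℂ :=
  ∑ γ ∈ Finset.piAntidiag (Finset.univ : Finset (Fin n)) 2, a γ * ∏ i, (ξ i : ℂ) ^ γ i

/-- Ellipticity: `inf_{|ξ| = 1} Re ∑_{|γ| = 2} a_γ ξ^γ > 0`. -/
def IsElliptic {n : ℕ} (a : (Fin n → ℕ) → ℂ) : Prop :=
  ∃ c : ℝ, 0 < c ∧ ∀ ξ : RSpace n, ‖ξ‖ = 1 → c ≤ (principalSymbol a ξ).re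

/-- The second order coefficients `a_{lj}` are real. -/
def HasRealPrincipalPart {n : ℕ} (a : (Fin n → ℕ) → ℂ) : Prop :=
  ∀ l j : Fin n, (coeffTwo a l j).im = 0

/-- The formal transpose of
`P[a,D] u = ∑ ∂_l (a_{lj} ∂_j u) + ∑ a_l ∂_l u + a₀ u`, that is,
`φ ↦ ∑ a_{lj} ∂_l ∂_j φ - ∑ a_l ∂_l φ + a₀ φ`. -/
def transposeOp {n : ℕ} (a : (Fin n → ℕ) → ℂ) (φ : RSpace n → ℂ) (x : RSpace n) : ℂ :=
  (∑ l, ∑ j, coeffTwo a l j * partialD l (partialD j φ) x)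
    - (∑ l, coeffOne a l * partialD l φ x) + a 0 * φ x

/-- `S` is a fundamental solution of `P[a,D]`: a locally integrable function, continuous off the
origin (this selects the representative with meaningful point values; the value at `0` plays no
role), such that `P[a,D] S = δ₀` in the sense of distributions. -/
structure IsFundamentalSolution {n : ℕ} (a : (Fin n → ℕ) → ℂ) (S : RSpace n → ℂ) : Prop where
  locallyIntegrable : LocallyIntegrable S volume
  continuousOn : ContinuousOn S {0}ᶜ
  weak_eq : ∀ φ : RSpace n → ℂ, ContDiff ℝ ∞ φ → HasCompactSupport φ →
    ∫ x, S x * transposeOp a φ x = φ 0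

/-! ### Domains of class `C^{1,α}`, normal, tangential gradient -/

/-- `Ω` is of class `C^{1,α}`: around each boundary point `p`, in the coordinate cylinder of the
points `p + η + t e` with `η ⟂ e`, `|η| < r`, `|t| < δ`, the set `Ω` is the strict hypograph of
a function `γ` of class `C^{1,α}`. -/
def IsOfClassC1Holder {n : ℕ} (α : ℝ) (Ω : Set (RSpace n)) : Prop :=
  ∀ p ∈ frontier Ω, ∃ (e : RSpace n) (r δ : ℝ) (γ : (Submodule.span ℝ {e})ᗮ → ℝ),
    ‖e‖ = 1 ∧ 0 < r ∧ 0 < δ ∧ γ 0 = 0 ∧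
    (∀ η ∈ Metric.ball (0 : (Submodule.span ℝ {e})ᗮ) r, |γ η| < δ) ∧
    ContDiffOn ℝ 1 γ (Metric.ball 0 r) ∧
    (∃ c : ℝ, ∀ η ∈ Metric.ball (0 : (Submodule.span ℝ {e})ᗮ) r,
      ∀ η' ∈ Metric.ball (0 : (Submodule.span ℝ {e})ᗮ) r,
        ‖fderiv ℝ γ η - fderiv ℝ γ η'‖ ≤ c * ‖η - η'‖ ^ α) ∧
    (∀ η ∈ Metric.ball (0 : (Submodule.span ℝ {e})ᗮ) r, ∀ t : ℝ, |t| < δ →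
      (p + (η : RSpace n) + t • e ∈ Ω ↔ t < γ η))

/-- `v` is an outer unit normal to `∂Ω` at `x`: a unit vector orthogonal to all vectors tangent to
`∂Ω` at `x` and pointing out of `Ω`. -/
structure IsOuterUnitNormal {n : ℕ} (Ω : Set (RSpace n)) (x v : RSpace n) : Prop where
  norm_eq : ‖v‖ = 1
  orthogonal : ∀ w ∈ tangentConeAt ℝ (frontier Ω) x, inner ℝ v w = 0
  outward : ∀ᶠ t : ℝ in 𝓝[>] 0, x + t • v ∉ closure Ω

open Classical in
/-- The outer unit normal `ν_Ω` (with value `0` where there is none). -/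
def outerNormal {n : ℕ} (Ω : Set (RSpace n)) (x : RSpace n) : RSpace n :=
  if h : ∃ v, IsOuterUnitNormal Ω x v then h.choose else 0

/-- The real-linear functional `w ↦ ∑_l w_l v_l`. -/
def pairing {n : ℕ} (v : Fin n → ℂ) : RSpace n →L[ℝ] ℂ :=
  ∑ l, (EuclideanSpace.proj l : RSpace n →L[ℝ] ℝ).smulRight (v l)

/-- `v` is the tangential gradient at `x` of the function `f` on `∂Ω` (only the values of `f` on
`∂Ω` matter): `v` is tangent to `∂Ω` and represents the differential of `f` along `∂Ω`. -/
structure HasTangentialGradientAt {n : ℕ} (Ω : Set (RSpace n)) (f : RSpace n → ℂ) (x : RSpace n)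
    (v : Fin n → ℂ) : Prop where
  tangent : ∑ l, (outerNormal Ω x l : ℂ) * v l = 0
  differential : HasFDerivWithinAt f (pairing v) (frontier Ω) x

open Classical in
/-- The tangential gradient `grad_{∂Ω} f` at `x` (with value `0` where there is none). -/
def tangentialGradient {n : ℕ} (Ω : Set (RSpace n)) (f : RSpace n → ℂ) (x : RSpace n) :
    Fin n → ℂ :=
  if h : ∃ v, HasTangentialGradientAt Ω f x v then h.choose else 0

/-! ### The double layer kernel and the kernel classes -/

/-- The kernel of the double layer potential,
`-∑_{l,j} a_{jl} ν_l(y) (∂_j S)(x - y) - ∑_l ν_l(y) a_l S(x - y)`. -/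
def doubleLayerKernel {n : ℕ} (Ω : Set (RSpace n)) (a : (Fin n → ℕ) → ℂ) (S : RSpace n → ℂ)
    (x y : RSpace n) : ℂ :=
  -(∑ l, ∑ j, coeffTwo a j l * (outerNormal Ω y l : ℂ) * partialD j S (x - y))
    - ∑ l, (outerNormal Ω y l : ℂ) * coeffOne a l * S (x - y)

/-- Membership in the class `𝒦_{s₁,s₂,s₃}(X × Y)` of the off-diagonal function `K`
(only the values `K x y` with `x ∈ X`, `y ∈ Y`, `x ≠ y` matter). -/
structure MemKernelClass {n : ℕ} (s₁ s₂ s₃ : ℝ) (X Y : Set (RSpace n))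
    (K : RSpace n → RSpace n → ℂ) : Prop where
  continuousOn : ContinuousOn (fun p : RSpace n × RSpace n => K p.1 p.2)
    {p | p.1 ∈ X ∧ p.2 ∈ Y ∧ p.1 ≠ p.2}
  bounded : ∃ c : ℝ, ∀ x ∈ X, ∀ y ∈ Y, x ≠ y → ‖x - y‖ ^ s₁ * ‖K x y‖ ≤ c
  holder : ∃ c : ℝ, ∀ x' ∈ X, ∀ x'' ∈ X, x' ≠ x'' → ∀ y ∈ Y \ Metric.ball x' (2 * ‖x' - x''‖),
    ‖x' - y‖ ^ s₂ / ‖x' - x''‖ ^ s₃ * ‖K x' y - K x'' y‖ ≤ c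

/-! ### The expansions of the fundamental solution and of its gradient -/

/-- `s_n`, the `(n-1)`-dimensional measure of the unit sphere of `ℝⁿ`. -/
def sphereArea (n : ℕ) : ℝ := (volume : Measure (RSpace n)).toSphere.real Set.univ

/-- The fundamental solution `S_n` of the Laplace operator. -/
def laplaceFundamentalSolution (n : ℕ) (x : RSpace n) : ℝ :=
  if n = 2 then 1 / sphereArea n * Real.log ‖x‖
  else 1 / ((2 - (n : ℝ)) * sphereArea n) * ‖x‖ ^ (2 - (n : ℤ))

/-- `T⁻¹ x`. -/
def invApply {n : ℕ} (T : Matrix (Fin n) (Fin n) ℝ) (x : RSpace n) : RSpace n :=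
  Matrix.toEuclideanLin T⁻¹ x

/-- `A` is an analytic extension, to a neighbourhood of `∂𝔹(0,1) × ℝ` in `ℝⁿ × ℝ`, of a real
analytic function on `∂𝔹(0,1) × ℝ`. -/
def IsAnalyticNearSphere {n : ℕ} {F : Type*} [NormedAddCommGroup F] [NormedSpace ℝ F]
    (A : RSpace n × ℝ → F) : Prop :=
  AnalyticOnNhd ℝ A (Metric.sphere 0 1 ×ˢ Set.univ)

/-- The point `(x / |x|, |x|)` of `∂𝔹(0,1) × ℝ`. -/
def polar {n : ℕ} (x : RSpace n) : RSpace n × ℝ := (‖x‖⁻¹ • x, ‖x‖)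

/-- The data `T`, `A₁`, `b₀`, `B₁`, `C` give the expansion
`S(x) = (det a⁽²⁾)^{-1/2} S_n(T⁻¹ x) + |x|^{3-n} A₁(x/|x|,|x|)
  + (B₁(x) + b₀ (1 - δ_{2,n})) log |x| + C(x)`. -/
structure IsExpansion {n : ℕ} (a : (Fin n → ℕ) → ℂ) (S : RSpace n → ℂ)
    (T : Matrix (Fin n) (Fin n) ℝ) (A₁ : RSpace n × ℝ → ℂ) (b₀ : ℂ) (B₁ C : RSpace n → ℂ) :
    Prop where
  isUnit : IsUnit T
  factor : realCoeffTwo a = T * T.transpose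
  analytic_A : IsAnalyticNearSphere A₁
  odd_A : ∀ θ : RSpace n, ‖θ‖ = 1 → A₁ (-θ, 0) = -A₁ (θ, 0)
  analytic_B : AnalyticOnNhd ℝ B₁ Set.univ
  B_zero : B₁ 0 = 0
  analytic_C : AnalyticOnNhd ℝ C Set.univ
  odd_dim : Odd n → b₀ = 0 ∧ ∀ x, B₁ x = 0
  expansion : ∀ x : RSpace n, x ≠ 0 →
    S x = ((1 / √(realCoeffTwo a).det * laplaceFundamentalSolution n (invApply T x) : ℝ) : ℂ)
      + ((‖x‖ ^ (3 - (n : ℤ)) : ℝ) : ℂ) * A₁ (polar x)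
      + (B₁ x + b₀ * (if n = 2 then 0 else 1)) * (Real.log ‖x‖ : ℂ) + C x

/-- The function `A₂` (with values in `ℂⁿ`) gives the expansion
`DS(x) = (s_n √(det a⁽²⁾))⁻¹ |T⁻¹x|^{-n} xᵗ (a⁽²⁾)⁻¹ + |x|^{2-n} A₂(x/|x|,|x|)
  + DB₁(x) log |x| + DC(x)`. -/
structure IsGradientExpansion {n : ℕ} (a : (Fin n → ℕ) → ℂ) (S : RSpace n → ℂ)
    (T : Matrix (Fin n) (Fin n) ℝ) (B₁ C : RSpace n → ℂ) (A₂ : RSpace n × ℝ → Fin n → ℂ) :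
    Prop where
  analytic_A : IsAnalyticNearSphere A₂
  even_A : ∀ θ : RSpace n, ‖θ‖ = 1 → A₂ (-θ, 0) = A₂ (θ, 0)
  expansion : ∀ x : RSpace n, x ≠ 0 → ∀ j : Fin n,
    partialD j S x =
      ((1 / (sphereArea n * √(realCoeffTwo a).det) * ‖invApply T x‖ ^ (-(n : ℤ))
          * ∑ i, x i * (realCoeffTwo a)⁻¹ i j : ℝ) : ℂ)
      + ((‖x‖ ^ (2 - (n : ℤ)) : ℝ) : ℂ) * A₂ (polar x) j
      + partialD j B₁ x * (Real.log ‖x‖ : ℂ) + partialD j C x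

/-! ### The explicit formula -/

/-- `v a⁽²⁾ w` for a row vector `v ∈ ℂⁿ` and a column vector `w ∈ ℝⁿ`. -/
def rowMatCol {n : ℕ} (a : (Fin n → ℕ) → ℂ) (v : Fin n → ℂ) (w : RSpace n) : ℂ :=
  ∑ j, ∑ z, v j * coeffTwo a j z * (w z : ℂ)

/-- `∑_l ν_l(x) [ν_l(x) F_h - ν_h(x) F_l]`. -/
def tangentialPart {n : ℕ} (Ω : Set (RSpace n)) (x : RSpace n) (F : Fin n → ℂ) (h : Fin n) : ℂ :=
  ∑ l, (outerNormal Ω x l : ℂ) * ((outerNormal Ω x l : ℂ) * F h - (outerNormal Ω x h : ℂ) * F l)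

/-- The explicit expression of the `h`-th component of the tangential gradient with respect to `x`
of the double layer kernel, as a sum of nine terms. -/
def gradientFormula {n : ℕ} (Ω : Set (RSpace n)) (a : (Fin n → ℕ) → ℂ) (S : RSpace n → ℂ)
    (T : Matrix (Fin n) (Fin n) ℝ) (B₁ C : RSpace n → ℂ) (A₂ : RSpace n × ℝ → Fin n → ℂ)
    (h : Fin n) (x y : RSpace n) : ℂ :=
  ((n / (sphereArea n * √(realCoeffTwo a).det)
      * ((∑ i, (x i - y i) * outerNormal Ω y i) / ‖invApply T (x - y)‖ ^ n) : ℝ) : ℂ)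
    * tangentialPart Ω x (fun l =>
        (((∑ j, ∑ z, T⁻¹ j z * (x z - y z) * T⁻¹ j l) / ‖invApply T (x - y)‖ ^ 2 : ℝ) : ℂ)) h
  - tangentialPart Ω x (fun l => (outerNormal Ω y l : ℂ)) h
    / ((sphereArea n * √(realCoeffTwo a).det * ‖invApply T (x - y)‖ ^ n : ℝ) : ℂ)
  - (2 - (n : ℂ)) * ((‖x - y‖ ^ (1 - (n : ℤ)) : ℝ) : ℂ)
    * rowMatCol a (A₂ (polar (x - y))) (outerNormal Ω y)
    * tangentialPart Ω x (fun l => (((x l - y l) / ‖x - y‖ : ℝ) : ℂ)) h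
  - ∑ j, rowMatCol a (fderiv ℝ A₂ (polar (x - y)) (EuclideanSpace.single j 1, 0))
        (outerNormal Ω y)
      * ((‖x - y‖ ^ (-(n : ℤ)) : ℝ) : ℂ)
      * tangentialPart Ω x (fun l =>
          (((if j = l then 1 else 0) * ‖x - y‖
            - (x j - y j) * (x l - y l) / ‖x - y‖ : ℝ) : ℂ)) h
  - rowMatCol a (fderiv ℝ A₂ (polar (x - y)) (0, 1)) (outerNormal Ω y)
    * tangentialPart Ω x (fun l => (((x l - y l) / ‖x - y‖ ^ (n - 1 : ℤ) : ℝ) : ℂ)) h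
  - ∑ j, ∑ z, tangentialPart Ω x (fun l => partialD l (partialD j B₁) (x - y)) h
      * (coeffTwo a j z * (outerNormal Ω y z : ℂ)) * (Real.log ‖x - y‖ : ℂ)
  - rowMatCol a (fun j => partialD j B₁ (x - y)) (outerNormal Ω y)
    * tangentialPart Ω x (fun l => (((x l - y l) / ‖x - y‖ ^ 2 : ℝ) : ℂ)) h
  - ∑ j, ∑ z, tangentialPart Ω x (fun l => partialD l (partialD j C) (x - y)) h
      * (coeffTwo a j z * (outerNormal Ω y z : ℂ))
  - (∑ l, (outerNormal Ω y l : ℂ) * coeffOne a l)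
    * tangentialPart Ω x (fun l => partialD l S (x - y)) h

end

/-! The singular part of `S` is isolated by an explicit construction, and everything else is read
off the resulting expansion of `DS`.

Expansion. Write a⁽²⁾ = T Tᵗ and choose β with 2 a⁽²⁾ β = a⁽¹⁾. The substitution u(x) = exp(-β·x)
v(T⁻¹x) turns P[a,D] u = 0 into Δv + κ v = 0 with κ = a₀ - βᵗ a⁽²⁾ β. A radial v(z) = f(|z|²) solves
this off the origin as soon as 4 s f'' + 2 n f' + κ f = 0. A solution f(s) = s^(1-n/2) G(s) + log s
· J(s) with G and J entire is given by power series for n = 1 and n = 2, and it passes from n to n +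
2 by differentiation in s (`exists_isRadialProfile`). To find the mass at the origin, replace
|T⁻¹x|² by |T⁻¹x|² + ε² and integrate by parts: the equation cancels everything except -4 ε²
f''(|T⁻¹x|² + ε²), which concentrates to a multiple of δ₀ as ε → 0 (`integral_radial_mul`). So
`profileSolution` is a fundamental solution, and expanding its factors along rays gives A₁, b₀ and
B₁. An arbitrary `S` differs from it by a weak solution of the homogeneous equation. Such a solution
is real analytic, by a cut-off and convolution with the explicit solution
(`exists_analytic_of_weak_solution`), so the difference is absorbed by C. Differentiation gives A₂
(`exists_expansion`).

Statement (i). Near a boundary point Ω is {Φ < 0}, with ∇Φ Hölder continuous and nonvanishing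
(`exists_isLocalDefining`). Hence the outer normal is ∇Φ/|∇Φ|, the tangent cone is its orthogonal
complement, and the tangential gradient of a differentiable function is the projection of its
gradient (`tangentialGradient_eq`). The nine terms come from differentiating the expansion of `DS`
once more and contracting with a⁽²⁾ν(y), which cancels the inverse matrix in the leading part
(`gradientFormula_eq`).

Statement (ii). Put w = x - y and g(w) = |T⁻¹w|^(-n). Up to terms of size |w|^(1-n), the gradient of
K in x is a constant times ν(y) g(w) + (w·ν(y)) ∇g(w) (`exists_hessian_splitting`). After projection
to the tangent plane at x, the vector ν(y) has size |w|^α because the normal is Hölder continuous;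
and w·ν(y) has size |w|^(1+α) because the boundary is flat to that order. Each piece is thus of size
|w|^(α-n). The Hölder estimate in x follows from one product estimate,
`memKernelClass_mul_polarLog`, applied to the three pieces. -/

noncomputable section

/-! ### Radial profiles: solutions of the ordinary differential equation in s = |x|². -/

/-- The exponential generating function of a sequence. -/
def egf (c : ℕ → ℂ) (z : ℂ) : ℂ := ∑' k, c k * z ^ k / (k.factorial : ℂ)

lemma egf_summable {c : ℕ → ℂ} {B M : ℝ} (hc : ∀ k, ‖c k‖ ≤ B * M ^ k) (z : ℂ) :
    Summable fun k => c k * z ^ k / (k.factorial : ℂ) := by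
  refine Summable.of_norm_bounded (g := fun k => B * ((M * ‖z‖) ^ k / (k.factorial : ℝ)))
    ((Real.summable_pow_div_factorial _).mul_left B) fun k => ?_
  rw [norm_div, norm_mul, norm_pow, Complex.norm_natCast, mul_pow, ← mul_div_assoc, ← mul_assoc]
  gcongr
  exact hc k

lemma egf_zero (c : ℕ → ℂ) : egf c 0 = c 0 := by
  rw [egf, tsum_eq_single 0]
  · simp
  · intro k hk
    simp [hk]

/-- Differentiation of an exponential generating function is a shift of the sequence, so linear
equations with polynomial coefficients become recursions. Termwise differentiation is justified by a
majorant on the ball of radius ‖z‖ + 1. -/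
lemma hasDerivAt_egf {c : ℕ → ℂ} {B M : ℝ} (hM : 0 ≤ M) (hc : ∀ k, ‖c k‖ ≤ B * M ^ k) (z : ℂ) :
    HasDerivAt (egf c) (egf (fun k => c (k + 1)) z) z := by
  have hB : 0 ≤ B := by simpa using (norm_nonneg _).trans (hc 0)
  set R : ℝ := ‖z‖ + 1
  have hR : 0 < R := by positivity
  let g' : ℕ → ℂ → ℂ := fun k w => c k * ((k : ℂ) * w ^ (k - 1)) / (k.factorial : ℂ)
  let u : ℕ → ℝ := fun k => B * M ^ k * ((k : ℝ) * R ^ (k - 1)) / (k.factorial : ℝ)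
  have hu : Summable u := by
    rw [← summable_nat_add_iff 1]
    have : (fun k => u (k + 1)) = fun k => B * M * ((M * R) ^ k / (k.factorial : ℝ)) := by
      ext k
      simp only [u, Nat.factorial_succ, Nat.cast_mul, add_tsub_cancel_right]
      have : ((k + 1 : ℕ) : ℝ) ≠ 0 := by positivity
      field_simp
      ring_nf
    rw [this]
    exact (Real.summable_pow_div_factorial _).mul_left _
  have key := hasDerivAt_tsum_of_isPreconnected (g := fun k w => c k * w ^ k / (k.factorial : ℂ))
    (g' := g') (t := Metric.ball (0 : ℂ) R) (y₀ := 0) (y := z) hu Metric.isOpen_ball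
    (convex_ball _ _).isPreconnected
    (fun k w _ => ((hasDerivAt_pow k w).const_mul (c k)).div_const _)
    (fun k w hw => ?_) (by simpa using hR) (egf_summable hc 0) (by simp [R])
  · have e : ∑' k, g' k z = egf (fun k => c (k + 1)) z := by
      have hs : Summable fun k => g' k z := by
        refine Summable.of_norm_bounded hu fun k => ?_
        simp only [g', u, norm_div, norm_mul, norm_pow, Complex.norm_natCast]
        gcongr
        · exact hc k
        · simp [R]
      rw [hs.tsum_eq_zero_add]
      simp only [g', egf, Nat.cast_zero, zero_mul, mul_zero, zero_div, zero_add,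
        add_tsub_cancel_right, Nat.factorial_succ, Nat.cast_mul]
      refine tsum_congr fun k => ?_
      have : ((k + 1 : ℕ) : ℂ) ≠ 0 := by exact_mod_cast Nat.succ_ne_zero k
      have h2 : (k.factorial : ℂ) ≠ 0 := by exact_mod_cast k.factorial_ne_zero
      field_simp
    rw [← e]
    exact key
  · simp only [g', u, norm_div, norm_mul, norm_pow, Complex.norm_natCast]
    gcongr
    · exact hc k
    · simpa using le_of_lt (by simpa using hw)

lemma shift_bound {c : ℕ → ℂ} {B M : ℝ} (hc : ∀ k, ‖c k‖ ≤ B * M ^ k) (k : ℕ) :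
    ‖c (k + 1)‖ ≤ B * M * M ^ k := by
  simpa [pow_succ, mul_assoc, mul_comm, mul_left_comm] using hc (k + 1)

lemma differentiable_egf {c : ℕ → ℂ} {B M : ℝ} (hM : 0 ≤ M) (hc : ∀ k, ‖c k‖ ≤ B * M ^ k) :
    Differentiable ℂ (egf c) := fun z => (hasDerivAt_egf hM hc z).differentiableAt

/-- The coefficient recursion that makes `y = egf c` satisfy
`4 z D²y + 2 m Dy + κ y = egf e`, with `D` the derivative. -/
lemma egf_ode {c e : ℕ → ℂ} {B M : ℝ} (hc : ∀ k, ‖c k‖ ≤ B * M ^ k) (m κ z : ℂ)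
    (hrec : ∀ k : ℕ, (4 * k + 2 * m) * c (k + 1) + κ * c k = e k) :
    4 * z * egf (fun k => c (k + 2)) z + 2 * m * egf (fun k => c (k + 1)) z + κ * egf c z
      = egf e z := by
  have s0 := egf_summable hc z
  have s1 := egf_summable (shift_bound hc) z
  have s2 := egf_summable (shift_bound (shift_bound hc)) z
  -- Multiplying by z moves index k to k + 1, and the ratio of factorials produces the factor k.
  have hz : z * egf (fun k => c (k + 2)) z
      = ∑' k : ℕ, (k : ℂ) * c (k + 1) * z ^ k / (k.factorial : ℂ) := by
    have e1 : ∀ k : ℕ, ((k + 1 : ℕ) : ℂ) * c (k + 1 + 1) * z ^ (k + 1) / ((k + 1).factorial : ℂ)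
        = z * (c (k + 2) * z ^ k / (k.factorial : ℂ)) := by
      intro k
      have : ((k + 1 : ℕ) : ℂ) ≠ 0 := by exact_mod_cast Nat.succ_ne_zero k
      have h2 : (k.factorial : ℂ) ≠ 0 := by exact_mod_cast k.factorial_ne_zero
      rw [Nat.factorial_succ, Nat.cast_mul]
      field_simp
      ring_nf
    have hs : Summable fun k : ℕ => (k : ℂ) * c (k + 1) * z ^ k / (k.factorial : ℂ) := by
      rw [← summable_nat_add_iff 1]
      simp_rw [e1]
      exact s2.mul_left z
    rw [hs.tsum_eq_zero_add, egf, ← tsum_mul_left]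
    simp only [e1]
    simp
  have hs : Summable fun k : ℕ => (k : ℂ) * c (k + 1) * z ^ k / (k.factorial : ℂ) := by
    rw [← summable_nat_add_iff 1]
    refine (s2.mul_left z).congr fun k => ?_
    have : ((k + 1 : ℕ) : ℂ) ≠ 0 := by exact_mod_cast Nat.succ_ne_zero k
    have h2 : (k.factorial : ℂ) ≠ 0 := by exact_mod_cast k.factorial_ne_zero
    rw [Nat.factorial_succ, Nat.cast_mul]
    field_simp
    ring_nf
  rw [mul_assoc, hz, egf, egf, egf, ← tsum_mul_left, ← tsum_mul_left, ← tsum_mul_left,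
    ← (hs.mul_left 4).tsum_add (s1.mul_left _),
    ← ((hs.mul_left 4).add (s1.mul_left _)).tsum_add (s0.mul_left _)]
  refine tsum_congr fun k => ?_
  rw [← hrec k]
  ring

/-- Functions of the form `s ^ p G(s) + log s J(s)`. -/
def frobeniusFn (p : ℝ) (G J : ℂ → ℂ) (s : ℝ) : ℂ :=
  ((s ^ p : ℝ) : ℂ) * G s + (Real.log s : ℂ) * J s

/-- The only term that could leave the class is J(s)/s, coming from the logarithm. It is s^(p-1)
times an entire function when p is a nonpositive integer, and it is absent when J = 0. The value
G'(0) is tracked because it is the leading coefficient, from which the mass of δ₀ is computed. -/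
lemma hasDerivAt_frobeniusFn {p : ℝ} {G J : ℂ → ℂ} (hG : Differentiable ℂ G)
    (hJ : Differentiable ℂ J) (hp : J = 0 ∨ ∃ k : ℕ, p = -k) :
    ∃ G' : ℂ → ℂ, Differentiable ℂ G' ∧ G' 0 = p * G 0 + (if p = 0 then J 0 else 0) ∧
      ∀ s : ℝ, 0 < s → HasDerivAt (frobeniusFn p G J) (frobeniusFn (p - 1) G' (deriv J) s) s := by
  obtain ⟨N, hN, hN0, hNJ⟩ : ∃ N : ℂ → ℂ, Differentiable ℂ N ∧ N 0 = (if p = 0 then J 0 else 0) ∧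
      ∀ s : ℝ, 0 < s → ((s ^ (p - 1) : ℝ) : ℂ) * N s = (s : ℂ)⁻¹ * J s := by
    rcases hp with rfl | ⟨k, rfl⟩
    · exact ⟨0, differentiable_const _, by simp, by simp⟩
    -- With p = -k one has s^(p-1) · s^k = s⁻¹; at 0 this factor survives only for k = 0.
    · refine ⟨fun z => z ^ k * J z, (differentiable_id.pow k).mul hJ, ?_, fun s hs => ?_⟩
      · rcases eq_or_ne k 0 with rfl | hk
        · simp
        · simp [hk]
      · rw [Real.rpow_sub hs, Real.rpow_neg hs.le, Real.rpow_natCast, Real.rpow_one]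
        have : (s : ℂ) ≠ 0 := by exact_mod_cast hs.ne'
        push_cast
        field_simp
  have hG1 : Differentiable ℂ (deriv G) := (hG.contDiff (n := 2)).differentiable_deriv_two
  refine ⟨fun z => p * G z + z * deriv G z + N z,
    (((hG.const_mul _).add (differentiable_id.mul hG1)).add hN), by simp [hN0], fun s hs => ?_⟩
  have h1 : HasDerivAt (fun s : ℝ => ((s ^ p : ℝ) : ℂ)) ((p * s ^ (p - 1) : ℝ) : ℂ) s :=
    (Real.hasDerivAt_rpow_const (Or.inl hs.ne')).ofReal_comp
  have h2 : HasDerivAt (fun s : ℝ => G s) (deriv G s) s := (hG s).hasDerivAt.comp_ofReal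
  have h3 : HasDerivAt (fun s : ℝ => J s) (deriv J s) s := (hJ s).hasDerivAt.comp_ofReal
  have h4 : HasDerivAt (fun s : ℝ => (Real.log s : ℂ)) ((s⁻¹ : ℝ) : ℂ) s :=
    (Real.hasDerivAt_log hs.ne').ofReal_comp
  have := (h1.mul h2).add (h4.mul h3)
  refine this.congr_deriv ?_
  have e := hNJ s hs
  have e2 : s ^ p = s ^ (p - 1) * s := by
    rw [← Real.rpow_add_one hs.ne']
    simp
  simp only [frobeniusFn]
  rw [e2, mul_add, e]
  push_cast
  ring

lemma frobeniusFn_smul (p : ℝ) (G J : ℂ → ℂ) (c : ℂ) (s : ℝ) :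
    frobeniusFn p (fun z => c * G z) (fun z => c * J z) s = c * frobeniusFn p G J s := by
  simp only [frobeniusFn]
  ring

lemma differentiable_deriv_of_entire {J : ℂ → ℂ} (hJ : Differentiable ℂ J) :
    Differentiable ℂ (deriv J) := (hJ.contDiff (n := 2)).differentiable_deriv_two

/-- The radial profile, as a function of `s = |x|²`, of a solution of `Δ u + κ u = 0` in
`ℝⁿ \ {0}` with the singularity of a fundamental solution. -/
structure IsRadialProfile (n : ℕ) (κ : ℂ) (G J : ℂ → ℂ) : Prop where
  diffG : Differentiable ℂ G
  diffJ : Differentiable ℂ J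
  odd_dim : Odd n → J = 0
  leading_two : n = 2 → J 0 = 1
  leading : n ≠ 2 → G 0 = 1
  ode : ∃ f' f'' : ℝ → ℂ, ∀ s : ℝ, 0 < s →
    HasDerivAt (frobeniusFn (1 - n / 2) G J) (f' s) s ∧ HasDerivAt f' (f'' s) s ∧
    4 * s * f'' s + 2 * n * f' s + κ * frobeniusFn (1 - n / 2) G J s = 0

lemma exponent_alternative {n : ℕ} (hn : 2 ≤ n) {J : ℂ → ℂ} (hJ : Odd n → J = 0) :
    J = 0 ∨ ∃ k : ℕ, (1 - (n : ℝ) / 2) = -k := by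
  rcases Nat.even_or_odd' n with ⟨m, h | h⟩
  · right
    refine ⟨m - 1, ?_⟩
    rw [Nat.cast_sub (by omega), h]
    push_cast
    ring
  · exact Or.inl (hJ ⟨m, h⟩)

/-- Dimension one is outside the theorem and serves as the seed for the odd dimensions. Putting f =
s^(1/2) G turns the equation into 4 s G'' + 6 G' + κ G = 0, hence the denominators 4k + 6. -/
lemma isRadialProfile_one (κ : ℂ) : ∃ G J, IsRadialProfile 1 κ G J := by
  let g : ℕ → ℂ := fun k => Nat.rec 1 (fun k c => -κ * c / (4 * k + 6)) k
  have g1 : ∀ k : ℕ, g (k + 1) = -κ * g k / (4 * k + 6) := fun k => rfl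
  have hden : ∀ k : ℕ, (4 * (k : ℂ) + 6) ≠ 0 := fun k => by
    exact_mod_cast (by omega : 4 * k + 6 ≠ 0)
  have hb : ∀ k, ‖g k‖ ≤ 1 * ‖κ‖ ^ k := by
    intro k
    induction k with
    | zero => simp [g]
    | succ k ih =>
      rw [g1, norm_div, norm_mul, norm_neg]
      have h6 : (1 : ℝ) ≤ ‖(4 * (k : ℂ) + 6)‖ := by
        have : (4 * (k : ℂ) + 6) = ((4 * k + 6 : ℕ) : ℂ) := by push_cast; ring
        rw [this, Complex.norm_natCast]
        exact_mod_cast (by omega)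
      calc ‖κ‖ * ‖g k‖ / ‖(4 * (k : ℂ) + 6)‖ ≤ ‖κ‖ * ‖g k‖ := div_le_self (by positivity) h6
        _ ≤ ‖κ‖ * (1 * ‖κ‖ ^ k) := by gcongr
        _ = 1 * ‖κ‖ ^ (k + 1) := by ring
  have d0 := hasDerivAt_egf (norm_nonneg κ) hb
  have d1 := hasDerivAt_egf (norm_nonneg κ) (shift_bound hb)
  refine ⟨egf g, 0, differentiable_egf (norm_nonneg κ) hb, differentiable_const _, fun _ => rfl,
    by simp, fun _ => by simp [egf_zero, g], ?_⟩
  let G := egf g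
  let G1 := egf fun k => g (k + 1)
  let G2 := egf fun k => g (k + 2)
  refine ⟨fun s => ((1 / 2 * s ^ (-(1 / 2) : ℝ) : ℝ) : ℂ) * G s + ((s ^ (1 / 2 : ℝ) : ℝ) : ℂ) * G1 s,
    fun s => ((1 / 2 * (-(1 / 2) * s ^ (-(3 / 2) : ℝ)) : ℝ) : ℂ) * G s
      + ((1 / 2 * s ^ (-(1 / 2) : ℝ) : ℝ) : ℂ) * G1 s
      + (((1 / 2 * s ^ (-(1 / 2) : ℝ) : ℝ) : ℂ) * G1 s + ((s ^ (1 / 2 : ℝ) : ℝ) : ℂ) * G2 s),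
    fun s hs => ?_⟩
  have hp : HasDerivAt (fun s : ℝ => ((s ^ (1 / 2 : ℝ) : ℝ) : ℂ))
      ((1 / 2 * s ^ (-(1 / 2) : ℝ) : ℝ) : ℂ) s := by
    have := (Real.hasDerivAt_rpow_const (p := 1 / 2) (Or.inl hs.ne')).ofReal_comp
    convert this using 4
    norm_num
  have hm : HasDerivAt (fun s : ℝ => ((1 / 2 * s ^ (-(1 / 2) : ℝ) : ℝ) : ℂ))
      ((1 / 2 * (-(1 / 2) * s ^ (-(3 / 2) : ℝ)) : ℝ) : ℂ) s := by
    have := ((Real.hasDerivAt_rpow_const (p := -(1 / 2)) (Or.inl hs.ne')).const_mul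
      (1 / 2)).ofReal_comp
    convert this using 5
    norm_num
  have hG : HasDerivAt (fun s : ℝ => G s) (G1 s) s := (d0 s).comp_ofReal
  have hG1 : HasDerivAt (fun s : ℝ => G1 s) (G2 s) s := (d1 s).comp_ofReal
  refine ⟨?_, (hm.mul hG).add (hp.mul hG1), ?_⟩
  · have e : frobeniusFn (1 - (1 : ℕ) / 2) (egf g) 0 = fun s : ℝ => ((s ^ (1 / 2 : ℝ) : ℝ) : ℂ) * G s := by
      ext s
      simp only [frobeniusFn, Pi.zero_apply, mul_zero, add_zero, G]
      norm_num
    rw [e]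
    exact hp.mul hG
  · have ode := egf_ode hb (3 : ℂ) κ s (e := fun _ => 0) (fun k => by
      rw [g1]
      have := hden k
      field_simp
      ring)
    have h0 : egf (fun _ => 0) (s : ℂ) = 0 := by simp [egf]
    rw [h0] at ode
    change 4 * (s : ℂ) * G2 s + 2 * 3 * G1 s + κ * G s = 0 at ode
    have e1 : s ^ (1 / 2 : ℝ) = s * s ^ (-(1 / 2) : ℝ) := by
      rw [← Real.rpow_one_add' hs.le (by norm_num)]
      norm_num
    have e2 : s ^ (-(1 / 2) : ℝ) = s * s ^ (-(3 / 2) : ℝ) := by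
      rw [← Real.rpow_one_add' hs.le (by norm_num)]
      norm_num
    have e3 : frobeniusFn (1 - (1 : ℕ) / 2) (egf g) 0 s = ((s ^ (1 / 2 : ℝ) : ℝ) : ℂ) * G s := by
      simp only [frobeniusFn, Pi.zero_apply, mul_zero, add_zero, G]
      norm_num
    beta_reduce
    rw [e3, e1, e2]
    push_cast
    linear_combination (s * s * ((s ^ (-(3 / 2) : ℝ) : ℝ) : ℂ)) * ode

/-- For f = H + log s · J the coefficient of log s gives 4 s J'' + 4 J' + κ J = 0. The remaining
terms give 4 s H'' + 4 H' + κ H = -8 J', since the contributions J/s cancel. Both equations are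
recursions for Taylor coefficients. -/
lemma isRadialProfile_two (κ : ℂ) : ∃ G J, IsRadialProfile 2 κ G J := by
  let j : ℕ → ℂ := fun k => Nat.rec 1 (fun k c => -κ * c / (4 * (k + 1))) k
  have j1 : ∀ k : ℕ, j (k + 1) = -κ * j k / (4 * (k + 1)) := fun k => rfl
  let h : ℕ → ℂ := fun k => Nat.rec 0 (fun k c => (-κ * c - 8 * j (k + 1)) / (4 * (k + 1))) k
  have h1 : ∀ k : ℕ, h (k + 1) = (-κ * h k - 8 * j (k + 1)) / (4 * (k + 1)) := fun k => rfl
  have hden : ∀ k : ℕ, (k : ℂ) + 1 ≠ 0 := fun k => by exact_mod_cast (by omega : k + 1 ≠ 0)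
  have hnorm : ∀ k : ℕ, (4 : ℝ) ≤ ‖(4 * ((k : ℂ) + 1))‖ := fun k => by
    have : (4 * ((k : ℂ) + 1)) = ((4 * (k + 1) : ℕ) : ℂ) := by push_cast; ring
    rw [this, Complex.norm_natCast]
    exact_mod_cast (by omega)
  have hM : (0 : ℝ) ≤ ‖κ‖ := norm_nonneg κ
  have bj : ∀ k, ‖j k‖ ≤ 1 * ‖κ‖ ^ k := by
    intro k
    induction k with
    | zero => simp [j]
    | succ k ih =>
      rw [j1, norm_div, norm_mul, norm_neg]
      calc ‖κ‖ * ‖j k‖ / ‖(4 * ((k : ℂ) + 1))‖ ≤ ‖κ‖ * ‖j k‖ :=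
            div_le_self (by positivity) (by linarith [hnorm k])
        _ ≤ ‖κ‖ * (1 * ‖κ‖ ^ k) := by gcongr
        _ = 1 * ‖κ‖ ^ (k + 1) := by ring
  -- The constant 4 closes the induction: the recursion bounds the next coefficient by (4 + 8)/4 = 3
  -- times ‖κ‖^(k+1).
  have bh : ∀ k, ‖h k‖ ≤ 4 * ‖κ‖ ^ k := by
    intro k
    induction k with
    | zero => simp [h]
    | succ k ih =>
      rw [h1, norm_div, div_le_iff₀ (by linarith [hnorm k])]
      calc ‖-κ * h k - 8 * j (k + 1)‖ ≤ ‖κ‖ * ‖h k‖ + 8 * ‖j (k + 1)‖ := by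
            refine (norm_sub_le _ _).trans ?_
            simp
        _ ≤ ‖κ‖ * (4 * ‖κ‖ ^ k) + 8 * (1 * ‖κ‖ ^ (k + 1)) := by gcongr; exact bj (k + 1)
        _ = 4 * ‖κ‖ ^ (k + 1) * 3 := by ring
        _ ≤ _ := by gcongr; linarith [hnorm k]
  have dj := hasDerivAt_egf hM bj
  have dj1 := hasDerivAt_egf hM (shift_bound bj)
  have dh := hasDerivAt_egf hM bh
  have dh1 := hasDerivAt_egf hM (shift_bound bh)
  refine ⟨egf h, egf j, differentiable_egf hM bh, differentiable_egf hM bj, fun hodd => by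
    exact absurd hodd (by decide), fun _ => by simp [egf_zero, j], by simp, ?_⟩
  let H := egf h
  let H1 := egf fun k => h (k + 1)
  let H2 := egf fun k => h (k + 2)
  let J := egf j
  let J1 := egf fun k => j (k + 1)
  let J2 := egf fun k => j (k + 2)
  have e : frobeniusFn (1 - (2 : ℕ) / 2) (egf h) (egf j)
      = fun s : ℝ => H s + (Real.log s : ℂ) * J s := by
    ext s
    simp [frobeniusFn, H, J]
  refine ⟨fun s => H1 s + (((s⁻¹ : ℝ) : ℂ) * J s + (Real.log s : ℂ) * J1 s),
    fun s => H2 s + (((-(s ^ 2)⁻¹ : ℝ) : ℂ) * J s + ((s⁻¹ : ℝ) : ℂ) * J1 s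
      + (((s⁻¹ : ℝ) : ℂ) * J1 s + (Real.log s : ℂ) * J2 s)), fun s hs => ?_⟩
  have hl : HasDerivAt (fun s : ℝ => (Real.log s : ℂ)) ((s⁻¹ : ℝ) : ℂ) s :=
    (Real.hasDerivAt_log hs.ne').ofReal_comp
  have hi : HasDerivAt (fun s : ℝ => ((s⁻¹ : ℝ) : ℂ)) ((-(s ^ 2)⁻¹ : ℝ) : ℂ) s :=
    (hasDerivAt_inv hs.ne').ofReal_comp
  have hH : HasDerivAt (fun s : ℝ => H s) (H1 s) s := (dh s).comp_ofReal
  have hH1 : HasDerivAt (fun s : ℝ => H1 s) (H2 s) s := (dh1 s).comp_ofReal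
  have hJ : HasDerivAt (fun s : ℝ => J s) (J1 s) s := (dj s).comp_ofReal
  have hJ1 : HasDerivAt (fun s : ℝ => J1 s) (J2 s) s := (dj1 s).comp_ofReal
  refine ⟨?_, hH1.add ((hi.mul hJ).add (hl.mul hJ1)), ?_⟩
  · rw [e]
    exact hH.add (hl.mul hJ)
  · have oj := egf_ode bj (2 : ℂ) κ s (e := fun _ => 0) (fun k => by
      rw [j1]
      have := hden k
      field_simp
      ring)
    have oh := egf_ode bh (2 : ℂ) κ s (e := fun k => (-8) * j (k + 1)) (fun k => by
      rw [h1]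
      have := hden k
      field_simp
      ring)
    have h0 : egf (fun _ => 0) (s : ℂ) = 0 := by simp [egf]
    have h8 : egf (fun k => (-8) * j (k + 1)) (s : ℂ) = -8 * J1 s := by
      simp only [egf, J1, mul_assoc, mul_div_assoc, tsum_mul_left]
    rw [h0] at oj
    rw [h8] at oh
    change 4 * (s : ℂ) * J2 s + 2 * 2 * J1 s + κ * J s = 0 at oj
    change 4 * (s : ℂ) * H2 s + 2 * 2 * H1 s + κ * H s = -8 * J1 s at oh
    have hs' : (s : ℂ) ≠ 0 := by exact_mod_cast hs.ne'
    rw [e]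
    push_cast
    have : (4 * (s : ℂ)) * (H2 s + (-((s : ℂ) ^ 2)⁻¹ * J s + (s : ℂ)⁻¹ * J1 s
        + ((s : ℂ)⁻¹ * J1 s + (Real.log s : ℂ) * J2 s)))
        = 4 * s * H2 s - 4 * (s : ℂ)⁻¹ * J s + 8 * J1 s + (Real.log s : ℂ) * (4 * s * J2 s) := by
      field_simp
      ring
    rw [this]
    linear_combination oh + (Real.log s : ℂ) * oj

/-- Differentiating 4 s f'' + 2 n f' + κ f = 0 gives 4 s (f')'' + 2 (n + 2) (f')' + κ f' = 0, so f'
is, up to a constant, a profile in dimension n + 2. -/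
lemma IsRadialProfile.exists_add_two {n : ℕ} (hn : 1 ≤ n) {κ : ℂ} {G J : ℂ → ℂ}
    (h : IsRadialProfile n κ G J) : ∃ G J, IsRadialProfile (n + 2) κ G J := by
  have hp : J = 0 ∨ ∃ k : ℕ, (1 - (n : ℝ) / 2) = -k := by
    rcases Nat.lt_or_ge n 2 with h1 | h2
    · exact Or.inl (h.odd_dim (by obtain rfl : n = 1 := by omega
                                  exact odd_one))
    · exact exponent_alternative h2 h.odd_dim
  have hp' : deriv J = 0 ∨ ∃ k : ℕ, (1 - (n : ℝ) / 2 - 1) = -k := by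
    rcases hp with rfl | ⟨k, hk⟩
    · left
      ext z
      simp
    · right
      exact ⟨k + 1, by rw [hk]; push_cast; ring⟩
  have hp'' : deriv (deriv J) = 0 ∨ ∃ k : ℕ, (1 - (n : ℝ) / 2 - 1 - 1) = -k := by
    rcases hp' with h0 | ⟨k, hk⟩
    · left
      ext z
      simp [h0]
    · right
      exact ⟨k + 1, by rw [hk]; push_cast; ring⟩
  have hJ1 := differentiable_deriv_of_entire h.diffJ
  have hJ2 := differentiable_deriv_of_entire hJ1
  obtain ⟨G1, dG1, G10, hd1⟩ := hasDerivAt_frobeniusFn h.diffG h.diffJ hp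
  obtain ⟨G2, dG2, -, hd2⟩ := hasDerivAt_frobeniusFn dG1 hJ1 hp'
  obtain ⟨G3, dG3, -, hd3⟩ := hasDerivAt_frobeniusFn dG2 hJ2 hp''
  obtain ⟨f', f'', hode⟩ := h.ode
  let F0 := frobeniusFn (1 - (n : ℝ) / 2) G J
  let F1 := frobeniusFn (1 - (n : ℝ) / 2 - 1) G1 (deriv J)
  let F2 := frobeniusFn (1 - (n : ℝ) / 2 - 1 - 1) G2 (deriv (deriv J))
  let F3 := frobeniusFn (1 - (n : ℝ) / 2 - 1 - 1 - 1) G3 (deriv (deriv (deriv J)))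
  have e1 : ∀ s : ℝ, 0 < s → f' s = F1 s := fun s hs => (hode s hs).1.unique (hd1 s hs)
  have e2 : ∀ s : ℝ, 0 < s → f'' s = F2 s := fun s hs => by
    refine (hode s hs).2.1.unique ((hd2 s hs).congr_of_eventuallyEq ?_)
    filter_upwards [lt_mem_nhds hs] with t ht using e1 t ht
  have ode : ∀ s : ℝ, 0 < s → 4 * s * F2 s + 2 * n * F1 s + κ * F0 s = 0 := fun s hs => by
    rw [← e1 s hs, ← e2 s hs]
    exact (hode s hs).2.2
  have ode' : ∀ s : ℝ, 0 < s → 4 * s * F3 s + 2 * (n + 2) * F2 s + κ * F1 s = 0 := fun s hs => by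
    have hid : HasDerivAt (fun s : ℝ => (4 * s : ℂ)) 4 s := by
      simpa using ((hasDerivAt_id s).ofReal_comp.const_mul (4 : ℂ))
    have d := ((hid.mul (hd3 s hs)).add ((hd2 s hs).const_mul (2 * n : ℂ))).add
      ((hd1 s hs).const_mul κ)
    have z : HasDerivAt (fun _ : ℝ => (0 : ℂ)) 0 s := hasDerivAt_const _ _
    have := d.unique (z.congr_of_eventuallyEq (by
      filter_upwards [lt_mem_nhds hs] with t ht using ode t ht))
    simp only [F1, F2, F3]
    linear_combination this
  -- The leading coefficient of f' is 1 - n/2 for n ≠ 2. For n = 2 it is J(0) = 1, coming from the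
  -- derivative of the logarithm. It is nonzero in both cases and can be normalised.
  obtain ⟨c, hc, hcG⟩ : ∃ c : ℂ, c ≠ 0 ∧ c * G1 0 = 1 := by
    have : G1 0 ≠ 0 := by
      rw [G10]
      rcases eq_or_ne n 2 with rfl | h2
      · simp [h.leading_two rfl]
      · have hne : (1 - (n : ℝ) / 2) ≠ 0 := fun h0 => h2 (by
          have : (n : ℝ) = 2 := by linarith
          exact_mod_cast this)
        rw [if_neg hne, h.leading h2]
        rw [add_zero, mul_one]
        exact_mod_cast hne
    exact ⟨(G1 0)⁻¹, inv_ne_zero this, inv_mul_cancel₀ this⟩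
  have hfn : frobeniusFn (1 - ((n + 2 : ℕ) : ℝ) / 2) (fun z => c * G1 z) (fun z => c * deriv J z)
      = fun s => c * F1 s := by
    ext s
    rw [frobeniusFn_smul]
    simp only [F1]
    congr 2
    push_cast
    ring
  refine ⟨fun z => c * G1 z, fun z => c * deriv J z, dG1.const_mul c, hJ1.const_mul c, fun ho => ?_,
    by omega, fun _ => hcG, fun s => c * F2 s, fun s => c * F3 s, fun s hs => ⟨?_, ?_, ?_⟩⟩
  · have : J = 0 := h.odd_dim (by simpa [Nat.odd_add, parity_simps] using ho)
    ext z
    simp [this]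
  · rw [hfn]
    exact (hd2 s hs).const_mul c
  · exact (hd3 s hs).const_mul c
  · rw [hfn]
    push_cast
    linear_combination c * ode' s hs

/-- Radial profiles exist in every dimension. -/
theorem exists_isRadialProfile (n : ℕ) (hn : 1 ≤ n) (κ : ℂ) : ∃ G J, IsRadialProfile n κ G J := by
  induction n using Nat.twoStepInduction with
  | zero => omega
  | one => exact isRadialProfile_one κ
  | more n ih _ =>
    rcases Nat.eq_zero_or_pos n with rfl | hpos
    · exact isRadialProfile_two κ
    · obtain ⟨G, J, h⟩ := ih hpos
      exact h.exists_add_two hpos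

end

noncomputable section

/-! ### Linear algebra of the principal part -/

lemma coeffTwo_symm {n : ℕ} (a : (Fin n → ℕ) → ℂ) (l j : Fin n) :
    coeffTwo a l j = coeffTwo a j l := by
  simp only [coeffTwo, add_comm (Pi.single j 1 : Fin n → ℕ), eq_comm (a := j)]

lemma coeffTwo_eq_ofReal {n : ℕ} {a : (Fin n → ℕ) → ℂ} (har : HasRealPrincipalPart a)
    (l j : Fin n) : coeffTwo a l j = (realCoeffTwo a l j : ℂ) :=
  Complex.ext (by simp [realCoeffTwo]) (by simpa using har l j)

lemma realCoeffTwo_symm {n : ℕ} (a : (Fin n → ℕ) → ℂ) (l j : Fin n) :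
    realCoeffTwo a l j = realCoeffTwo a j l := by
  simp only [realCoeffTwo, coeffTwo_symm a l j]

lemma exists_eq_single_add_single {n : ℕ} {γ : Fin n → ℕ} (h : ∑ i, γ i = 2) :
    ∃ l j, γ = Pi.single l 1 + Pi.single j 1 := by
  have step : ∀ (δ : Fin n → ℕ) (m : ℕ), ∑ i, δ i = m + 1 →
      ∃ (l : Fin n) (δ' : Fin n → ℕ), δ = Pi.single l 1 + δ' ∧ ∑ i, δ' i = m := by
    intro δ m hδ
    obtain ⟨l, -, hl⟩ : ∃ l ∈ Finset.univ, δ l ≠ 0 := by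
      apply Finset.exists_ne_zero_of_sum_ne_zero
      omega
    have e : δ = Pi.single l 1 + (δ - Pi.single l 1) := by
      ext i
      rcases eq_or_ne i l with rfl | hi
      · simp; omega
      · simp [hi]
    refine ⟨l, _, e, ?_⟩
    have := congrArg (fun f : Fin n → ℕ => ∑ i, f i) e
    simp only [Pi.add_apply, Finset.sum_add_distrib, Finset.sum_pi_single', Finset.mem_univ,
      if_true] at this
    omega
  obtain ⟨l, δ, rfl, hδ⟩ := step γ 1 h
  obtain ⟨j, δ', rfl, hδ'⟩ := step δ 0 hδ
  refine ⟨l, j, ?_⟩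
  have : δ' = 0 := by
    ext i
    exact (Finset.sum_eq_zero_iff.1 hδ') i (Finset.mem_univ i)
  simp [this]

lemma single_add_single_eq_iff {n : ℕ} (l j l' j' : Fin n) :
    (Pi.single l' 1 + Pi.single j' 1 : Fin n → ℕ) = Pi.single l 1 + Pi.single j 1 ↔
      (l' = l ∧ j' = j) ∨ (l' = j ∧ j' = l) := by
  constructor
  · intro h
    have h1 := congrFun h l'
    have h2 := congrFun h j'
    have h3 := congrFun h l
    have h4 := congrFun h j
    simp only [Pi.add_apply, Pi.single_apply] at h1 h2 h3 h4
    grind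
  · rintro (⟨rfl, rfl⟩ | ⟨rfl, rfl⟩)
    · rfl
    · exact add_comm _ _

/-- A mixed multi-index e_l + e_j comes from the two ordered pairs (l, j) and (j, l), a pure one
from a single pair. This is exactly compensated by the factor 1/2 in the off-diagonal entries. -/
lemma principalSymbol_eq {n : ℕ} (a : (Fin n → ℕ) → ℂ) (ξ : RSpace n) :
    principalSymbol a ξ = ∑ l, ∑ j, coeffTwo a l j * ξ l * ξ j := by
  have hmaps : ∀ p ∈ (Finset.univ : Finset (Fin n × Fin n)),
      (Pi.single p.1 1 + Pi.single p.2 1 : Fin n → ℕ)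
        ∈ Finset.piAntidiag (Finset.univ : Finset (Fin n)) 2 := by
    intro p _
    simp [Finset.mem_piAntidiag, Finset.sum_add_distrib]
  rw [principalSymbol, ← Fintype.sum_prod_type' (fun l j => coeffTwo a l j * ξ l * ξ j),
    ← Finset.sum_fiberwise_of_maps_to hmaps]
  refine Finset.sum_congr rfl fun γ hγ => ?_
  obtain ⟨l, j, rfl⟩ := exists_eq_single_add_single (Finset.mem_piAntidiag.1 hγ).1
  have hprod : ∀ l j : Fin n, ∏ i, (ξ i : ℂ) ^ (Pi.single l 1 + Pi.single j 1 : Fin n → ℕ) i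
      = ξ l * ξ j := by
    intro l j
    have h1 : ∀ l : Fin n, ∏ i, (ξ i : ℂ) ^ (Pi.single l 1 : Fin n → ℕ) i = ξ l := by
      intro l
      rw [Finset.prod_eq_single l]
      · simp
      · intro b _ hb
        simp [hb]
      · simp
    simp only [Pi.add_apply, pow_add, Finset.prod_mul_distrib, h1]
  rw [hprod]
  simp only [single_add_single_eq_iff]
  rcases eq_or_ne l j with rfl | hlj
  · have : (Finset.univ.filter fun p : Fin n × Fin n => (p.1 = l ∧ p.2 = l) ∨ (p.1 = l ∧ p.2 = l))
        = {(l, l)} := by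
      ext ⟨p, q⟩
      simp
    rw [this, Finset.sum_singleton]
    simp only [coeffTwo, if_true]
    ring
  · have : (Finset.univ.filter fun p : Fin n × Fin n => (p.1 = l ∧ p.2 = j) ∨ (p.1 = j ∧ p.2 = l))
        = {(l, j), (j, l)} := by
      ext ⟨p, q⟩
      simp
    rw [this, Finset.sum_pair (by simp [hlj])]
    simp only [coeffTwo, if_neg hlj, if_neg hlj.symm, add_comm (Pi.single j 1 : Fin n → ℕ)]
    ring

/-- By homogeneity, the lower bound on the unit sphere makes the real symmetric matrix positive
definite, so it has the form Bᵗ B; T is then Bᵗ. -/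
lemma exists_factor {n : ℕ} {a : (Fin n → ℕ) → ℂ} (ha : IsElliptic a)
    (har : HasRealPrincipalPart a) :
    ∃ T : Matrix (Fin n) (Fin n) ℝ, IsUnit T ∧ realCoeffTwo a = T * T.transpose := by
  obtain ⟨c, hc, hell⟩ := ha
  have hquad : ∀ ξ : RSpace n,
      (principalSymbol a ξ).re = ∑ l, ∑ j, realCoeffTwo a l j * ξ l * ξ j := by
    intro ξ
    rw [principalSymbol_eq]
    simp only [coeffTwo_eq_ofReal har]
    norm_cast
  have hpos : (realCoeffTwo a).PosDef := by
    refine Matrix.PosDef.of_dotProduct_mulVec_pos ?_ fun v hv => ?_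
    · ext l j
      simp [realCoeffTwo_symm a l j]
    · set x : RSpace n := WithLp.toLp 2 v
      have hx : x ≠ 0 := fun h => hv (by simpa [x] using h)
      have hx' : 0 < ‖x‖ := norm_pos_iff.2 hx
      have h1 := hell (‖x‖⁻¹ • x) (by rw [norm_smul, norm_inv, norm_norm, inv_mul_cancel₀ hx'.ne'])
      rw [hquad] at h1
      have h2 : ∑ l, ∑ j, realCoeffTwo a l j * (‖x‖⁻¹ • x) l * (‖x‖⁻¹ • x) j
          = (‖x‖⁻¹) ^ 2 * ∑ l, ∑ j, realCoeffTwo a l j * v l * v j := by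
        simp only [Finset.mul_sum, PiLp.smul_apply, smul_eq_mul, x]
        refine Finset.sum_congr rfl fun l _ => Finset.sum_congr rfl fun j _ => ?_
        ring
      rw [h2] at h1
      have h3 : star v ⬝ᵥ (realCoeffTwo a).mulVec v = ∑ l, ∑ j, realCoeffTwo a l j * v l * v j := by
        simp only [dotProduct, Matrix.mulVec, Finset.mul_sum]
        refine Finset.sum_congr rfl fun l _ => Finset.sum_congr rfl fun j _ => ?_
        simp
        ring
      rw [h3]
      by_contra hcon
      push Not at hcon
      have : (‖x‖⁻¹) ^ 2 * ∑ l, ∑ j, realCoeffTwo a l j * v l * v j ≤ 0 :=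
        mul_nonpos_of_nonneg_of_nonpos (by positivity) hcon
      linarith
  obtain ⟨B, hB⟩ : ∃ B : Matrix (Fin n) (Fin n) ℝ, realCoeffTwo a = B.conjTranspose * B := by
    open scoped MatrixOrder Matrix.Norms.L2Operator in
    exact CStarAlgebra.nonneg_iff_eq_star_mul_self.mp hpos.posSemidef.nonneg
  refine ⟨B.transpose, ?_, by rw [hB, Matrix.conjTranspose_eq_transpose_of_trivial, Matrix.transpose_transpose]⟩
  have hdet := hpos.det_pos
  rw [hB, Matrix.det_mul] at hdet
  rw [Matrix.isUnit_iff_isUnit_det, Matrix.det_transpose, isUnit_iff_ne_zero]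
  intro h0
  simp [h0] at hdet

section Factor

variable {n : ℕ} {A T : Matrix (Fin n) (Fin n) ℝ}

lemma invApply_apply (T : Matrix (Fin n) (Fin n) ℝ) (x : RSpace n) (i : Fin n) :
    invApply T x i = ∑ j, T⁻¹ i j * x j := by
  simp [invApply, Matrix.toEuclideanLin, Matrix.toLpLin, Matrix.mulVec, dotProduct]

lemma factor_inv (hA : A = T * T.transpose) (i j : Fin n) :
    A⁻¹ i j = ∑ k, T⁻¹ k i * T⁻¹ k j := by
  rw [hA, Matrix.mul_inv_rev, ← Matrix.transpose_nonsing_inv, Matrix.mul_apply]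
  rfl

lemma factor_isUnit_det (hT : IsUnit T) (hA : A = T * T.transpose) : IsUnit A.det := by
  rw [Matrix.isUnit_iff_isUnit_det] at hT
  rw [hA, Matrix.det_mul, Matrix.det_transpose]
  exact hT.mul hT

lemma sqrt_det_eq (hA : A = T * T.transpose) : √A.det = |T.det| := by
  rw [hA, Matrix.det_mul, Matrix.det_transpose, Real.sqrt_mul_self_eq_abs]

/-- The covector `xᵗ A⁻¹`. -/
def invForm (A : Matrix (Fin n) (Fin n) ℝ) (x : RSpace n) (j : Fin n) : ℝ := ∑ i, x i * A⁻¹ i j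

lemma invForm_eq (hA : A = T * T.transpose) (x : RSpace n) (l : Fin n) :
    invForm A x l = ∑ j, ∑ z, T⁻¹ j z * x z * T⁻¹ j l := by
  simp only [invForm, factor_inv hA, Finset.mul_sum]
  rw [Finset.sum_comm]
  refine Finset.sum_congr rfl fun l _ => Finset.sum_congr rfl fun j _ => ?_
  ring

lemma norm_invApply_sq (hA : A = T * T.transpose) (x : RSpace n) :
    ‖invApply T x‖ ^ 2 = ∑ l, invForm A x l * x l := by
  have h1 : ∀ k, (invApply T x k) ^ 2 = ∑ l, ∑ z, T⁻¹ k z * x z * T⁻¹ k l * x l := by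
    intro k
    rw [invApply_apply, pow_two, Finset.sum_mul_sum, Finset.sum_comm]
    refine Finset.sum_congr rfl fun l _ => Finset.sum_congr rfl fun z _ => ?_
    ring
  rw [EuclideanSpace.real_norm_sq_eq]
  simp only [h1, invForm_eq hA, Finset.sum_mul]
  exact Finset.sum_comm

lemma sum_mul_invForm (hT : IsUnit T) (hA : A = T * T.transpose) (x : RSpace n) (l : Fin n) :
    ∑ j, A j l * invForm A x j = x l := by
  have hdet := factor_isUnit_det hT hA
  have h1 : ∀ i, ∑ j, A⁻¹ i j * A j l = if i = l then 1 else 0 := by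
    intro i
    rw [← Matrix.mul_apply, Matrix.nonsing_inv_mul _ hdet, Matrix.one_apply]
  calc ∑ j, A j l * invForm A x j = ∑ i, x i * ∑ j, A⁻¹ i j * A j l := by
        simp only [invForm, Finset.mul_sum]
        rw [Finset.sum_comm]
        refine Finset.sum_congr rfl fun l _ => Finset.sum_congr rfl fun j _ => ?_
        ring
    _ = x l := by simp [h1]

lemma factor_inv_symm (hA : A = T * T.transpose) (l j : Fin n) : A⁻¹ l j = A⁻¹ j l := by
  rw [factor_inv hA, factor_inv hA]
  exact Finset.sum_congr rfl fun k _ => by ring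

lemma sum_mul_inv (hT : IsUnit T) (hA : A = T * T.transpose) :
    ∑ l, ∑ j, A l j * A⁻¹ l j = n := by
  have hdet := factor_isUnit_det hT hA
  have h1 : ∀ l, ∑ j, A l j * A⁻¹ l j = 1 := by
    intro l
    have : ∑ j, A l j * A⁻¹ l j = (A * A⁻¹) l l := by
      rw [Matrix.mul_apply]
      exact Finset.sum_congr rfl fun j _ => by rw [factor_inv_symm hA l j]
    rw [this, Matrix.mul_nonsing_inv _ hdet, Matrix.one_apply_eq]
  simp [h1]

lemma sum_mul_invForm_mul_invForm (hT : IsUnit T) (hA : A = T * T.transpose) (x : RSpace n) :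
    ∑ l, ∑ j, A l j * invForm A x l * invForm A x j = ‖invApply T x‖ ^ 2 := by
  rw [norm_invApply_sq hA, Finset.sum_comm]
  refine Finset.sum_congr rfl fun j _ => ?_
  rw [← Finset.sum_mul, sum_mul_invForm hT hA x j, mul_comm]

lemma invApply_ne_zero (hT : IsUnit T) {x : RSpace n} (hx : x ≠ 0) : invApply T x ≠ 0 := by
  intro h
  apply hx
  have hdet : IsUnit T.det := (Matrix.isUnit_iff_isUnit_det _).1 hT
  have h1 : Matrix.toEuclideanLin T (invApply T x) = x := by
    ext i
    have h2 : (T * T⁻¹).mulVec (WithLp.ofLp x) i = x i := by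
      rw [Matrix.mul_nonsing_inv _ hdet, Matrix.one_mulVec]
    rw [← Matrix.mulVec_mulVec] at h2
    simpa [invApply, Matrix.toEuclideanLin, Matrix.toLpLin] using h2
  rw [← h1, h, map_zero]

/-- `x ↦ T⁻¹ x` as a continuous linear map. -/
def invApplyL (T : Matrix (Fin n) (Fin n) ℝ) : RSpace n →L[ℝ] RSpace n :=
  LinearMap.toContinuousLinearMap (Matrix.toEuclideanLin T⁻¹)

lemma invApplyL_apply (T : Matrix (Fin n) (Fin n) ℝ) (x : RSpace n) :
    invApplyL T x = invApply T x := rfl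

lemma inner_invApply_single (hA : A = T * T.transpose) (x : RSpace n) (j : Fin n) :
    inner ℝ (invApply T x) (invApply T (EuclideanSpace.single j 1)) = invForm A x j := by
  rw [invForm_eq hA, PiLp.inner_apply]
  refine Finset.sum_congr rfl fun k _ => ?_
  simp only [invApply_apply, PiLp.single_apply, mul_ite, mul_one, mul_zero,
    Finset.sum_ite_eq', Finset.mem_univ, if_true]
  simp [Finset.mul_sum, mul_comm]

lemma hasFDerivAt_norm_invApply_sq (T : Matrix (Fin n) (Fin n) ℝ) (x : RSpace n) :
    HasFDerivAt (fun x : RSpace n => ‖invApply T x‖ ^ 2)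
      (2 • (innerSL ℝ (invApply T x)).comp (invApplyL T)) x :=
  (invApplyL T).hasFDerivAt.norm_sq

end Factor

end

noncomputable section

/-! ### Calculus of partial derivatives -/

section PartialD

variable {n : ℕ} {f g : RSpace n → ℂ} {x : RSpace n}

lemma HasFDerivAt.partialD_eq {f' : RSpace n →L[ℝ] ℂ} (h : HasFDerivAt f f' x) (j : Fin n) :
    partialD j f x = f' (EuclideanSpace.single j 1) := by
  rw [partialD, h.fderiv]

lemma partialD_add (j : Fin n) (hf : DifferentiableAt ℝ f x) (hg : DifferentiableAt ℝ g x) :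
    partialD j (fun x => f x + g x) x = partialD j f x + partialD j g x := by
  rw [(hf.hasFDerivAt.fun_add hg.hasFDerivAt).partialD_eq]
  rfl

lemma partialD_sub (j : Fin n) (hf : DifferentiableAt ℝ f x) (hg : DifferentiableAt ℝ g x) :
    partialD j (fun x => f x - g x) x = partialD j f x - partialD j g x := by
  rw [(hf.hasFDerivAt.fun_sub hg.hasFDerivAt).partialD_eq]
  rfl

lemma partialD_mul (j : Fin n) (hf : DifferentiableAt ℝ f x) (hg : DifferentiableAt ℝ g x) :
    partialD j (fun x => f x * g x) x = partialD j f x * g x + f x * partialD j g x := by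
  rw [(hf.hasFDerivAt.fun_mul hg.hasFDerivAt).partialD_eq]
  simp only [partialD, add_apply, smul_apply, smul_eq_mul]
  ring

lemma partialD_const_mul (j : Fin n) (c : ℂ) (hf : DifferentiableAt ℝ f x) :
    partialD j (fun x => c * f x) x = c * partialD j f x := by
  rw [(hf.hasFDerivAt.const_mul c).partialD_eq]
  rfl

lemma partialD_sum {ι : Type*} (s : Finset ι) (j : Fin n) {F : ι → RSpace n → ℂ}
    (hF : ∀ i ∈ s, DifferentiableAt ℝ (F i) x) :
    partialD j (fun x => ∑ i ∈ s, F i x) x = ∑ i ∈ s, partialD j (F i) x := by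
  rw [(HasFDerivAt.fun_sum fun i hi => (hF i hi).hasFDerivAt).partialD_eq]
  simp [partialD]

lemma Filter.EventuallyEq.partialD_eq (h : f =ᶠ[𝓝 x] g) (j : Fin n) :
    partialD j f x = partialD j g x := by
  rw [partialD, partialD, h.fderiv_eq]

lemma contDiff_partialD (hf : ContDiff ℝ ∞ f) (j : Fin n) : ContDiff ℝ ∞ (partialD j f) :=
  (hf.fderiv_right (m := ∞) (by simp)).clm_apply contDiff_const

lemma hasCompactSupport_partialD (hf : HasCompactSupport f) (j : Fin n) :
    HasCompactSupport (partialD j f) :=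
  hf.fderiv_apply (𝕜 := ℝ) (EuclideanSpace.single j 1)

lemma partialD_comp_sub (j : Fin n) (f : RSpace n → ℂ) (y x : RSpace n) :
    partialD j (fun x => f (x - y)) x = partialD j f (x - y) := by
  rw [partialD, fderiv_comp_sub]
  rfl

/-- Integration by parts on `ℝⁿ` against a compactly supported function. -/
lemma integral_mul_partialD (j : Fin n) (hf : Differentiable ℝ f) (hf' : Continuous (partialD j f))
    (hg : ContDiff ℝ 1 g) (hgc : HasCompactSupport g) :
    ∫ x, f x * partialD j g x = -∫ x, partialD j f x * g x := by
  have hg' : Continuous (partialD j g) := (hg.continuous_fderiv one_ne_zero).clm_apply continuous_const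
  refine integral_mul_fderiv_eq_neg_fderiv_mul_of_integrable ?_ ?_ ?_ (fun x _ => hf x)
    (fun x _ => hg.differentiable one_ne_zero x)
  · exact (hf'.mul hg.continuous).integrable_of_hasCompactSupport hgc.mul_left
  · exact (hf.continuous.mul hg').integrable_of_hasCompactSupport
      (hasCompactSupport_partialD hgc j).mul_left
  · exact (hf.continuous.mul hg.continuous).integrable_of_hasCompactSupport hgc.mul_left

end PartialD

/-! ### Functions of the quadratic form -/

section QuadraticForm

variable {n : ℕ} {A T : Matrix (Fin n) (Fin n) ℝ}

lemma hasFDerivAt_comp_quadratic {f : ℝ → ℂ} {f' : ℂ} {c : ℝ} {x : RSpace n}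
    (hf : HasDerivAt f f' (‖invApply T x‖ ^ 2 + c)) :
    HasFDerivAt (fun x : RSpace n => f (‖invApply T x‖ ^ 2 + c))
      ((2 • (innerSL ℝ (invApply T x)).comp (invApplyL T)).smulRight f') x := by
  refine (hf.hasFDerivAt.comp x ((hasFDerivAt_norm_invApply_sq T x).add_const c)).congr_fderiv ?_
  ext v
  simp [mul_assoc]

lemma partialD_comp_quadratic (hA : A = T * T.transpose) {f : ℝ → ℂ} {f' : ℂ} {c : ℝ}
    {x : RSpace n} (hf : HasDerivAt f f' (‖invApply T x‖ ^ 2 + c)) (j : Fin n) :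
    partialD j (fun x : RSpace n => f (‖invApply T x‖ ^ 2 + c)) x = 2 * invForm A x j * f' := by
  rw [(hasFDerivAt_comp_quadratic hf).partialD_eq]
  have := inner_invApply_single hA x j
  simp [invApplyL_apply, this]

lemma hasFDerivAt_invForm (A : Matrix (Fin n) (Fin n) ℝ) (j : Fin n) (x : RSpace n) :
    HasFDerivAt (fun x : RSpace n => invForm A x j)
      (∑ i, A⁻¹ i j • (EuclideanSpace.proj i : RSpace n →L[ℝ] ℝ)) x := by
  refine HasFDerivAt.fun_sum fun i _ => ?_
  exact (EuclideanSpace.proj i : RSpace n →L[ℝ] ℝ).hasFDerivAt.mul_const (A⁻¹ i j)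

lemma partialD_invForm (A : Matrix (Fin n) (Fin n) ℝ) (j l : Fin n) (x : RSpace n) :
    partialD l (fun x : RSpace n => (invForm A x j : ℂ)) x = A⁻¹ l j := by
  have h : HasFDerivAt (fun x : RSpace n => (invForm A x j : ℂ)) _ x :=
    Complex.ofRealCLM.hasFDerivAt.comp x (hasFDerivAt_invForm A j x)
  rw [h.partialD_eq]
  simp

lemma continuous_invApply (T : Matrix (Fin n) (Fin n) ℝ) :
    Continuous (invApply T : RSpace n → RSpace n) := (invApplyL T).continuous

/-- Integration by parts for a smooth function of the quadratic form: the action of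
`∑ A_{lj} ∂_l ∂_j` on `f(|T⁻¹x|² + c)`. -/
lemma integral_comp_quadratic_mul (hT : IsUnit T) (hA : A = T * T.transpose) {f f' f'' : ℝ → ℂ}
    (h1 : ∀ s : ℝ, 0 < s → HasDerivAt f (f' s) s) (h2 : ∀ s : ℝ, 0 < s → HasDerivAt f' (f'' s) s)
    (h3 : ContinuousOn f'' (Set.Ioi 0)) {c : ℝ} (hc : 0 < c) {ψ : RSpace n → ℂ}
    (hψ : ContDiff ℝ ∞ ψ) (hψc : HasCompactSupport ψ) :
    ∫ x, f (‖invApply T x‖ ^ 2 + c) * ∑ l, ∑ j, (A l j : ℂ) * partialD l (partialD j ψ) x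
      = ∫ x, (4 * ((‖invApply T x‖ ^ 2 : ℝ) : ℂ) * f'' (‖invApply T x‖ ^ 2 + c)
          + 2 * n * f' (‖invApply T x‖ ^ 2 + c)) * ψ x := by
  have hpos : ∀ x : RSpace n, 0 < ‖invApply T x‖ ^ 2 + c := fun x => by positivity
  have hcont : Continuous fun x : RSpace n => ‖invApply T x‖ ^ 2 + c :=
    ((continuous_invApply T).norm.pow 2).add continuous_const
  set W : RSpace n → ℂ := fun x => f (‖invApply T x‖ ^ 2 + c) with hW
  set W1 : RSpace n → ℂ := fun x => f' (‖invApply T x‖ ^ 2 + c) with hW1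
  set W2 : RSpace n → ℂ := fun x => f'' (‖invApply T x‖ ^ 2 + c) with hW2
  have dW : Differentiable ℝ W := fun x => (hasFDerivAt_comp_quadratic (h1 _ (hpos x))).differentiableAt
  have dW1 : Differentiable ℝ W1 :=
    fun x => (hasFDerivAt_comp_quadratic (h2 _ (hpos x))).differentiableAt
  have cW2 : Continuous W2 := h3.comp_continuous hcont hpos
  have pW : ∀ j, partialD j W = fun x => 2 * (invForm A x j : ℂ) * W1 x := fun j => by
    ext x
    exact partialD_comp_quadratic hA (h1 _ (hpos x)) j
  have dI : ∀ j, Differentiable ℝ fun x : RSpace n => (invForm A x j : ℂ) := fun j x =>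
    (Complex.ofRealCLM.hasFDerivAt.comp x (hasFDerivAt_invForm A j x)).differentiableAt
  have cI : ∀ j, Continuous fun x : RSpace n => (invForm A x j : ℂ) := fun j => (dI j).continuous
  have dpW : ∀ j, Differentiable ℝ (partialD j W) := fun j => by
    rw [pW]
    exact ((dI j).const_mul 2).mul dW1
  -- The two terms contract against A to 4 |T⁻¹x|² f'' and 2 n f' respectively, the second because
  -- the trace of A A⁻¹ is n.
  have ppW : ∀ l j, partialD j (partialD l W) = fun x =>
      4 * (invForm A x l : ℂ) * (invForm A x j : ℂ) * W2 x + 2 * (A⁻¹ j l : ℂ) * W1 x := fun l j => by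
    rw [pW]
    ext x
    rw [partialD_mul j ((dI l x).const_mul 2) (dW1 x), partialD_const_mul j 2 (dI l x),
      partialD_invForm, partialD_comp_quadratic hA (h2 _ (hpos x)) j]
    ring
  have parts : ∀ l j, ∫ x, W x * partialD l (partialD j ψ) x
      = ∫ x, partialD j (partialD l W) x * ψ x := fun l j => by
    rw [integral_mul_partialD l dW ((dpW l).continuous)
      ((contDiff_partialD hψ j).of_le (by simp)) (hasCompactSupport_partialD hψc j),
      integral_mul_partialD j (dpW l) (by
        rw [ppW]
        exact (((continuous_const.mul (cI l)).mul (cI j)).mul cW2).add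
          (continuous_const.mul dW1.continuous)) (hψ.of_le (by simp)) hψc, neg_neg]
  have i1 : ∀ l j, Integrable fun x => (A l j : ℂ) * (W x * partialD l (partialD j ψ) x) :=
    fun l j => ((dW.continuous.mul (contDiff_partialD (contDiff_partialD hψ j) l).continuous
      ).integrable_of_hasCompactSupport (hasCompactSupport_partialD
        (hasCompactSupport_partialD hψc j) l).mul_left).const_mul _
  have i2 : ∀ l j, Integrable fun x => (A l j : ℂ) * (partialD j (partialD l W) x * ψ x) :=
    fun l j => by
      refine Integrable.const_mul ?_ _
      refine Continuous.integrable_of_hasCompactSupport ?_ hψc.mul_left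
      rw [ppW]
      exact ((((continuous_const.mul (cI l)).mul (cI j)).mul cW2).add
          (continuous_const.mul dW1.continuous)).mul hψ.continuous
  calc ∫ x, W x * ∑ l, ∑ j, (A l j : ℂ) * partialD l (partialD j ψ) x
      = ∫ x, ∑ l, ∑ j, (A l j : ℂ) * (W x * partialD l (partialD j ψ) x) := by
        congr 1
        ext x
        simp only [Finset.mul_sum]
        refine Finset.sum_congr rfl fun l _ => Finset.sum_congr rfl fun j _ => ?_
        ring
    _ = ∑ l, ∑ j, (A l j : ℂ) * ∫ x, W x * partialD l (partialD j ψ) x := by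
        rw [integral_finsetSum _ fun l _ => integrable_finsetSum _ fun j _ => i1 l j]
        refine Finset.sum_congr rfl fun l _ => ?_
        rw [integral_finsetSum _ fun j _ => i1 l j]
        refine Finset.sum_congr rfl fun j _ => integral_const_mul _ _
    _ = ∑ l, ∑ j, (A l j : ℂ) * ∫ x, partialD j (partialD l W) x * ψ x := by simp only [parts]
    _ = ∫ x, ∑ l, ∑ j, (A l j : ℂ) * (partialD j (partialD l W) x * ψ x) := by
        rw [integral_finsetSum _ fun l _ => integrable_finsetSum _ fun j _ => i2 l j]
        refine Finset.sum_congr rfl fun l _ => ?_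
        rw [integral_finsetSum _ fun j _ => i2 l j]
        refine Finset.sum_congr rfl fun j _ => (integral_const_mul _ _).symm
    _ = _ := by
        congr 1
        ext x
        have e1 : ∑ l, ∑ j, (A l j : ℂ) * (invForm A x l : ℂ) * (invForm A x j : ℂ)
            = ((‖invApply T x‖ ^ 2 : ℝ) : ℂ) := by
          rw [← sum_mul_invForm_mul_invForm hT hA x]
          push_cast
          rfl
        have e2 : ∑ l, ∑ j, (A l j : ℂ) * (A⁻¹ j l : ℂ) = n := by
          have := congrArg (fun t : ℝ => (t : ℂ)) (sum_mul_inv hT hA)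
          push_cast at this
          rw [← this]
          refine Finset.sum_congr rfl fun l _ => Finset.sum_congr rfl fun j _ => ?_
          rw [factor_inv_symm hA j l]
        simp only [ppW]
        rw [← e1, ← e2]
        simp only [Finset.mul_sum, Finset.sum_mul, ← Finset.sum_add_distrib]
        refine Finset.sum_congr rfl fun l _ => Finset.sum_congr rfl fun j _ => ?_
        ring

end QuadraticForm

end

noncomputable section

/-! ### The weak equation for a radial profile -/

section Normalisation

lemma det_toEuclideanLin_inv {n : ℕ} (T : Matrix (Fin n) (Fin n) ℝ) :
    LinearMap.det (Matrix.toEuclideanLin T⁻¹ : RSpace n →ₗ[ℝ] RSpace n) = T.det⁻¹ := by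
  rw [Matrix.toEuclideanLin_eq_toLin_orthonormal, LinearMap.det_toLin,
    Matrix.det_nonsing_inv, Ring.inverse_eq_inv]

lemma det_toEuclideanLin_inv_ne_zero {n : ℕ} {T : Matrix (Fin n) (Fin n) ℝ} (hT : IsUnit T) :
    LinearMap.det (Matrix.toEuclideanLin T⁻¹ : RSpace n →ₗ[ℝ] RSpace n) ≠ 0 := by
  rw [det_toEuclideanLin_inv]
  exact inv_ne_zero ((Matrix.isUnit_iff_isUnit_det _).1 hT).ne_zero

/-- `T⁻¹` as a continuous linear equivalence. -/
def invApplyEquiv {n : ℕ} {T : Matrix (Fin n) (Fin n) ℝ} (hT : IsUnit T) :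
    RSpace n ≃L[ℝ] RSpace n :=
  (LinearMap.equivOfDetNeZero _ (det_toEuclideanLin_inv_ne_zero hT)).toContinuousLinearEquiv

lemma map_invApply {n : ℕ} {T : Matrix (Fin n) (Fin n) ℝ} (hT : IsUnit T) :
    Measure.map (invApplyEquiv hT) (volume : Measure (RSpace n))
      = ENNReal.ofReal |T.det| • volume := by
  have := Measure.map_linearMap_addHaar_eq_smul_addHaar (volume : Measure (RSpace n))
    (det_toEuclideanLin_inv_ne_zero hT)
  rw [det_toEuclideanLin_inv, inv_inv] at this
  exact this

lemma integral_comp_invApply {n : ℕ} {T : Matrix (Fin n) (Fin n) ℝ} (hT : IsUnit T)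
    {F : Type*} [NormedAddCommGroup F] [NormedSpace ℝ F] (g : RSpace n → F) :
    ∫ x, g (invApply T x) = |T.det| • ∫ x, g x := by
  have := (invApplyEquiv hT).toHomeomorph.measurableEmbedding.integral_map (μ := volume) g
  change ∫ y, g y ∂(Measure.map (invApplyEquiv hT) volume) = ∫ x, g (invApply T x) at this
  rw [← this, map_invApply, integral_smul_measure, ENNReal.toReal_ofReal (abs_nonneg _)]

lemma integrable_comp_invApply {n : ℕ} {T : Matrix (Fin n) (Fin n) ℝ} (hT : IsUnit T)
    {F : Type*} [NormedAddCommGroup F] {g : RSpace n → F} (hg : Integrable g) :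
    Integrable fun x => g (invApply T x) := by
  refine ((invApplyEquiv hT).toHomeomorph.measurableEmbedding.integrable_map_iff (μ := volume)
    (g := g)).1 ?_
  change Integrable g (Measure.map (invApplyEquiv hT) volume)
  rw [map_invApply]
  exact hg.smul_measure ENNReal.ofReal_ne_top

lemma sphereArea_eq (n : ℕ) :
    sphereArea n = n * (volume : Measure (RSpace n)).real (Metric.ball 0 1) := by
  rw [sphereArea, Measure.toSphere_real_apply_univ]
  simp

lemma sphereArea_pos {n : ℕ} (hn : 1 ≤ n) : 0 < sphereArea n := by
  rw [sphereArea_eq]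
  have : 0 < (volume : Measure (RSpace n)).real (Metric.ball 0 1) :=
    ENNReal.toReal_pos (Metric.measure_ball_pos _ _ one_pos).ne' measure_ball_lt_top.ne
  have hn' : (0 : ℝ) < n := by exact_mod_cast hn
  positivity

/-- A primitive is r^n (1 + r²)^(-n/2) / n, which vanishes at 0 and tends to 1/n. This is the radial
integral that determines the mass of δ₀. -/
lemma integral_Ioi_pow_mul_one_add_sq {n : ℕ} (hn : 1 ≤ n) :
    ∫ r in Set.Ioi (0 : ℝ), r ^ (n - 1) * (1 + r ^ 2) ^ (-((n : ℝ) + 2) / 2) = 1 / (n : ℝ) := by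
  have hn' : (n : ℝ) ≠ 0 := by exact_mod_cast (by omega : n ≠ 0)
  have hpos : ∀ r : ℝ, 0 < 1 + r ^ 2 := fun r => by positivity
  let g : ℝ → ℝ := fun r => 1 / n * (r ^ n * (1 + r ^ 2) ^ (-(n : ℝ) / 2))
  have hderiv : ∀ r ∈ Set.Ici (0 : ℝ),
      HasDerivAt g (r ^ (n - 1) * (1 + r ^ 2) ^ (-((n : ℝ) + 2) / 2)) r := by
    intro r _
    have h1 : HasDerivAt (fun r : ℝ => 1 + r ^ 2) (2 * r) r := by
      simpa using (hasDerivAt_pow 2 r).const_add 1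
    have h2 := h1.rpow_const (p := -(n : ℝ) / 2) (Or.inl (hpos r).ne')
    refine (((hasDerivAt_pow n r).mul h2).const_mul (1 / (n : ℝ))).congr_deriv ?_
    have e1 : (1 + r ^ 2) ^ (-(n : ℝ) / 2)
        = (1 + r ^ 2) ^ (-((n : ℝ) + 2) / 2) * (1 + r ^ 2) := by
      rw [← Real.rpow_add_one (hpos r).ne']
      congr 1
      ring
    have e2 : -(n : ℝ) / 2 - 1 = -((n : ℝ) + 2) / 2 := by ring
    have e3 : r ^ n = r ^ (n - 1) * r := by rw [← pow_succ, Nat.sub_add_cancel hn]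
    rw [e2, e1, e3]
    field_simp
    ring
  have hlim : Tendsto g atTop (𝓝 (1 / n)) := by
    have h1 : Tendsto (fun r : ℝ => (1 - (1 + r ^ 2)⁻¹) ^ ((n : ℝ) / 2)) atTop (𝓝 1) := by
      have h2 : Tendsto (fun r : ℝ => 1 - (1 + r ^ 2)⁻¹) atTop (𝓝 (1 - 0)) :=
        tendsto_const_nhds.sub (tendsto_inv_atTop_zero.comp
          (tendsto_atTop_add_const_left _ _ (tendsto_pow_atTop two_ne_zero)))
      simpa using h2.rpow_const (p := (n : ℝ) / 2) (Or.inl (by norm_num))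
    have h3 := h1.const_mul (1 / (n : ℝ))
    rw [mul_one] at h3
    refine h3.congr' ?_
    filter_upwards [eventually_gt_atTop 0] with r hr
    have e : 1 - (1 + r ^ 2)⁻¹ = r ^ 2 / (1 + r ^ 2) := by
      have := (hpos r).ne'
      field_simp
      ring
    have e2 : r ^ n = (r ^ 2) ^ ((n : ℝ) / 2) := by
      rw [← Real.rpow_natCast r 2, ← Real.rpow_mul hr.le, ← Real.rpow_natCast]
      congr 1
      push_cast
      ring
    simp only [g]
    rw [e, Real.div_rpow (by positivity) (hpos r).le, e2, neg_div, Real.rpow_neg (hpos r).le,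
      div_eq_mul_inv ((r ^ 2) ^ ((n : ℝ) / 2))]
  have := integral_Ioi_of_hasDerivAt_of_nonneg' hderiv
    (fun r hr => by have : 0 < r := hr; positivity) hlim
  rw [this]
  simp [g, show n ≠ 0 by omega]

lemma integral_one_add_norm_sq {n : ℕ} (hn : 1 ≤ n) :
    ∫ x : RSpace n, (1 + ‖x‖ ^ 2) ^ (-((n : ℝ) + 2) / 2) = sphereArea n / n := by
  have : Nontrivial (RSpace n) := by
    have : Nonempty (Fin n) := ⟨⟨0, hn⟩⟩
    infer_instance
  rw [integral_fun_norm_addHaar volume fun r => (1 + r ^ 2) ^ (-((n : ℝ) + 2) / 2)]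
  simp only [finrank_euclideanSpace, Fintype.card_fin, smul_eq_mul, nsmul_eq_mul]
  rw [integral_Ioi_pow_mul_one_add_sq hn, sphereArea_eq]
  ring

lemma integrable_one_add_quadratic {n : ℕ} {T : Matrix (Fin n) (Fin n) ℝ} (hT : IsUnit T) :
    Integrable fun x : RSpace n => (1 + ‖invApply T x‖ ^ 2) ^ (-((n : ℝ) + 2) / 2) :=
  integrable_comp_invApply hT (g := fun x : RSpace n => (1 + ‖x‖ ^ 2) ^ (-((n : ℝ) + 2) / 2))
    (integrable_rpow_neg_one_add_norm_sq (by simp))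

lemma integral_one_add_quadratic {n : ℕ} (hn : 1 ≤ n) {T : Matrix (Fin n) (Fin n) ℝ}
    (hT : IsUnit T) :
    ∫ x : RSpace n, (1 + ‖invApply T x‖ ^ 2) ^ (-((n : ℝ) + 2) / 2)
      = |T.det| * (sphereArea n / n) := by
  rw [integral_comp_invApply hT fun x : RSpace n => (1 + ‖x‖ ^ 2) ^ (-((n : ℝ) + 2) / 2),
    integral_one_add_norm_sq hn, smul_eq_mul]

/-- `|x|^{1-n}` is locally integrable. -/
lemma integrableOn_norm_pow_inv {n : ℕ} (hn : 1 ≤ n) (R : ℝ) :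
    IntegrableOn (fun x : RSpace n => (‖x‖ ^ (n - 1))⁻¹) (Metric.ball 0 R) := by
  have : Nontrivial (RSpace n) := by
    have : Nonempty (Fin n) := ⟨⟨0, hn⟩⟩
    infer_instance
  rw [integrableOn_fun_norm_addHaar volume (f := fun r : ℝ => (r ^ (n - 1))⁻¹)]
  have h : IntegrableOn (fun _ : ℝ => (1 : ℝ)) (Set.Ioo 0 R) := by
    simp
  refine h.congr_fun (fun r hr => ?_) measurableSet_Ioo
  have : (r : ℝ) ^ (n - 1) ≠ 0 := pow_ne_zero _ hr.1.ne'
  simp [this]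

lemma exists_norm_le_invApply {n : ℕ} {T : Matrix (Fin n) (Fin n) ℝ} (hT : IsUnit T) :
    ∃ K : ℝ, 0 < K ∧ ∀ x : RSpace n, ‖x‖ ≤ K * ‖invApply T x‖ ∧ ‖invApply T x‖ ≤ K * ‖x‖ := by
  let e := invApplyEquiv hT
  refine ⟨‖(e : RSpace n →L[ℝ] RSpace n)‖ + ‖(e.symm : RSpace n →L[ℝ] RSpace n)‖ + 1,
    by positivity, fun x => ⟨?_, ?_⟩⟩
  · have h1 := (e.symm : RSpace n →L[ℝ] RSpace n).le_opNorm (e x)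
    have h2 : (e.symm : RSpace n →L[ℝ] RSpace n) (e x) = x := e.symm_apply_apply x
    rw [h2] at h1
    refine h1.trans ?_
    change _ * ‖e x‖ ≤ _ * ‖e x‖
    gcongr
    linarith [norm_nonneg (e : RSpace n →L[ℝ] RSpace n)]
  · refine ((e : RSpace n →L[ℝ] RSpace n).le_opNorm x).trans ?_
    gcongr
    linarith [norm_nonneg (e.symm : RSpace n →L[ℝ] RSpace n)]

end Normalisation
end

noncomputable section

/-! ### Behaviour of radial profiles at the origin -/

lemma exists_bound_log_mul_rpow {t R : ℝ} (ht : 0 < t) :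
    ∃ C : ℝ, ∀ s ∈ Set.Ioc 0 R, |Real.log s * s ^ t| ≤ C := by
  refine ⟨max (1 / t) (Real.log R * R ^ t), fun s hs => ?_⟩
  rcases le_total s 1 with h1 | h1
  · exact (Real.abs_log_mul_self_rpow_lt s t hs.1 h1 ht).le.trans (le_max_left _ _)
  · refine le_trans ?_ (le_max_right _ _)
    have h0 : 0 ≤ Real.log s := Real.log_nonneg h1
    rw [abs_of_nonneg (mul_nonneg h0 (Real.rpow_nonneg hs.1.le _))]
    have hR : Real.log s ≤ Real.log R := Real.log_le_log hs.1 hs.2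
    have hR' : s ^ t ≤ R ^ t := Real.rpow_le_rpow hs.1.le hs.2 ht.le
    exact mul_le_mul hR hR' (Real.rpow_nonneg hs.1.le _) (h0.trans hR)

lemma exists_bound_entire {G : ℂ → ℂ} (hG : Differentiable ℂ G) (R : ℝ) :
    ∃ C : ℝ, 0 ≤ C ∧ ∀ s ∈ Set.Ioc 0 R, ‖G (s : ℂ)‖ ≤ C := by
  obtain ⟨C, hC⟩ := (isCompact_Icc (a := (0 : ℝ)) (b := R)).exists_bound_of_continuousOn
    (f := fun s : ℝ => G s) (hG.continuous.comp Complex.continuous_ofReal).continuousOn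
  exact ⟨max C 0, le_max_right _ _, fun s hs => (hC s ⟨hs.1.le, hs.2⟩).trans (le_max_left _ _)⟩

/-- On a bounded interval a strictly negative power absorbs the logarithm, and also s^p as long as t
≤ p. For the profile itself t = (1 - n)/2 is used, which corresponds to the locally integrable
|x|^(1-n). -/
lemma frobeniusFn_bound {p t : ℝ} {G J : ℂ → ℂ} (hG : Differentiable ℂ G)
    (hJ : Differentiable ℂ J) (htp : t ≤ p) (ht : t < 0) (R : ℝ) :
    ∃ C : ℝ, ∀ s ∈ Set.Ioc 0 R, ‖frobeniusFn p G J s‖ ≤ C * s ^ t := by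
  obtain ⟨CG, hCG0, hCG⟩ := exists_bound_entire hG R
  obtain ⟨CJ, hCJ0, hCJ⟩ := exists_bound_entire hJ R
  obtain ⟨CL, hCL⟩ := exists_bound_log_mul_rpow (R := R) (neg_pos.2 ht)
  refine ⟨R ^ (p - t) * CG + CL * CJ, fun s hs => ?_⟩
  have hs0 : 0 < s := hs.1
  have e1 : s ^ p = s ^ (p - t) * s ^ t := by
    rw [← Real.rpow_add hs0]
    simp
  have h1 : s ^ (p - t) ≤ R ^ (p - t) := Real.rpow_le_rpow hs0.le hs.2 (by linarith)
  have h2 : |Real.log s| ≤ CL * s ^ t := by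
    have := hCL s hs
    rw [abs_mul, abs_of_pos (Real.rpow_pos_of_pos hs0 _), Real.rpow_neg hs0.le] at this
    have hp : 0 < s ^ t := Real.rpow_pos_of_pos hs0 _
    rwa [← div_eq_mul_inv, div_le_iff₀ hp] at this
  have hst : 0 < s ^ t := Real.rpow_pos_of_pos hs0 _
  calc ‖frobeniusFn p G J s‖ ≤ s ^ p * ‖G s‖ + |Real.log s| * ‖J s‖ := by
        refine (norm_add_le _ _).trans ?_
        rw [norm_mul, norm_mul, Complex.norm_real, Complex.norm_real, Real.norm_eq_abs,
          Real.norm_eq_abs, abs_of_pos (Real.rpow_pos_of_pos hs0 _)]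
    _ ≤ (R ^ (p - t) * s ^ t) * CG + (CL * s ^ t) * CJ := by
        rw [e1]
        gcongr
        · exact mul_nonneg ((Real.rpow_nonneg hs0.le _).trans h1) hst.le
        · exact hCG s hs
        · exact (abs_nonneg _).trans h2
        · exact hCJ s hs
    _ = _ := by ring

/-- For p < 0 the logarithmic term is negligible against s^p, so G(0) is the coefficient of the
singularity. -/
lemma frobeniusFn_tendsto {p : ℝ} {G J : ℂ → ℂ} (hG : Differentiable ℂ G)
    (hJ : Differentiable ℂ J) (hp : p < 0) :
    Tendsto (fun s : ℝ => ((s ^ (-p) : ℝ) : ℂ) * frobeniusFn p G J s) (𝓝[>] 0) (𝓝 (G 0)) := by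
  have hl := tendsto_log_mul_rpow_nhdsGT_zero (neg_pos.2 hp)
  have hl' : Tendsto (fun s : ℝ => ((Real.log s * s ^ (-p) : ℝ) : ℂ)) (𝓝[>] 0) (𝓝 ((0 : ℝ) : ℂ)) :=
    (Complex.continuous_ofReal.tendsto 0).comp hl
  have hg : ∀ {F : ℂ → ℂ}, Differentiable ℂ F →
      Tendsto (fun s : ℝ => F s) (𝓝[>] 0) (𝓝 (F 0)) := fun {F} hF => by
    have : Continuous fun s : ℝ => F s := hF.continuous.comp Complex.continuous_ofReal
    simpa using (this.tendsto 0).mono_left nhdsWithin_le_nhds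
  have := (hg hG).add (hl'.mul (hg hJ))
  simp only [Complex.ofReal_zero, zero_mul, add_zero] at this
  refine this.congr' ?_
  filter_upwards [self_mem_nhdsWithin] with s hs
  have hs0 : 0 < s := hs
  have e : ((s ^ (-p) : ℝ) : ℂ) * ((s ^ p : ℝ) : ℂ) = 1 := by
    rw [← Complex.ofReal_mul, ← Real.rpow_add hs0]
    simp
  simp only [frobeniusFn]
  push_cast
  linear_combination -(G s) * e

lemma continuousOn_frobeniusFn {p : ℝ} {G J : ℂ → ℂ} (hG : Differentiable ℂ G)
    (hJ : Differentiable ℂ J) : ContinuousOn (frobeniusFn p G J) (Set.Ioi 0) := by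
  intro s hs
  have hs0 : (s : ℝ) ≠ 0 := (Set.mem_Ioi.1 hs).ne'
  have h1 : ContinuousAt (fun s : ℝ => ((s ^ p : ℝ) : ℂ)) s :=
    Complex.continuous_ofReal.continuousAt.comp (Real.continuousAt_rpow_const _ _ (Or.inl hs0))
  have h2 : ContinuousAt (fun s : ℝ => (Real.log s : ℂ)) s :=
    Complex.continuous_ofReal.continuousAt.comp (Real.continuousAt_log hs0)
  exact ((h1.mul (hG.continuous.comp Complex.continuous_ofReal).continuousAt).add
    (h2.mul (hJ.continuous.comp Complex.continuous_ofReal).continuousAt)).continuousWithinAt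

/-- The weak form of `∑ A_{lj} ∂_l ∂_j u + κ u = c δ₀` for `u = f(|T⁻¹x|²)`. -/
theorem integral_radial_mul {n : ℕ} (hn : 2 ≤ n) {A T : Matrix (Fin n) (Fin n) ℝ} (hT : IsUnit T)
    (hA : A = T * T.transpose) {κ h₀ : ℂ} {f f' f'' : ℝ → ℂ}
    (h1 : ∀ s : ℝ, 0 < s → HasDerivAt f (f' s) s) (h2 : ∀ s : ℝ, 0 < s → HasDerivAt f' (f'' s) s)
    (h3 : ContinuousOn f'' (Set.Ioi 0))
    (hode : ∀ s : ℝ, 0 < s → 4 * s * f'' s + 2 * n * f' s + κ * f s = 0)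
    (hf : ∀ R : ℝ, ∃ C : ℝ, ∀ s ∈ Set.Ioc 0 R, ‖f s‖ ≤ C * s ^ (-((n : ℝ) - 1) / 2))
    (hf'' : ∀ R : ℝ, ∃ C : ℝ, ∀ s ∈ Set.Ioc 0 R, ‖f'' s‖ ≤ C * s ^ (-((n : ℝ) + 2) / 2))
    (hlim : Tendsto (fun s : ℝ => ((s ^ (-(-((n : ℝ) + 2) / 2)) : ℝ) : ℂ) * f'' s) (𝓝[>] 0) (𝓝 h₀))
    {ψ : RSpace n → ℂ} (hψ : ContDiff ℝ ∞ ψ) (hψc : HasCompactSupport ψ) :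
    ∫ x, f (‖invApply T x‖ ^ 2)
        * (∑ l, ∑ j, (A l j : ℂ) * partialD l (partialD j ψ) x + κ * ψ x)
      = -4 * h₀ * (|T.det| * (sphereArea n / n) : ℝ) * ψ 0 := by
  have hntr : Nontrivial (RSpace n) := by
    have : Nonempty (Fin n) := ⟨⟨0, by omega⟩⟩
    infer_instance
  obtain ⟨K, hK, hKb⟩ := exists_norm_le_invApply hT
  set Q : RSpace n → ℝ := fun x => ‖invApply T x‖ ^ 2 with hQ
  have hQc : Continuous Q := (continuous_invApply T).norm.pow 2
  have hQ0 : ∀ x, 0 ≤ Q x := fun x => by positivity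
  set Lψ : RSpace n → ℂ := fun x => ∑ l, ∑ j, (A l j : ℂ) * partialD l (partialD j ψ) x with hLψ
  have cLψ : Continuous Lψ := continuous_finsetSum _ fun l _ => continuous_finsetSum _ fun j _ =>
    continuous_const.mul (contDiff_partialD (contDiff_partialD hψ j) l).continuous
  set g : RSpace n → ℂ := fun x => Lψ x + κ * ψ x with hg
  have cg : Continuous g := cLψ.add (continuous_const.mul hψ.continuous)
  -- a ball containing the support
  obtain ⟨R, hR, hsupp⟩ : ∃ R : ℝ, 0 < R ∧ ∀ x, R ≤ ‖x‖ → ψ x = 0 ∧ g x = 0 := by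
    obtain ⟨R, hR⟩ := hψc.isCompact.isBounded.subset_ball_lt 0 0
    refine ⟨R, hR.1, fun x hx => ?_⟩
    have hx' : x ∉ tsupport ψ := fun h => by
      have := hR.2 h
      rw [mem_ball_zero_iff] at this
      linarith
    have hz : ψ x = 0 := image_eq_zero_of_notMem_tsupport hx'
    have hd : ∀ l j, partialD l (partialD j ψ) x = 0 := fun l j => by
      refine image_eq_zero_of_notMem_tsupport fun h => hx' ?_
      exact (tsupport_fderiv_apply_subset ℝ _ |>.trans (tsupport_fderiv_apply_subset ℝ _)) h
    exact ⟨hz, by simp [hg, hLψ, hz, hd]⟩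
  obtain ⟨Mg, hMg⟩ : ∃ M, ∀ x, ‖g x‖ ≤ M := by
    obtain ⟨M, hM⟩ := (isCompact_closedBall (0 : RSpace n) R).exists_bound_of_continuousOn
      cg.continuousOn
    refine ⟨max M 0, fun x => ?_⟩
    rcases le_total ‖x‖ R with h | h
    · exact (hM x (by simpa using h)).trans (le_max_left _ _)
    · simp [(hsupp x h).2]
  obtain ⟨Mψ, hMψ⟩ : ∃ M, ∀ x, ‖ψ x‖ ≤ M := by
    obtain ⟨M, hM⟩ := (isCompact_closedBall (0 : RSpace n) R).exists_bound_of_continuousOn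
      hψ.continuous.continuousOn
    refine ⟨max M 0, fun x => ?_⟩
    rcases le_total ‖x‖ R with h | h
    · exact (hM x (by simpa using h)).trans (le_max_left _ _)
    · simp [(hsupp x h).1]
  have hMg0 : 0 ≤ Mg := (norm_nonneg _).trans (hMg 0)
  have hMψ0 : 0 ≤ Mψ := (norm_nonneg _).trans (hMψ 0)
  -- `R'` bounds |T⁻¹x|² + ε² for ‖x‖ ≤ R and ε ≤ 1.
  set R' : ℝ := (K * R) ^ 2 + 1 with hR'
  have cf : ContinuousOn f (Set.Ioi 0) := fun s hs => (h1 s hs).continuousAt.continuousWithinAt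
  have cf' : ContinuousOn f' (Set.Ioi 0) := fun s hs => (h2 s hs).continuousAt.continuousWithinAt
  -- the regularised identity
  have reg : ∀ ε : ℝ, 0 < ε → ∫ x, f (Q x + ε ^ 2) * g x
      = ∫ x, -4 * (ε ^ 2 : ℝ) * f'' (Q x + ε ^ 2) * ψ x := by
    intro ε hε
    have hpos : ∀ x, 0 < Q x + ε ^ 2 := fun x => add_pos_of_nonneg_of_pos (hQ0 x) (by positivity)
    have hcont : Continuous fun x => Q x + ε ^ 2 := hQc.add continuous_const
    have c0 : Continuous fun x => f (Q x + ε ^ 2) := cf.comp_continuous hcont hpos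
    have c1 : Continuous fun x => f' (Q x + ε ^ 2) := cf'.comp_continuous hcont hpos
    have c2 : Continuous fun x => f'' (Q x + ε ^ 2) := h3.comp_continuous hcont hpos
    have comp : ∀ {u : RSpace n → ℂ}, (∀ x, R ≤ ‖x‖ → u x = 0) → HasCompactSupport u := by
      intro u hu
      refine HasCompactSupport.intro (isCompact_closedBall 0 R) fun x hx => hu x ?_
      simp only [mem_closedBall_zero_iff, not_le] at hx
      exact hx.le
    have i1 : Integrable fun x => f (Q x + ε ^ 2) * Lψ x := by
      refine (c0.mul cLψ).integrable_of_hasCompactSupport (comp fun x hx => ?_)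
      have := (hsupp x hx)
      have h0 : Lψ x = 0 := by simpa [hg, this.1] using this.2
      simp [h0]
    have i2 : Integrable fun x => f (Q x + ε ^ 2) * (κ * ψ x) := by
      refine (c0.mul (continuous_const.mul hψ.continuous)).integrable_of_hasCompactSupport
        (comp fun x hx => ?_)
      simp [(hsupp x hx).1]
    have i3 : Integrable fun x => (4 * (Q x : ℂ) * f'' (Q x + ε ^ 2)
        + 2 * n * f' (Q x + ε ^ 2)) * ψ x := by
      refine Continuous.integrable_of_hasCompactSupport ?_ (comp fun x hx => ?_)
      · exact (((continuous_const.mul (Complex.continuous_ofReal.comp hQc)).mul c2).add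
          (continuous_const.mul c1)).mul hψ.continuous
      · simp [(hsupp x hx).1]
    have e := integral_comp_quadratic_mul hT hA h1 h2 h3 (c := ε ^ 2) (by positivity) hψ hψc
    calc ∫ x, f (Q x + ε ^ 2) * g x
        = (∫ x, f (Q x + ε ^ 2) * Lψ x) + ∫ x, f (Q x + ε ^ 2) * (κ * ψ x) := by
          rw [← integral_add i1 i2]
          simp only [hg, mul_add]
      _ = (∫ x, (4 * (Q x : ℂ) * f'' (Q x + ε ^ 2) + 2 * n * f' (Q x + ε ^ 2)) * ψ x)
          + ∫ x, f (Q x + ε ^ 2) * (κ * ψ x) := by rw [e]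
      _ = ∫ x, -4 * (ε ^ 2 : ℝ) * f'' (Q x + ε ^ 2) * ψ x := by
          rw [← integral_add i3 i2]
          congr 1
          ext x
          -- Writing 4 Q f'' as 4 (Q + ε²) f'' - 4 ε² f'' and using the equation at s = Q + ε², only
          -- the last term remains.
          have := hode _ (hpos x)
          push_cast at this ⊢
          linear_combination (ψ x) * this
  -- the limit of the left-hand side
  have lhs : Tendsto (fun ε : ℝ => ∫ x, f (Q x + ε ^ 2) * g x) (𝓝[>] 0) (𝓝 (∫ x, f (Q x) * g x)) := by
    obtain ⟨C, hC⟩ := hf R'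
    have hC0 : 0 ≤ C := by
      have := (norm_nonneg _).trans (hC 1 ⟨one_pos, by rw [hR']; nlinarith [sq_nonneg (K * R)]⟩)
      simpa using this
    -- Since the exponent (1 - n)/2 is negative, adding ε² only decreases the bound for f. The
    -- majorant is therefore a multiple of |x|^(1-n) on the ball, uniformly in ε.
    refine tendsto_integral_filter_of_dominated_convergence
      ((Metric.ball 0 R).indicator fun x => C * K ^ (n - 1) * Mg * (‖x‖ ^ (n - 1))⁻¹) ?_ ?_ ?_ ?_
    · filter_upwards [self_mem_nhdsWithin] with ε hε
      have hε0 : 0 < ε := hε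
      have hpos : ∀ x, 0 < Q x + ε ^ 2 := fun x => add_pos_of_nonneg_of_pos (hQ0 x) (by positivity)
      exact ((cf.comp_continuous (hQc.add continuous_const) hpos).mul cg).aestronglyMeasurable
    · filter_upwards [Ioo_mem_nhdsGT (one_pos : (0 : ℝ) < 1)] with ε hε
      filter_upwards [Measure.ae_ne volume (0 : RSpace n)] with x hx
      by_cases hxR : x ∈ Metric.ball (0 : RSpace n) R
      · rw [Set.indicator_of_mem hxR]
        have hxR' : ‖x‖ < R := by simpa using hxR
        have hxpos : 0 < ‖x‖ := norm_pos_iff.2 hx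
        have hMx : 0 < ‖invApply T x‖ := norm_pos_iff.2 (invApply_ne_zero hT hx)
        have hQx : 0 < Q x := by positivity
        have hle : Q x + ε ^ 2 ≤ R' := by
          have a1 : ‖invApply T x‖ ≤ K * R := (hKb x).2.trans (by gcongr)
          have a2 : Q x ≤ (K * R) ^ 2 := by
            simp only [hQ]
            gcongr
          have a3 : ε ^ 2 ≤ 1 := by nlinarith [hε.1, hε.2]
          linarith
        have b1 := hC (Q x + ε ^ 2) ⟨by positivity, hle⟩
        have hexp : -((n : ℝ) - 1) / 2 ≤ 0 := by
          have : (2 : ℝ) ≤ n := by exact_mod_cast hn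
          linarith
        have b2 : (Q x + ε ^ 2) ^ (-((n : ℝ) - 1) / 2) ≤ (Q x) ^ (-((n : ℝ) - 1) / 2) :=
          Real.rpow_le_rpow_of_nonpos hQx (by nlinarith [hε.1]) hexp
        have b3 : (Q x) ^ (-((n : ℝ) - 1) / 2) = (‖invApply T x‖ ^ (n - 1))⁻¹ := by
          simp only [hQ]
          rw [← Real.rpow_natCast, ← Real.rpow_natCast, ← Real.rpow_mul hMx.le,
            ← Real.rpow_neg hMx.le, Nat.cast_sub (by omega)]
          congr 1
          push_cast
          ring
        have b4 : (‖invApply T x‖ ^ (n - 1))⁻¹ ≤ K ^ (n - 1) * (‖x‖ ^ (n - 1))⁻¹ := by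
          rw [← div_eq_mul_inv, le_div_iff₀ (by positivity), inv_mul_le_iff₀ (by positivity),
            ← mul_pow, mul_comm]
          exact pow_le_pow_left₀ hxpos.le (hKb x).1 _
        calc ‖f (Q x + ε ^ 2) * g x‖ = ‖f (Q x + ε ^ 2)‖ * ‖g x‖ := norm_mul _ _
          _ ≤ (C * (K ^ (n - 1) * (‖x‖ ^ (n - 1))⁻¹)) * Mg := by
              gcongr
              · exact b1.trans (by gcongr; exact b2.trans (b3.le.trans b4))
              · exact hMg x
          _ = _ := by ring
      · have : R ≤ ‖x‖ := by simpa using hxR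
        rw [Set.indicator_of_notMem hxR, (hsupp x this).2]
        simp
    · rw [integrable_indicator_iff measurableSet_ball]
      exact (integrableOn_norm_pow_inv (by omega) R).const_mul _
    · filter_upwards [Measure.ae_ne volume (0 : RSpace n)] with x hx
      have hQx : 0 < Q x := by
        have := norm_pos_iff.2 (invApply_ne_zero hT hx)
        positivity
      refine Tendsto.mul_const _ ?_
      have t1 : Tendsto (fun ε : ℝ => Q x + ε ^ 2) (𝓝[>] 0) (𝓝 (Q x)) := by
        have : Continuous fun ε : ℝ => Q x + ε ^ 2 := by fun_prop
        simpa using (this.tendsto 0).mono_left nhdsWithin_le_nhds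
      exact (h1 _ hQx).continuousAt.tendsto.comp t1
  -- the limit of the right-hand side
  have scale : ∀ ε : ℝ, 0 < ε → ∫ x, -4 * (ε ^ 2 : ℝ) * f'' (Q x + ε ^ 2) * ψ x
      = ∫ y, (-4 * (((1 + Q y) ^ (-((n : ℝ) + 2) / 2) : ℝ) : ℂ)
        * ((((ε ^ 2 * (1 + Q y)) ^ (-(-((n : ℝ) + 2) / 2)) : ℝ) : ℂ) * f'' (ε ^ 2 * (1 + Q y))))
        * ψ (ε • y) := by
    intro ε hε
    -- Substitute x = ε y. The Jacobian and the prefactor give ε^(n+2), which is what normalises f''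
    -- at ε² (1 + Q y), its size being s^(-(n+2)/2); the weight (1 + Q y)^(-(n+2)/2) is left over.
    have e1 := Measure.integral_comp_smul_of_nonneg (volume : Measure (RSpace n))
      (fun x => -4 * ((ε ^ 2 : ℝ) : ℂ) * f'' (Q x + ε ^ 2) * ψ x) ε (hR := hε.le)
    rw [finrank_euclideanSpace, Fintype.card_fin] at e1
    have e2 : ∫ x, -4 * ((ε ^ 2 : ℝ) : ℂ) * f'' (Q x + ε ^ 2) * ψ x
        = (ε ^ n : ℝ) • ∫ y, -4 * ((ε ^ 2 : ℝ) : ℂ) * f'' (Q (ε • y) + ε ^ 2) * ψ (ε • y) := by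
      rw [e1, smul_smul, mul_inv_cancel₀ (by positivity), one_smul]
    rw [e2, ← integral_smul]
    congr 1
    ext y
    have hq : Q (ε • y) + ε ^ 2 = ε ^ 2 * (1 + Q y) := by
      have : invApply T (ε • y) = ε • invApply T y := by
        rw [← invApplyL_apply, map_smul, invApplyL_apply]
      simp only [hQ, this, norm_smul, Real.norm_eq_abs, mul_pow, sq_abs]
      ring
    have h1Q : 0 < 1 + Q y := by linarith [hQ0 y]
    have hpow : (1 + Q y) ^ (-((n : ℝ) + 2) / 2) * (ε ^ 2 * (1 + Q y)) ^ (-(-((n : ℝ) + 2) / 2))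
        = ε ^ n * ε ^ 2 := by
      rw [Real.mul_rpow (by positivity) h1Q.le, Real.rpow_neg h1Q.le, mul_comm, mul_assoc,
        inv_mul_cancel₀ (Real.rpow_pos_of_pos h1Q _).ne', mul_one, ← Real.rpow_natCast ε 2,
        ← Real.rpow_mul hε.le, ← Real.rpow_natCast ε n, ← Real.rpow_add hε]
      congr 1
      push_cast
      ring
    rw [hq, Complex.real_smul]
    have := congrArg (fun t : ℝ => (t : ℂ)) hpow
    push_cast at this ⊢
    linear_combination (4 * f'' (ε ^ 2 * (1 + Q y)) * ψ (ε • y)) * this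
  have rhs : Tendsto (fun ε : ℝ => ∫ x, -4 * (ε ^ 2 : ℝ) * f'' (Q x + ε ^ 2) * ψ x) (𝓝[>] 0)
      (𝓝 (∫ y, (-4 * (((1 + Q y) ^ (-((n : ℝ) + 2) / 2) : ℝ) : ℂ) * h₀) * ψ 0)) := by
    obtain ⟨C, hC⟩ := hf'' R'
    have hC0 : 0 ≤ C := by
      have := (norm_nonneg _).trans (hC 1 ⟨one_pos, by rw [hR']; nlinarith [sq_nonneg (K * R)]⟩)
      simpa using this
    have : Tendsto (fun ε : ℝ => ∫ y, (-4 * (((1 + Q y) ^ (-((n : ℝ) + 2) / 2) : ℝ) : ℂ)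
        * ((((ε ^ 2 * (1 + Q y)) ^ (-(-((n : ℝ) + 2) / 2)) : ℝ) : ℂ) * f'' (ε ^ 2 * (1 + Q y))))
        * ψ (ε • y)) (𝓝[>] 0)
        (𝓝 (∫ y, (-4 * (((1 + Q y) ^ (-((n : ℝ) + 2) / 2) : ℝ) : ℂ) * h₀) * ψ 0)) := by
      refine tendsto_integral_filter_of_dominated_convergence
        (fun y => 4 * C * Mψ * (1 + Q y) ^ (-((n : ℝ) + 2) / 2)) ?_ ?_ ?_ ?_
      · filter_upwards [self_mem_nhdsWithin] with ε hε
        have hε0 : 0 < ε := hε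
        have hpos : ∀ y, 0 < ε ^ 2 * (1 + Q y) := fun y => by
          have := hQ0 y
          positivity
        have hc1 : Continuous fun y => ε ^ 2 * (1 + Q y) :=
          continuous_const.mul (continuous_const.add hQc)
        have hc2 : Continuous fun y => (1 + Q y) ^ (-((n : ℝ) + 2) / 2) :=
          (continuous_const.add hQc).rpow_const fun y => Or.inl (by linarith [hQ0 y] : (0:ℝ) < 1 + Q y).ne'
        have hc3 : Continuous fun y => (ε ^ 2 * (1 + Q y)) ^ (-(-((n : ℝ) + 2) / 2)) :=
          hc1.rpow_const fun y => Or.inl (hpos y).ne'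
        exact (((continuous_const.mul (Complex.continuous_ofReal.comp hc2)).mul
          ((Complex.continuous_ofReal.comp hc3).mul (h3.comp_continuous hc1 hpos))).mul
          (hψ.continuous.comp (continuous_const_smul ε))).aestronglyMeasurable
      · filter_upwards [Ioo_mem_nhdsGT (one_pos : (0 : ℝ) < 1)] with ε hε
        refine Eventually.of_forall fun y => ?_
        have h1Q : 0 < 1 + Q y := by linarith [hQ0 y]
        have hε0 : 0 < ε := hε.1
        by_cases hy : R ≤ ‖ε • y‖
        · rw [(hsupp _ hy).1, mul_zero, norm_zero]
          positivity
        · push Not at hy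
          have hs : ε ^ 2 * (1 + Q y) ∈ Set.Ioc 0 R' := by
            refine ⟨by positivity, ?_⟩
            have a1 : ε * ‖invApply T y‖ ≤ K * R := by
              have := (hKb y).2
              rw [norm_smul, Real.norm_eq_abs, abs_of_pos hε0] at hy
              calc ε * ‖invApply T y‖ ≤ ε * (K * ‖y‖) := by gcongr
                _ = K * (ε * ‖y‖) := by ring
                _ ≤ K * R := by gcongr
            have a2 : ε ^ 2 * Q y ≤ (K * R) ^ 2 := by
              simp only [hQ]
              rw [← mul_pow]
              gcongr
            nlinarith [hε.1, hε.2]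
          have b1 := hC _ hs
          have b2 : ‖(((ε ^ 2 * (1 + Q y)) ^ (-(-((n : ℝ) + 2) / 2)) : ℝ) : ℂ)
              * f'' (ε ^ 2 * (1 + Q y))‖ ≤ C := by
            rw [norm_mul, Complex.norm_real, Real.norm_eq_abs,
              abs_of_pos (Real.rpow_pos_of_pos hs.1 _)]
            calc _ ≤ (ε ^ 2 * (1 + Q y)) ^ (-(-((n : ℝ) + 2) / 2))
                  * (C * (ε ^ 2 * (1 + Q y)) ^ (-((n : ℝ) + 2) / 2)) := by
                  gcongr
              _ = C := by
                  rw [Real.rpow_neg hs.1.le, mul_comm C, ← mul_assoc,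
                    inv_mul_cancel₀ (Real.rpow_pos_of_pos hs.1 _).ne', one_mul]
          rw [norm_mul, norm_mul, norm_mul, Complex.norm_real, Real.norm_eq_abs,
            abs_of_pos (Real.rpow_pos_of_pos h1Q _), norm_neg]
          calc _ ≤ ‖(4 : ℂ)‖ * (1 + Q y) ^ (-((n : ℝ) + 2) / 2) * C * Mψ := by
                gcongr
                exact hMψ _
            _ = _ := by
                norm_num
                ring
      · exact (integrable_one_add_quadratic hT).const_mul _
      · refine Eventually.of_forall fun y => ?_
        have h1Q : 0 < 1 + Q y := by linarith [hQ0 y]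
        refine Tendsto.mul (Tendsto.const_mul _ ?_) ?_
        · refine hlim.comp (tendsto_nhdsWithin_iff.2 ⟨?_, ?_⟩)
          · have : Continuous fun ε : ℝ => ε ^ 2 * (1 + Q y) := by fun_prop
            simpa using (this.tendsto 0).mono_left nhdsWithin_le_nhds
          · filter_upwards [self_mem_nhdsWithin] with ε hε
            have hε0 : 0 < ε := hε
            exact Set.mem_Ioi.2 (by positivity)
        · have : Continuous fun ε : ℝ => ψ (ε • y) :=
            hψ.continuous.comp (continuous_id.smul continuous_const)
          simpa using (this.tendsto 0).mono_left nhdsWithin_le_nhds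
    refine this.congr' ?_
    filter_upwards [self_mem_nhdsWithin] with ε hε using (scale ε hε).symm
  have heq := tendsto_nhds_unique lhs (rhs.congr' (by
    filter_upwards [self_mem_nhdsWithin] with ε hε using (reg ε hε).symm))
  change ∫ x, f (Q x) * g x = _
  rw [heq, integral_mul_const, integral_mul_const, integral_const_mul, integral_complex_ofReal,
    integral_one_add_quadratic (by omega) hT]
  ring

end

noncomputable section

/-! ### An explicit fundamental solution -/

section Exponential

variable {n : ℕ}

/-- The complex linear form `x ↦ ∑ β_j x_j`. -/
def cpair (β : Fin n → ℂ) (x : RSpace n) : ℂ := ∑ j, β j * (x j : ℂ)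

lemma cpair_eq_pairing (β : Fin n → ℂ) (x : RSpace n) : cpair β x = pairing β x := by
  simp [cpair, pairing, mul_comm]

lemma pairing_single (v : Fin n → ℂ) (j : Fin n) :
    pairing v (EuclideanSpace.single j 1) = v j := by
  rw [← cpair_eq_pairing, cpair, Finset.sum_eq_single j]
  · simp
  · intro b _ hb
    simp [hb]
  · simp

/-- The exponential factor that removes the first order terms. -/
def expFactor (β : Fin n → ℂ) (x : RSpace n) : ℂ := Complex.exp (-cpair β x)

lemma expFactor_eq (β : Fin n → ℂ) : expFactor β = fun x => Complex.exp (-pairing β x) := by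
  ext x
  rw [expFactor, cpair_eq_pairing]

lemma contDiff_expFactor (β : Fin n → ℂ) : ContDiff ℝ ∞ (expFactor β) := by
  rw [expFactor_eq]
  exact (pairing β).contDiff.neg.cexp

lemma partialD_expFactor (β : Fin n → ℂ) (j : Fin n) (x : RSpace n) :
    partialD j (expFactor β) x = -β j * expFactor β x := by
  have h : HasFDerivAt (expFactor β) (Complex.exp (-pairing β x) • (-pairing β)) x := by
    rw [expFactor_eq]
    exact (pairing β).hasFDerivAt.neg.cexp
  rw [h.partialD_eq, expFactor_eq]
  simp [pairing_single]
  ring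

lemma partialD_expFactor_mul (β : Fin n → ℂ) (j : Fin n) {φ : RSpace n → ℂ}
    (hφ : ContDiff ℝ ∞ φ) :
    partialD j (fun x => expFactor β x * φ x)
      = fun x => expFactor β x * (partialD j φ x - β j * φ x) := by
  ext x
  rw [partialD_mul j ((contDiff_expFactor β).differentiable (by simp) x)
    (hφ.differentiable (by simp) x), partialD_expFactor]
  ring

/-- This is completing the square. On the conjugated function each ∂_j acts as ∂_j - β_j, and the
choice of β makes the cross terms equal to the first order terms of the transposed operator. What is
left over is the constant βᵗ a⁽²⁾ β. -/
lemma expFactor_mul_transposeOp {a : (Fin n → ℕ) → ℂ} {β : Fin n → ℂ}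
    (hβ : ∀ l, 2 * ∑ j, coeffTwo a l j * β j = coeffOne a l) {φ : RSpace n → ℂ}
    (hφ : ContDiff ℝ ∞ φ) (x : RSpace n) :
    expFactor β x * transposeOp a φ x
      = ∑ l, ∑ j, coeffTwo a l j * partialD l (partialD j fun x => expFactor β x * φ x) x
        + (a 0 - ∑ l, ∑ j, coeffTwo a l j * β l * β j) * (expFactor β x * φ x) := by
  have h2 : ∀ l j, partialD l (partialD j fun x => expFactor β x * φ x) x
      = expFactor β x * (partialD l (partialD j φ) x - β j * partialD l φ x
        - β l * (partialD j φ x - β j * φ x)) := by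
    intro l j
    rw [partialD_expFactor_mul β j hφ, partialD_expFactor_mul β l
      ((contDiff_partialD hφ j).sub (contDiff_const.mul hφ))]
    simp only
    rw [partialD_sub l ((contDiff_partialD hφ j).differentiable (by simp) x)
      ((hφ.differentiable (by simp) x).const_mul _), partialD_const_mul l _
      (hφ.differentiable (by simp) x)]
  have e1 : ∑ l, coeffOne a l * partialD l φ x
      = ∑ l, ∑ j, (coeffTwo a l j * β j * partialD l φ x + coeffTwo a l j * β l * partialD j φ x) := by
    simp only [Finset.sum_add_distrib]
    rw [Finset.sum_comm (f := fun l j => coeffTwo a l j * β l * partialD j φ x),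
      ← Finset.sum_add_distrib]
    refine Finset.sum_congr rfl fun l _ => ?_
    rw [← hβ l, Finset.mul_sum, Finset.sum_mul, ← Finset.sum_add_distrib]
    refine Finset.sum_congr rfl fun j _ => ?_
    rw [coeffTwo_symm a j l]
    ring
  simp only [h2, transposeOp]
  rw [e1, sub_mul, Finset.sum_mul, mul_add, mul_sub]
  simp only [Finset.mul_sum, Finset.sum_mul]
  have e2 : ∑ l, ∑ j, coeffTwo a l j * (expFactor β x * (partialD l (partialD j φ) x
        - β j * partialD l φ x - β l * (partialD j φ x - β j * φ x)))
      = ∑ l, ∑ j, expFactor β x * (coeffTwo a l j * partialD l (partialD j φ) x)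
        - ∑ l, ∑ j, expFactor β x * (coeffTwo a l j * β j * partialD l φ x
          + coeffTwo a l j * β l * partialD j φ x)
        + ∑ l, ∑ j, coeffTwo a l j * β l * β j * (expFactor β x * φ x) := by
    simp only [← Finset.sum_add_distrib, ← Finset.sum_sub_distrib]
    refine Finset.sum_congr rfl fun l _ => Finset.sum_congr rfl fun j _ => ?_
    ring
  rw [e2]
  ring

end Exponential

/-- The normalising constant of a radial profile. -/
def profileConst (n : ℕ) : ℝ :=
  if n = 2 then 1 / (2 * sphereArea n) else 1 / ((2 - (n : ℝ)) * sphereArea n)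

/-- The fundamental solution built from a radial profile. -/
def profileSolution {n : ℕ} (T : Matrix (Fin n) (Fin n) ℝ) (β : Fin n → ℂ) (G J : ℂ → ℂ)
    (x : RSpace n) : ℂ :=
  ((profileConst n / |T.det| : ℝ) : ℂ) * (expFactor β x
    * frobeniusFn (1 - n / 2) G J (‖invApply T x‖ ^ 2))

section ProfileSolution

variable {n : ℕ} {T : Matrix (Fin n) (Fin n) ℝ} {β : Fin n → ℂ} {G J : ℂ → ℂ}

lemma continuousOn_profileSolution (hT : IsUnit T) (hG : Differentiable ℂ G)
    (hJ : Differentiable ℂ J) : ContinuousOn (profileSolution T β G J) {0}ᶜ := by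
  refine continuousOn_const.mul ((contDiff_expFactor β).continuous.continuousOn.mul ?_)
  refine (continuousOn_frobeniusFn hG hJ).comp ((continuous_invApply T).norm.pow 2).continuousOn ?_
  intro x hx
  have := norm_pos_iff.2 (invApply_ne_zero hT hx)
  exact Set.mem_Ioi.2 (by positivity)

lemma locallyIntegrable_of_bound {n : ℕ} (hn : 1 ≤ n) {u : RSpace n → ℂ}
    (hu : ContinuousOn u {0}ᶜ)
    (hb : ∀ R : ℝ, ∃ C : ℝ, ∀ x : RSpace n, x ≠ 0 → ‖x‖ < R → ‖u x‖ ≤ C * (‖x‖ ^ (n - 1))⁻¹) :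
    LocallyIntegrable u := by
  have hntr : Nontrivial (RSpace n) := by
    have : Nonempty (Fin n) := ⟨⟨0, by omega⟩⟩
    infer_instance
  have hmeas : AEStronglyMeasurable u volume := by
    have := hu.aestronglyMeasurable (μ := volume) (measurableSet_singleton (0 : RSpace n)).compl
    rwa [restrict_compl_singleton] at this
  intro x
  obtain ⟨C, hC⟩ := hb (‖x‖ + 1)
  refine ⟨Metric.ball 0 (‖x‖ + 1), Metric.isOpen_ball.mem_nhds (by simp), ?_⟩
  refine Integrable.mono' ((integrableOn_norm_pow_inv hn (‖x‖ + 1)).const_mul C) hmeas.restrict ?_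
  have h0 : ∀ᵐ y ∂(volume.restrict (Metric.ball (0 : RSpace n) (‖x‖ + 1))), y ≠ 0 :=
    ae_restrict_of_ae (Measure.ae_ne volume 0)
  filter_upwards [h0, ae_restrict_mem measurableSet_ball] with y hy hyb
  exact hC y hy (by simpa using hyb)

/-- The profile is of size s^((1-n)/2) on bounded sets, and |T⁻¹x| is comparable to |x|, so
|x|^(1-n) is a local majorant. -/
lemma locallyIntegrable_profileSolution (hn : 2 ≤ n) (hT : IsUnit T) (hG : Differentiable ℂ G)
    (hJ : Differentiable ℂ J) : LocallyIntegrable (profileSolution T β G J) := by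
  refine locallyIntegrable_of_bound (by omega) (continuousOn_profileSolution hT hG hJ) fun R => ?_
  obtain ⟨K, hK, hKb⟩ := exists_norm_le_invApply hT
  have hn' : (2 : ℝ) ≤ n := by exact_mod_cast hn
  obtain ⟨C, hC⟩ := frobeniusFn_bound (p := 1 - n / 2) (t := -((n : ℝ) - 1) / 2) hG hJ
    (by linarith) (by linarith) ((K * R) ^ 2 + 1)
  have hC0 : 0 ≤ C := by
    have := (norm_nonneg _).trans (hC 1 ⟨one_pos, by nlinarith [sq_nonneg (K * R)]⟩)
    simpa using this
  obtain ⟨M, hM⟩ := (isCompact_closedBall (0 : RSpace n) R).exists_bound_of_continuousOn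
      (contDiff_expFactor β).continuous.continuousOn
  refine ⟨‖((profileConst n / |T.det| : ℝ) : ℂ)‖ * (M * (C * K ^ (n - 1))), fun x hx hxR => ?_⟩
  have hxpos : 0 < ‖x‖ := norm_pos_iff.2 hx
  have hMx : 0 < ‖invApply T x‖ := norm_pos_iff.2 (invApply_ne_zero hT hx)
  have hle : ‖invApply T x‖ ^ 2 ≤ (K * R) ^ 2 + 1 := by
    have a1 : ‖invApply T x‖ ≤ K * R := (hKb x).2.trans (by gcongr)
    have : ‖invApply T x‖ ^ 2 ≤ (K * R) ^ 2 := by gcongr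
    linarith
  have b1 := hC (‖invApply T x‖ ^ 2) ⟨by positivity, hle⟩
  have b3 : (‖invApply T x‖ ^ 2) ^ (-((n : ℝ) - 1) / 2) = (‖invApply T x‖ ^ (n - 1))⁻¹ := by
    rw [← Real.rpow_natCast, ← Real.rpow_natCast, ← Real.rpow_mul hMx.le,
      ← Real.rpow_neg hMx.le, Nat.cast_sub (by omega)]
    congr 1
    push_cast
    ring
  have b4 : (‖invApply T x‖ ^ (n - 1))⁻¹ ≤ K ^ (n - 1) * (‖x‖ ^ (n - 1))⁻¹ := by
    rw [← div_eq_mul_inv, le_div_iff₀ (by positivity), inv_mul_le_iff₀ (by positivity),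
      ← mul_pow, mul_comm]
    exact pow_le_pow_left₀ hxpos.le (hKb x).1 _
  have hM' := hM x (by simpa using hxR.le)
  have hM0 : 0 ≤ M := (norm_nonneg _).trans hM'
  rw [profileSolution, norm_mul, norm_mul]
  calc _ ≤ ‖((profileConst n / |T.det| : ℝ) : ℂ)‖ * (M * (C * (K ^ (n - 1) * (‖x‖ ^ (n - 1))⁻¹))) := by
        gcongr
        exact b1.trans (by rw [b3]; gcongr)
    _ = _ := by ring

/-- The profile solution is a fundamental solution. -/
theorem isFundamentalSolution_profileSolution (hn : 2 ≤ n) {a : (Fin n → ℕ) → ℂ}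
    (har : HasRealPrincipalPart a) (hT : IsUnit T) (hA : realCoeffTwo a = T * T.transpose)
    (hβ : ∀ l, 2 * ∑ j, coeffTwo a l j * β j = coeffOne a l)
    (hGJ : IsRadialProfile n (a 0 - ∑ l, ∑ j, coeffTwo a l j * β l * β j) G J) :
    IsFundamentalSolution a (profileSolution T β G J) where
  locallyIntegrable := locallyIntegrable_profileSolution hn hT hGJ.diffG hGJ.diffJ
  continuousOn := continuousOn_profileSolution hT hGJ.diffG hGJ.diffJ
  weak_eq φ hφ hφc := by
    set κ := a 0 - ∑ l, ∑ j, coeffTwo a l j * β l * β j with hκ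
    have hn' : (2 : ℝ) ≤ n := by exact_mod_cast hn
    have hdet : T.det ≠ 0 := ((Matrix.isUnit_iff_isUnit_det _).1 hT).ne_zero
    have hp := exponent_alternative hn hGJ.odd_dim
    have hp' : deriv J = 0 ∨ ∃ k : ℕ, (1 - (n : ℝ) / 2 - 1) = -k := by
      rcases hp with rfl | ⟨k, hk⟩
      · left
        ext z
        simp
      · right
        exact ⟨k + 1, by rw [hk]; push_cast; ring⟩
    have hJ1 := differentiable_deriv_of_entire hGJ.diffJ
    have hJ2 := differentiable_deriv_of_entire hJ1
    obtain ⟨G1, dG1, G10, hd1⟩ := hasDerivAt_frobeniusFn hGJ.diffG hGJ.diffJ hp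
    obtain ⟨G2, dG2, G20, hd2⟩ := hasDerivAt_frobeniusFn dG1 hJ1 hp'
    obtain ⟨f', f'', hode⟩ := hGJ.ode
    have e1 : ∀ s : ℝ, 0 < s → f' s = frobeniusFn (1 - (n : ℝ) / 2 - 1) G1 (deriv J) s :=
      fun s hs => (hode s hs).1.unique (hd1 s hs)
    have e2 : ∀ s : ℝ, 0 < s →
        f'' s = frobeniusFn (1 - (n : ℝ) / 2 - 1 - 1) G2 (deriv (deriv J)) s := fun s hs => by
      refine (hode s hs).2.1.unique ((hd2 s hs).congr_of_eventuallyEq ?_)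
      filter_upwards [lt_mem_nhds hs] with t ht using e1 t ht
    have hexp : 1 - (n : ℝ) / 2 - 1 - 1 = -((n : ℝ) + 2) / 2 := by ring
    set ψ : RSpace n → ℂ := fun x => expFactor β x * φ x with hψdef
    have hψ : ContDiff ℝ ∞ ψ := (contDiff_expFactor β).mul hφ
    have hψc : HasCompactSupport ψ := hφc.mul_left
    have main := integral_radial_mul hn hT hA (κ := κ) (h₀ := G2 0) (f := frobeniusFn (1 - n / 2) G J)
      (f' := f') (f'' := f'') (fun s hs => (hode s hs).1) (fun s hs => (hode s hs).2.1)
      ((continuousOn_frobeniusFn dG2 hJ2).congr fun s hs => e2 s hs)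
      (fun s hs => (hode s hs).2.2)
      (fun R => frobeniusFn_bound hGJ.diffG hGJ.diffJ (by linarith) (by linarith) R)
      (fun R => by
        obtain ⟨C, hC⟩ := frobeniusFn_bound (p := 1 - (n : ℝ) / 2 - 1 - 1)
          (t := -((n : ℝ) + 2) / 2) dG2 hJ2 hexp.ge (by linarith) R
        exact ⟨C, fun s hs => by rw [e2 s hs.1]; exact hC s hs⟩)
      (by
        have := frobeniusFn_tendsto (p := 1 - (n : ℝ) / 2 - 1 - 1) dG2 hJ2 (by linarith)
        rw [hexp] at this
        refine this.congr' ?_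
        filter_upwards [self_mem_nhdsWithin] with s hs
        rw [e2 s hs, hexp])
      hψ hψc
    have hpt : ∀ x, profileSolution T β G J x * transposeOp a φ x
        = ((profileConst n / |T.det| : ℝ) : ℂ) * (frobeniusFn (1 - n / 2) G J (‖invApply T x‖ ^ 2)
          * (∑ l, ∑ j, (realCoeffTwo a l j : ℂ) * partialD l (partialD j ψ) x + κ * ψ x)) := by
      intro x
      have := expFactor_mul_transposeOp hβ hφ x
      simp only [← coeffTwo_eq_ofReal har]
      rw [hκ, hψdef, ← this, profileSolution]
      ring
    simp only [hpt]
    rw [integral_const_mul, main]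
    have hψ0 : ψ 0 = φ 0 := by simp [hψdef, expFactor, cpair]
    have hs : sphereArea n ≠ 0 := (sphereArea_pos (by omega)).ne'
    have hn0 : (n : ℝ) ≠ 0 := by positivity
    have hab : |T.det| ≠ 0 := abs_ne_zero.2 hdet
    -- For n ≠ 2 the second derivative of s^(1-n/2) gives h₀ = (1 - n/2)(-n/2); for n = 2 that of
    -- log s gives -1. In both cases `profileConst` is the reciprocal of the resulting mass, once
    -- the determinant is cancelled.
    obtain ⟨h₀, hh₀, hc⟩ : ∃ h₀ : ℝ, G2 0 = h₀ ∧
        profileConst n / |T.det| * (-4 * h₀ * (|T.det| * (sphereArea n / n))) = 1 := by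
      have hne : (1 - (n : ℝ) / 2 - 1) ≠ 0 := by linarith
      rw [if_neg hne, add_zero] at G20
      rcases eq_or_ne n 2 with rfl | h2
      · refine ⟨-1, ?_, ?_⟩
        · rw [G20, G10, hGJ.leading_two rfl]
          norm_num
        · rw [profileConst, if_pos rfl]
          push_cast
          field_simp
          norm_num
      · have hne' : (1 - (n : ℝ) / 2) ≠ 0 := fun h0 => h2 (by
          have : (n : ℝ) = 2 := by linarith
          exact_mod_cast this)
        have hne2 : 2 - (n : ℝ) ≠ 0 := fun h => hne' (by linarith)
        refine ⟨(1 - (n : ℝ) / 2 - 1) * (1 - n / 2), ?_, ?_⟩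
        · rw [G20, G10, hGJ.leading h2, if_neg hne']
          push_cast
          ring
        · rw [profileConst, if_neg h2]
          field_simp
          ring
    rw [hh₀, hψ0, ← mul_assoc]
    have := congrArg (fun t : ℝ => (t : ℂ)) hc
    push_cast at this ⊢
    rw [this, one_mul]

end ProfileSolution

end

noncomputable section

/-! ### Real analyticity of convolution integrals -/

section AnalyticIntegral

open scoped NNReal ENNReal

variable {E : Type*} [NormedAddCommGroup E] [NormedSpace ℝ E]

/-- The standard majorant for the recentred coefficients depends on the new centre only through its
norm and increases with it, so its value at ρ serves all centres at once. This uniformity allows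
Taylor series to be integrated over a family of centres. -/
lemma changeOrigin_uniform_bound (p : FormalMultilinearSeries ℝ E ℂ) {ρ ρ' : ℝ≥0}
    (hr : (ρ + ρ' : ℝ≥0∞) < p.radius) :
    ∃ b : ℕ → ℝ≥0, (Summable fun k => b k * ρ' ^ k) ∧
      ∀ v : E, ‖v‖₊ ≤ ρ → ∀ k, ‖p.changeOrigin v k‖₊ ≤ b k := by
  have hρ : (ρ : ℝ≥0∞) < p.radius := lt_of_le_of_lt le_self_add hr
  refine ⟨fun k => ∑' s : Σ l : ℕ, { s : Finset (Fin (k + l)) // s.card = l },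
    ‖p (k + s.1)‖₊ * ρ ^ s.1, ?_, fun v hv k => ?_⟩
  · have := (NNReal.summable_sigma.1 (p.changeOriginSeries_summable_aux₁ hr)).2
    simpa only [NNReal.tsum_mul_right] using this
  · have hv' : (‖v‖₊ : ℝ≥0∞) ≤ ρ := by exact_mod_cast hv
    refine (p.nnnorm_changeOrigin_le k (hv'.trans_lt hρ)).trans ?_
    refine Summable.tsum_le_tsum (fun s => ?_) (p.changeOriginSeries_summable_aux₂ (hv'.trans_lt hρ) k)
      (p.changeOriginSeries_summable_aux₂ hρ k)
    gcongr

variable [MeasurableSpace E] [BorelSpace E] [SecondCountableTopology E] {μ : Measure E}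

/-- For y near y₀ the Taylor series of f at x₀ - y is the series at x₀ - y₀ recentred by y₀ - y. Its
coefficients, integrated against g, form a power series for the integral, by dominated convergence.
The integrability statement is recorded so that integrals over disjoint pieces can be added. -/
lemma analyticAt_setIntegral_of_subset_ball {f g : E → ℂ} {p : FormalMultilinearSeries ℝ E ℂ}
    {x₀ y₀ : E} {r : ℝ≥0∞} {ρ ρ' : ℝ≥0} (hf : HasFPowerSeriesOnBall f p (x₀ - y₀) r)
    (hρ' : 0 < ρ') (hr : (ρ + ρ' : ℝ≥0∞) < r) (hg : Integrable g μ) {t : Set E}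
    (ht : MeasurableSet t) (hts : t ⊆ Metric.ball y₀ ρ) :
    AnalyticAt ℝ (fun x => ∫ y in t, f (x - y) * g y ∂μ) x₀ ∧
      ∀ᶠ x in 𝓝 x₀, IntegrableOn (fun y => f (x - y) * g y) t μ := by
  obtain ⟨b, hb, hbk⟩ := changeOrigin_uniform_bound p (hr.trans_le hf.r_le)
  have hv : ∀ y ∈ t, ‖y₀ - y‖₊ ≤ ρ := fun y hy => by
    have := hts hy
    rw [Metric.mem_ball, dist_comm, dist_eq_norm] at this
    exact_mod_cast this.le
  set P : ∀ k, E → (E [×k]→L[ℝ] ℂ) := fun k y => p.changeOrigin (y₀ - y) k with hP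
  have hPc : ∀ k, ContinuousOn (P k) t := fun k => by
    have h0 : 0 < p.radius := hf.r_pos.trans_le hf.r_le
    have h1 := (p.hasFPowerSeriesOnBall_changeOrigin k h0).continuousOn
    refine h1.comp (continuous_const.sub continuous_id).continuousOn fun y hy => ?_
    rw [Metric.mem_eball, edist_zero_right]
    have : (‖y₀ - y‖₊ : ℝ≥0∞) ≤ ρ := by exact_mod_cast hv y hy
    exact (this.trans_lt (lt_of_le_of_lt le_self_add hr)).trans_le hf.r_le
  have hgt : Integrable g (μ.restrict t) := hg.restrict
  have hPi : ∀ k, Integrable (fun y => g y • P k y) (μ.restrict t) := fun k => by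
    refine Integrable.mono' (g := fun y => b k * ‖g y‖) (hgt.norm.const_mul _)
      (hgt.aestronglyMeasurable.smul ((hPc k).aestronglyMeasurable ht)) ?_
    filter_upwards [ae_restrict_mem ht] with y hy
    rw [norm_smul, mul_comm]
    gcongr
    exact_mod_cast hbk _ (hv y hy) k
  set q : FormalMultilinearSeries ℝ E ℂ := fun k => ∫ y in t, g y • P k y ∂μ with hq
  have hqb : ∀ k, ‖q k‖ ≤ (∫ y in t, ‖g y‖ ∂μ) * b k := fun k => by
    refine (norm_integral_le_integral_norm _).trans ?_
    rw [← integral_mul_const]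
    refine integral_mono_ae (hPi k).norm (hgt.norm.mul_const _) ?_
    filter_upwards [ae_restrict_mem ht] with y hy
    rw [norm_smul]
    gcongr
    exact_mod_cast hbk _ (hv y hy) k
  have hb' : Summable fun k => (b k : ℝ) * (ρ' : ℝ) ^ k := by exact_mod_cast hb
  have hasSum : ∀ {z : E}, z ∈ Metric.eball (0 : E) ρ' → ∀ y ∈ t,
      HasSum (fun k => P k y fun _ => z) (f (x₀ + z - y)) := by
    intro z hz y hy
    have hlt : (‖y₀ - y‖₊ : ℝ≥0∞) ≤ ρ := by exact_mod_cast hv y hy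
    have h1 := hf.changeOrigin (y := y₀ - y) (hlt.trans_lt (lt_of_le_of_lt le_self_add hr))
    have h2 := h1.hasSum (y := z) (by
      rw [Metric.mem_eball] at hz ⊢
      refine hz.trans_le ?_
      refine le_trans ?_ (tsub_le_tsub_left hlt r)
      exact ENNReal.le_sub_of_add_le_left ENNReal.coe_ne_top hr.le)
    have e : x₀ - y₀ + (y₀ - y) + z = x₀ + z - y := by abel
    rwa [e] at h2
  have hnz : ∀ {z : E}, z ∈ Metric.eball (0 : E) ρ' → ‖z‖ ≤ ρ' := fun {z} hz => by
    rw [Metric.eball_coe, mem_ball_zero_iff] at hz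
    exact hz.le
  have hterm : ∀ {z : E}, z ∈ Metric.eball (0 : E) ρ' → ∀ y ∈ t, ∀ k,
      ‖P k y fun _ => z‖ ≤ b k * (ρ' : ℝ) ^ k := by
    intro z hz y hy k
    refine (ContinuousMultilinearMap.le_opNorm _ _).trans ?_
    rw [Finset.prod_const, Finset.card_univ, Fintype.card_fin]
    have h1 : ‖P k y‖ ≤ b k := by exact_mod_cast hbk _ (hv y hy) k
    have h2 := hnz hz
    gcongr
  constructor
  · refine HasFPowerSeriesOnBall.analyticAt (p := q) (r := ρ') ⟨?_, by exact_mod_cast hρ', ?_⟩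
    · refine q.le_radius_of_summable ?_
      refine Summable.of_nonneg_of_le (fun k => by positivity) (fun k => ?_)
        (hb'.mul_left (∫ y in t, ‖g y‖ ∂μ))
      calc ‖q k‖ * (ρ' : ℝ) ^ k ≤ (∫ y in t, ‖g y‖ ∂μ) * b k * (ρ' : ℝ) ^ k := by
            gcongr
            exact hqb k
        _ = _ := by ring
    · intro z hz
      have e : ∀ k, (q k fun _ => z) = ∫ y in t, g y * (P k y fun _ => z) ∂μ := fun k => by
        rw [hq]
        simp only
        rw [ContinuousMultilinearMap.integral_apply (hPi k)]
        rfl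
      simp only [e]
      have hlim : HasSum (fun k => ∫ y in t, g y * (P k y fun _ => z) ∂μ)
          (∫ y in t, g y * f (x₀ + z - y) ∂μ) := by
        refine hasSum_integral_of_dominated_convergence
          (fun k y => ‖g y‖ * (b k * (ρ' : ℝ) ^ k)) (fun k => ?_) (fun k => ?_) ?_ ?_ ?_
        · have hc : ContinuousOn (fun y => P k y fun _ => z) t :=
            (ContinuousMultilinearMap.apply ℝ (fun _ => E) ℂ (fun _ => z)).continuous.comp_continuousOn
              (hPc k)
          exact hgt.aestronglyMeasurable.mul (hc.aestronglyMeasurable ht)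
        · filter_upwards [ae_restrict_mem ht] with y hy
          rw [norm_mul]
          gcongr
          exact hterm hz y hy k
        · exact Eventually.of_forall fun y => hb'.mul_left _
        · simp only [tsum_mul_left]
          exact hgt.norm.mul_const _
        · filter_upwards [ae_restrict_mem ht] with y hy
          exact (hasSum hz y hy).mul_left _
      simpa only [mul_comm] using hlim
  · have hnhds : Metric.eball x₀ ρ' ∈ 𝓝 x₀ := Metric.eball_mem_nhds _ (by exact_mod_cast hρ')
    filter_upwards [hnhds] with x hx
    have hz : x - x₀ ∈ Metric.eball (0 : E) ρ' := by
      rw [Metric.mem_eball, edist_zero_right]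
      rw [Metric.mem_eball, edist_eq_enorm_sub] at hx
      exact hx
    have hfc : ContinuousOn (fun y => f (x - y)) t := by
      refine hf.continuousOn.comp (continuous_const.sub continuous_id).continuousOn fun y hy => ?_
      rw [Metric.mem_eball, edist_eq_enorm_sub]
      have e : x - y - (x₀ - y₀) = (y₀ - y) + (x - x₀) := by abel
      rw [e]
      refine (enorm_add_le _ _).trans_lt (lt_of_le_of_lt (add_le_add ?_ ?_) hr)
      · have := hv y hy
        rw [enorm_eq_nnnorm]
        exact_mod_cast this
      · have := hnz hz
        rw [enorm_eq_nnnorm]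
        exact_mod_cast this
    refine Integrable.mono' (g := fun y => (∑' k, (b k : ℝ) * (ρ' : ℝ) ^ k) * ‖g y‖)
      (hgt.norm.const_mul _)
      ((hfc.aestronglyMeasurable ht).mul hgt.aestronglyMeasurable) ?_
    filter_upwards [ae_restrict_mem ht] with y hy
    rw [norm_mul]
    gcongr
    have h1 := hasSum hz y hy
    rw [add_sub_cancel] at h1
    exact h1.norm_le_of_bounded hb'.hasSum (hterm hz y hy)

/-- The convolution of a function that is analytic near `x₀ - Y` with an integrable function
carried by the compact set `Y` is analytic at `x₀`. -/
theorem analyticAt_convolution_integral {f g : E → ℂ} {Y : Set E} (hY : IsCompact Y) {x₀ : E}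
    (hf : ∀ y ∈ Y, AnalyticAt ℝ f (x₀ - y)) (hg : Integrable g μ) (hgY : ∀ y ∉ Y, g y = 0) :
    AnalyticAt ℝ (fun x => ∫ y, f (x - y) * g y ∂μ) x₀ := by
  let good : Set E → Prop := fun t => AnalyticAt ℝ (fun x => ∫ y in t, f (x - y) * g y ∂μ) x₀ ∧
      ∀ᶠ x in 𝓝 x₀, IntegrableOn (fun y => f (x - y) * g y) t μ
  -- The claim is made for every measurable subset of `s'`, so that in the union step the pieces can
  -- be cut to be disjoint.
  have key : ∃ s', MeasurableSet s' ∧ Y ⊆ s' ∧ ∀ t, MeasurableSet t → t ⊆ s' → good t := by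
    refine hY.induction_on (p := fun s => ∃ s', MeasurableSet s' ∧ s ⊆ s' ∧
      ∀ t, MeasurableSet t → t ⊆ s' → good t) ?_ ?_ ?_ ?_
    · refine ⟨∅, MeasurableSet.empty, subset_rfl, fun t _ ht => ?_⟩
      obtain rfl : t = ∅ := Set.subset_empty_iff.1 ht
      exact ⟨by simpa using analyticAt_const, by simp⟩
    · rintro s s₁ hs ⟨s', h1, h2, h3⟩
      exact ⟨s', h1, hs.trans h2, h3⟩
    · rintro s₁ s₂ ⟨s₁', h1, h2, h3⟩ ⟨s₂', h1', h2', h3'⟩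
      refine ⟨s₁' ∪ s₂', h1.union h1', Set.union_subset_union h2 h2', fun t ht hts => ?_⟩
      obtain ⟨a1, i1⟩ := h3 (t ∩ s₁') (ht.inter h1) Set.inter_subset_right
      obtain ⟨a2, i2⟩ := h3' (t \ s₁') (ht.diff h1) fun y hy => (hts hy.1).resolve_left hy.2
      have hun : t = (t ∩ s₁') ∪ (t \ s₁') := (Set.inter_union_sdiff t s₁').symm
      refine ⟨(a1.add a2).congr ?_, ?_⟩
      · filter_upwards [i1, i2] with x h1x h2x
        simp only [Pi.add_apply]
        conv_rhs => rw [hun]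
        rw [setIntegral_union Set.disjoint_sdiff_inter.symm (ht.diff h1) h1x h2x]
      · filter_upwards [i1, i2] with x h1x h2x
        rw [hun]
        exact h1x.union h2x
    · intro y₀ hy₀
      obtain ⟨p, r, hp⟩ := hf y₀ hy₀
      obtain ⟨ρ, hρ, hρr⟩ : ∃ ρ : ℝ≥0, 0 < ρ ∧ (ρ + ρ : ℝ≥0∞) < r := by
        obtain ⟨δ, hδ, hδr⟩ := ENNReal.lt_iff_exists_nnreal_btwn.1 hp.r_pos
        refine ⟨δ / 2, by
          have : 0 < δ := by exact_mod_cast hδ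
          positivity, ?_⟩
        rw [← ENNReal.coe_add, add_halves]
        exact hδr
      refine ⟨Metric.ball y₀ ρ, mem_nhdsWithin_of_mem_nhds
        (Metric.ball_mem_nhds _ (by exact_mod_cast hρ)), Metric.ball y₀ ρ, measurableSet_ball,
        subset_rfl, fun t ht hts => ?_⟩
      exact analyticAt_setIntegral_of_subset_ball hp hρ hρr hg ht hts
  obtain ⟨s', -, hYs, hs'⟩ := key
  have h := (hs' Y hY.measurableSet hYs).1
  refine h.congr (Eventually.of_forall fun x => ?_)
  refine setIntegral_eq_integral_of_forall_compl_eq_zero fun y hy => ?_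
  simp [hgY y hy]

end AnalyticIntegral

end

noncomputable section

/-! ### Analytic hypoellipticity -/

section Weyl

variable {n : ℕ}

lemma MeasureTheory.LocallyIntegrable.comp_neg_arg {S : RSpace n → ℂ} (hS : LocallyIntegrable S) :
    LocallyIntegrable fun x => S (-x) := by
  intro x
  obtain ⟨s, hs, hi⟩ := hS (-x)
  refine ⟨Neg.neg ⁻¹' s, continuous_neg.continuousAt.preimage_mem_nhds hs, ?_⟩
  exact ((Measure.measurePreserving_neg volume).integrableOn_comp_preimage
    (Homeomorph.neg (RSpace n)).measurableEmbedding).2 hi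

/-- The correlation `y ↦ ∫ S(x - y) ψ(x) dx`. -/
def correlation (S ψ : RSpace n → ℂ) : RSpace n → ℂ :=
  convolution (fun x => S (-x)) ψ (ContinuousLinearMap.mul ℝ ℂ) volume

variable {S ψ : RSpace n → ℂ}

lemma correlation_eq (S ψ : RSpace n → ℂ) (y : RSpace n) :
    correlation S ψ y = ∫ x, S (x - y) * ψ x := by
  rw [correlation, convolution_eq_swap]
  simp

lemma correlation_eq' (S ψ : RSpace n → ℂ) (y : RSpace n) :
    correlation S ψ y = ∫ x, S x * ψ (x + y) := by
  rw [correlation_eq, ← integral_sub_right_eq_self (fun x => S x * ψ (x + y)) y]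
  simp

lemma integrable_correlation (hS : LocallyIntegrable S) (hψ : Continuous ψ)
    (hψc : HasCompactSupport ψ) (y : RSpace n) : Integrable fun x => S x * ψ (x + y) := by
  have := hS.integrable_smul_right_of_hasCompactSupport (g := fun x => ψ (x + y))
    (hψ.comp (continuous_add_const y)) (hψc.comp_homeomorph (Homeomorph.addRight y))
  simpa using this

lemma contDiff_correlation (hS : LocallyIntegrable S) (hψ : ContDiff ℝ ∞ ψ)
    (hψc : HasCompactSupport ψ) : ContDiff ℝ ∞ (correlation S ψ) :=
  hψc.contDiff_convolution_right _ hS.comp_neg_arg hψ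

lemma partialD_correlation (hS : LocallyIntegrable S) (hψ : ContDiff ℝ ∞ ψ)
    (hψc : HasCompactSupport ψ) (j : Fin n) :
    partialD j (correlation S ψ) = correlation S (partialD j ψ) := by
  ext y
  have h := hψc.hasFDerivAt_convolution_right (ContinuousLinearMap.mul ℝ ℂ) hS.comp_neg_arg
    (hψ.of_le (by simp)) y
  rw [correlation, h.partialD_eq, convolution_precompR_apply _ hS.comp_neg_arg (hψc.fderiv ℝ)
    (hψ.continuous_fderiv (by simp))]
  rfl

lemma contDiff_transposeOp (a : (Fin n → ℕ) → ℂ) (hψ : ContDiff ℝ ∞ ψ) :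
    Continuous (transposeOp a ψ) := by
  refine ((continuous_finsetSum _ fun l _ => continuous_finsetSum _ fun j _ => ?_).sub
    (continuous_finsetSum _ fun l _ => ?_)).add (continuous_const.mul hψ.continuous)
  · exact continuous_const.mul (contDiff_partialD (contDiff_partialD hψ j) l).continuous
  · exact continuous_const.mul (contDiff_partialD hψ l).continuous

lemma partialD_comp_add_right (j : Fin n) (f : RSpace n → ℂ) (y x : RSpace n) :
    partialD j (fun x => f (x + y)) x = partialD j f (x + y) := by
  rw [partialD, fderiv_comp_add_right]
  rfl

/-- The derivatives fall on ψ, and the defining equation of `S` tested against the translate ψ(· +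
y) gives ψ(y). Correlation with a fundamental solution thus inverts the transposed operator on test
functions. -/
lemma transposeOp_correlation {a : (Fin n → ℕ) → ℂ} (hS : IsFundamentalSolution a S)
    (hψ : ContDiff ℝ ∞ ψ) (hψc : HasCompactSupport ψ) : transposeOp a (correlation S ψ) = ψ := by
  ext y
  have hL := hS.locallyIntegrable
  have h1 : ∀ j, partialD j (correlation S ψ) = correlation S (partialD j ψ) :=
    partialD_correlation hL hψ hψc
  have h2 : ∀ l j, partialD l (partialD j (correlation S ψ))
      = correlation S (partialD l (partialD j ψ)) := fun l j => by
    rw [h1, partialD_correlation hL (contDiff_partialD hψ j) (hasCompactSupport_partialD hψc j)]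
  have hw := hS.weak_eq (fun x => ψ (x + y)) (hψ.comp (contDiff_id.add contDiff_const))
    (hψc.comp_homeomorph (Homeomorph.addRight y))
  have t : ∀ x, transposeOp a (fun x => ψ (x + y)) x = transposeOp a ψ (x + y) := fun x => by
    have e : ∀ j, partialD j (fun x => ψ (x + y)) = fun x => partialD j ψ (x + y) := fun j => by
      ext x
      exact partialD_comp_add_right j ψ y x
    simp only [transposeOp, e, partialD_comp_add_right]
  simp only [t, zero_add] at hw
  rw [← hw, transposeOp]
  simp only [h2]
  simp only [h1, correlation_eq']
  have i2 : ∀ l j, Integrable fun x => coeffTwo a l j * (S x * partialD l (partialD j ψ) (x + y)) :=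
    fun l j => (integrable_correlation hL (contDiff_partialD (contDiff_partialD hψ j) l).continuous
      (hasCompactSupport_partialD (hasCompactSupport_partialD hψc j) l) y).const_mul _
  have i1 : ∀ l, Integrable fun x => coeffOne a l * (S x * partialD l ψ (x + y)) :=
    fun l => (integrable_correlation hL (contDiff_partialD hψ l).continuous
      (hasCompactSupport_partialD hψc l) y).const_mul _
  have i0 : Integrable fun x => a 0 * (S x * ψ (x + y)) :=
    (integrable_correlation hL hψ.continuous hψc y).const_mul _
  simp only [← integral_const_mul]
  have s2 : ∑ l, ∑ j, ∫ x, coeffTwo a l j * (S x * partialD l (partialD j ψ) (x + y))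
      = ∫ x, ∑ l, ∑ j, coeffTwo a l j * (S x * partialD l (partialD j ψ) (x + y)) := by
    rw [integral_finsetSum _ fun l _ => integrable_finsetSum _ fun j _ => i2 l j]
    exact Finset.sum_congr rfl fun l _ => (integral_finsetSum _ fun j _ => i2 l j).symm
  have j2 : Integrable fun x =>
      ∑ l, ∑ j, coeffTwo a l j * (S x * partialD l (partialD j ψ) (x + y)) :=
    integrable_finsetSum _ fun l _ => integrable_finsetSum _ fun j _ => i2 l j
  have j1 : Integrable fun x => ∑ l, coeffOne a l * (S x * partialD l ψ (x + y)) :=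
    integrable_finsetSum _ fun l _ => i1 l
  have j21 : Integrable fun x =>
      ∑ l, ∑ j, coeffTwo a l j * (S x * partialD l (partialD j ψ) (x + y))
        - ∑ l, coeffOne a l * (S x * partialD l ψ (x + y)) := j2.sub j1
  rw [s2, ← integral_finsetSum _ fun l _ => i1 l, ← integral_sub j2 j1, ← integral_add j21 i0]
  congr 1
  ext x
  simp only [transposeOp, mul_add, mul_sub, Finset.mul_sum]
  congr 1
  · congr 1
    · exact Finset.sum_congr rfl fun l _ => Finset.sum_congr rfl fun j _ => by ring
    · exact Finset.sum_congr rfl fun l _ => by ring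
  · ring

/-- First order coefficients of the commutator of the transposed operator with a cut-off. -/
def cutoffOne (a : (Fin n → ℕ) → ℂ) (X : RSpace n → ℂ) (j : Fin n) (x : RSpace n) : ℂ :=
  ∑ l, 2 * coeffTwo a l j * partialD l X x

/-- Zeroth order coefficient of the commutator of the transposed operator with a cut-off. -/
def cutoffZero (a : (Fin n → ℕ) → ℂ) (X : RSpace n → ℂ) (x : RSpace n) : ℂ :=
  (∑ l, ∑ j, coeffTwo a l j * partialD l (partialD j X) x) - ∑ l, coeffOne a l * partialD l X x

lemma transposeOp_mul (a : (Fin n → ℕ) → ℂ) {X w : RSpace n → ℂ} (hX : ContDiff ℝ ∞ X)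
    (hw : ContDiff ℝ ∞ w) (x : RSpace n) :
    transposeOp a (fun x => X x * w x) x = X x * transposeOp a w x
      + ∑ j, cutoffOne a X j x * partialD j w x + cutoffZero a X x * w x := by
  have dX := hX.differentiable (by simp)
  have dw := hw.differentiable (by simp)
  have h1 : ∀ j, partialD j (fun x => X x * w x)
      = fun x => partialD j X x * w x + X x * partialD j w x := fun j => by
    ext x
    exact partialD_mul j (dX x) (dw x)
  have dpX := fun j => (contDiff_partialD hX j).differentiable (by simp)
  have dpw := fun j => (contDiff_partialD hw j).differentiable (by simp)
  have h2 : ∀ l j, partialD l (partialD j fun x => X x * w x) x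
      = partialD l (partialD j X) x * w x + partialD j X x * partialD l w x
        + (partialD l X x * partialD j w x + X x * partialD l (partialD j w) x) := fun l j => by
    rw [h1, partialD_add l ((dpX j x).fun_mul (dw x)) ((dX x).fun_mul (dpw j x)),
      partialD_mul l (dpX j x) (dw x), partialD_mul l (dX x) (dpw j x)]
  have e1 : ∑ j, cutoffOne a X j x * partialD j w x
      = ∑ l, ∑ j, (coeffTwo a l j * (partialD j X x * partialD l w x)
        + coeffTwo a l j * (partialD l X x * partialD j w x)) := by
    simp only [Finset.sum_add_distrib, cutoffOne, Finset.sum_mul]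
    rw [Finset.sum_comm (f := fun l j => coeffTwo a l j * (partialD l X x * partialD j w x)),
      ← Finset.sum_add_distrib]
    refine Finset.sum_congr rfl fun j _ => ?_
    rw [← Finset.sum_add_distrib]
    refine Finset.sum_congr rfl fun l _ => ?_
    rw [coeffTwo_symm a j l]
    ring
  rw [e1]
  simp only [transposeOp, h2]
  simp only [h1, cutoffZero, sub_mul, mul_add, mul_sub, Finset.sum_mul,
    Finset.mul_sum, Finset.sum_add_distrib]
  have r1 : ∀ (F : Fin n → Fin n → ℂ) (F' : Fin n → Fin n → ℂ), (∀ l j, F l j = F' l j) →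
      ∑ l, ∑ j, F l j = ∑ l, ∑ j, F' l j := fun F F' h =>
    Finset.sum_congr rfl fun l _ => Finset.sum_congr rfl fun j _ => h l j
  rw [r1 (fun l j => coeffTwo a l j * (partialD l (partialD j X) x * w x))
      (fun l j => coeffTwo a l j * partialD l (partialD j X) x * w x) fun l j => by ring,
    r1 (fun l j => coeffTwo a l j * (X x * partialD l (partialD j w) x))
      (fun l j => X x * (coeffTwo a l j * partialD l (partialD j w) x)) fun l j => by ring,
    Finset.sum_congr rfl fun l _ => show coeffOne a l * (partialD l X x * w x)
      = coeffOne a l * partialD l X x * w x by ring,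
    Finset.sum_congr rfl fun l _ => show coeffOne a l * (X x * partialD l w x)
      = X x * (coeffOne a l * partialD l w x) by ring]
  ring

/-- Fubini's theorem for the pairing of a function carried by `Y` with a correlation. -/
lemma integral_mul_correlation {Y B : Set (RSpace n)} (hY : IsCompact Y) (hB : IsCompact B)
    (hYB : ∀ y ∈ Y, ∀ x ∈ B, x - y ≠ 0) (hS : ContinuousOn S {0}ᶜ) {g : RSpace n → ℂ}
    (hg : Integrable g) (hgY : ∀ y ∉ Y, g y = 0) (hψ : Integrable ψ) (hψB : ∀ x ∉ B, ψ x = 0) :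
    ∫ y, g y * correlation S ψ y = ∫ x, (∫ y, S (x - y) * g y) * ψ x := by
  -- Truncating the kernel to Y × B makes it bounded and measurable, and changes nothing because the
  -- other factors vanish outside these sets.
  set k : RSpace n × RSpace n → ℂ := (Y ×ˢ B).indicator fun p => S (p.2 - p.1) with hk
  have hkc : ContinuousOn (fun p : RSpace n × RSpace n => S (p.2 - p.1)) (Y ×ˢ B) :=
    hS.comp (continuous_snd.sub continuous_fst).continuousOn fun p hp => hYB _ hp.1 _ hp.2
  have hm : MeasurableSet (Y ×ˢ B) := hY.measurableSet.prod hB.measurableSet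
  obtain ⟨M, hM⟩ := (hY.prod hB).exists_bound_of_continuousOn hkc
  have hintegr : Integrable (Function.uncurry fun y x => g y * (S (x - y) * ψ x))
      ((volume : Measure (RSpace n)).prod volume) := by
    have h := (hg.mul_prod hψ).bdd_mul (f := k) (c := max M 0) ?_ ?_
    · refine h.congr (Eventually.of_forall fun p => ?_)
      by_cases hp : p ∈ Y ×ˢ B
      · simp only [hk, Set.indicator_of_mem hp, Function.uncurry]
        ring
      · simp only [hk, Set.indicator_of_notMem hp, Function.uncurry, zero_mul]
        rw [Set.mem_prod, not_and_or] at hp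
        rcases hp with h1 | h1
        · simp [hgY _ h1]
        · simp [hψB _ h1]
    · rw [hk, aestronglyMeasurable_indicator_iff hm]
      exact hkc.aestronglyMeasurable hm
    · refine Eventually.of_forall fun p => ?_
      by_cases hp : p ∈ Y ×ˢ B
      · simp only [hk, Set.indicator_of_mem hp]
        exact (hM p hp).trans (le_max_left _ _)
      · simp [hk, Set.indicator_of_notMem hp]
  have := integral_integral_swap hintegr
  simp only [correlation_eq, ← integral_const_mul]
  rw [this]
  congr 1
  ext x
  rw [← integral_mul_const]
  congr 1
  ext y
  ring

/-- V is controlled only on U, but the products are continuous with compact support because the test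
function lives in U. -/
lemma integral_mul_partialD_of_tsupport {V ψ : RSpace n → ℂ} {U : Set (RSpace n)} (hU : IsOpen U)
    (hV : AnalyticOnNhd ℝ V U) (hψ : ContDiff ℝ ∞ ψ) (hψc : HasCompactSupport ψ)
    (hψU : tsupport ψ ⊆ U) (j : Fin n) :
    ∫ x, V x * partialD j ψ x = -∫ x, partialD j V x * ψ x := by
  have hV' : ContinuousOn (partialD j V) U := fun x hx =>
    ((hV.fderiv x hx).continuousAt.clm_apply continuousAt_const).continuousWithinAt
  have comp : ∀ {f g : RSpace n → ℂ}, ContinuousOn f U → Continuous g → HasCompactSupport g →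
      tsupport g ⊆ U → Integrable fun x => f x * g x := by
    intro f g hf hg hgc hgU
    have h1 : Continuous fun x => f x * g x :=
      (hf.mul hg.continuousOn).continuous_of_tsupport_subset hU
        ((tsupport_mul_subset_right).trans hgU)
    exact h1.integrable_of_hasCompactSupport hgc.mul_left
  refine integral_mul_fderiv_eq_neg_fderiv_mul_of_integrable ?_ ?_ ?_
    (fun x hx => (hV x (hψU hx)).differentiableAt) (fun x _ => hψ.differentiable (by simp) x)
  · exact comp hV' hψ.continuous hψc hψU
  · exact comp hV.continuousOn (contDiff_partialD hψ j).continuous (hasCompactSupport_partialD hψc j)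
      ((tsupport_fderiv_apply_subset ℝ _).trans hψU)
  · exact comp hV.continuousOn hψ.continuous hψc hψU

/-- A locally integrable distributional solution of the homogeneous equation is almost everywhere
equal to a real analytic function near every point. -/
theorem exists_analytic_of_weak_solution {a : (Fin n → ℕ) → ℂ} (hS : IsFundamentalSolution a S)
    (hSa : ∀ x, x ≠ 0 → AnalyticAt ℝ S x) {u : RSpace n → ℂ} (hu : LocallyIntegrable u)
    (hweak : ∀ φ : RSpace n → ℂ, ContDiff ℝ ∞ φ → HasCompactSupport φ →
      ∫ x, u x * transposeOp a φ x = 0) (x₀ : RSpace n) :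
    ∃ v : RSpace n → ℂ, AnalyticOnNhd ℝ v (Metric.ball x₀ 1) ∧
      ∀ᵐ x, x ∈ Metric.ball x₀ 1 → u x = v x := by
  -- The derivatives of the cut-off live in the shell 2 ≤ |x - x₀| ≤ 3, which stays away from the
  -- unit ball. Only values of `S` off the origin, where it is analytic, enter there.
  let χ : ContDiffBump x₀ := ⟨2, 3, by norm_num, by norm_num⟩
  set X : RSpace n → ℂ := fun x => (χ x : ℂ) with hXdef
  have hX : ContDiff ℝ ∞ X := Complex.ofRealCLM.contDiff.comp χ.contDiff
  set Y : Set (RSpace n) := Metric.closedBall x₀ 3 \ Metric.ball x₀ 2 with hYdef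
  have hY : IsCompact Y := (isCompact_closedBall x₀ 3).diff Metric.isOpen_ball
  have hXone : ∀ x ∈ Metric.closedBall x₀ 2, X x = 1 := fun x hx => by
    simp [hXdef, χ.one_of_mem_closedBall hx]
  have hXzero : ∀ x, x ∉ Metric.closedBall x₀ 3 → X =ᶠ[𝓝 x] fun _ => 0 := fun x hx => by
    filter_upwards [Metric.isClosed_closedBall.isOpen_compl.mem_nhds hx] with z hz
    have : χ z = 0 := χ.zero_of_le_dist (by
      simp only [Set.mem_compl_iff, Metric.mem_closedBall, not_le] at hz
      exact hz.le)
    simp [hXdef, this]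
  have hXconst : ∀ x ∉ Y, ∃ c : ℂ, X =ᶠ[𝓝 x] fun _ => c := fun x hx => by
    by_cases h3 : x ∈ Metric.closedBall x₀ 3
    · have h2 : x ∈ Metric.ball x₀ 2 := by
        by_contra h
        exact hx ⟨h3, h⟩
      exact ⟨1, by
        filter_upwards [Metric.isOpen_ball.mem_nhds h2] with z hz
        exact hXone z (Metric.ball_subset_closedBall hz)⟩
    · exact ⟨0, hXzero x h3⟩
  have hp1 : ∀ x ∉ Y, ∀ j, partialD j X x = 0 := fun x hx j => by
    obtain ⟨c, hc⟩ := hXconst x hx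
    rw [hc.partialD_eq]
    simp [partialD]
  have hp2 : ∀ x ∉ Y, ∀ l j, partialD l (partialD j X) x = 0 := fun x hx l j => by
    have : partialD j X =ᶠ[𝓝 x] fun _ => 0 := by
      filter_upwards [hY.isClosed.isOpen_compl.mem_nhds hx] with z hz using hp1 z hz j
    rw [this.partialD_eq]
    simp [partialD]
  have hXc : HasCompactSupport X :=
    HasCompactSupport.intro (isCompact_closedBall x₀ 3) fun x hx => (hXzero x hx).self_of_nhds
  -- the coefficients of the commutator
  have c1Y : ∀ j, ∀ x ∉ Y, cutoffOne a X j x = 0 := fun j x hx => by simp [cutoffOne, hp1 x hx]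
  have c0Y : ∀ x ∉ Y, cutoffZero a X x = 0 := fun x hx => by simp [cutoffZero, hp1 x hx, hp2 x hx]
  have c1c : ∀ j, Continuous (cutoffOne a X j) := fun j => continuous_finsetSum _ fun l _ =>
    continuous_const.mul (contDiff_partialD hX l).continuous
  have c0c : Continuous (cutoffZero a X) :=
    (continuous_finsetSum _ fun l _ => continuous_finsetSum _ fun j _ =>
      continuous_const.mul (contDiff_partialD (contDiff_partialD hX j) l).continuous).sub
    (continuous_finsetSum _ fun l _ => continuous_const.mul (contDiff_partialD hX l).continuous)
  have hYint : ∀ {c : RSpace n → ℂ}, Continuous c → (∀ x ∉ Y, c x = 0) →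
      Integrable fun x => u x * c x := fun {c} hc hcY => by
    simpa using hu.integrable_smul_right_of_hasCompactSupport hc (HasCompactSupport.intro hY hcY)
  set V : (RSpace n → ℂ) → RSpace n → ℂ := fun c x => ∫ y, S (x - y) * (u y * c y) with hVdef
  have hYB : ∀ y ∈ Y, ∀ x ∈ Metric.closedBall x₀ 1, x - y ≠ 0 := by
    intro y hy x hx h0
    have h1 : x = y := sub_eq_zero.1 h0
    subst h1
    apply hy.2
    exact Metric.closedBall_subset_ball (by norm_num) hx
  have hVa : ∀ {c : RSpace n → ℂ}, Continuous c → (∀ x ∉ Y, c x = 0) →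
      AnalyticOnNhd ℝ (V c) (Metric.ball x₀ 1) := fun {c} hc hcY x hx =>
    analyticAt_convolution_integral hY
      (fun y hy => hSa _ (hYB y hy x (Metric.ball_subset_closedBall hx))) (hYint hc hcY)
      fun y hy => by simp [hcY y hy]
  set v : RSpace n → ℂ := fun x => ∑ j, partialD j (V (cutoffOne a X j)) x - V (cutoffZero a X) x
    with hvdef
  have hva : AnalyticOnNhd ℝ v (Metric.ball x₀ 1) := by
    have h1 : ∀ j, AnalyticOnNhd ℝ (partialD j (V (cutoffOne a X j))) (Metric.ball x₀ 1) :=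
      fun j x hx => ((ContinuousLinearMap.apply ℝ ℂ (EuclideanSpace.single j (1 : ℝ))).analyticAt _).comp
        ((hVa (c1c j) (c1Y j)).fderiv x hx)
    have h2 := Finset.analyticOnNhd_fun_sum Finset.univ fun j _ => h1 j
    exact h2.sub (hVa c0c c0Y)
  refine ⟨v, hva, ?_⟩
  have hloc : LocallyIntegrableOn (fun x => u x - v x) (Metric.ball x₀ 1) :=
    (hu.locallyIntegrableOn _).sub
      (hva.continuousOn.locallyIntegrableOn measurableSet_ball)
  have main := Metric.isOpen_ball.ae_eq_zero_of_integral_contDiff_smul_eq_zero hloc ?_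
  · filter_upwards [main] with x hx hxb
    exact sub_eq_zero.1 (hx hxb)
  intro g hg hgc hgU
  set ψ : RSpace n → ℂ := fun x => (g x : ℂ) with hψdef
  have hψ : ContDiff ℝ ∞ ψ := Complex.ofRealCLM.contDiff.comp hg
  have hψc : HasCompactSupport ψ := hgc.comp_left (g := fun t : ℝ => (t : ℂ)) (by simp)
  have hψU : tsupport ψ ⊆ Metric.ball x₀ 1 := by
    refine (closure_mono ?_).trans hgU
    intro x hx hx0
    apply hx
    simp [hψdef, hx0]
  have hψB : ∀ {θ : RSpace n → ℂ}, tsupport θ ⊆ Metric.ball x₀ 1 →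
      ∀ x ∉ Metric.closedBall x₀ 1, θ x = 0 := fun {θ} hθ x hx =>
    image_eq_zero_of_notMem_tsupport fun h => hx (Metric.ball_subset_closedBall (hθ h))
  set w := correlation S ψ with hwdef
  have hw : ContDiff ℝ ∞ w := contDiff_correlation hS.locallyIntegrable hψ hψc
  have hPw : transposeOp a w = ψ := transposeOp_correlation hS hψ hψc
  have hpw : ∀ j, partialD j w = correlation S (partialD j ψ) :=
    partialD_correlation hS.locallyIntegrable hψ hψc
  -- The correlation `w` need not have compact support, so it is cut off by X. Since X = 1 near the
  -- support of ψ, the transposed operator of X w is ψ plus commutator terms carried by Y. Fubini's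
  -- theorem moves ψ out of those terms and exhibits u as v in the weak sense.
  have h0 := hweak (fun x => X x * w x) (hX.mul hw) hXc.mul_right
  have hXψ : ∀ x, X x * ψ x = ψ x := fun x => by
    by_cases hx : x ∈ Metric.closedBall x₀ 1
    · rw [hXone x (Metric.closedBall_subset_closedBall (by norm_num) hx), one_mul]
    · rw [hψB hψU x hx, mul_zero]
  have hpt : ∀ x, u x * transposeOp a (fun x => X x * w x) x
      = u x * ψ x + ∑ j, (u x * cutoffOne a X j x) * partialD j w x
        + (u x * cutoffZero a X x) * w x := fun x => by
    rw [transposeOp_mul a hX hw, hPw, hXψ, mul_add, mul_add, Finset.mul_sum]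
    simp only [mul_assoc]
  have iu : Integrable fun x => u x * ψ x := by
    simpa using hu.integrable_smul_right_of_hasCompactSupport hψ.continuous hψc
  have i1 : ∀ j, Integrable fun x => (u x * cutoffOne a X j x) * partialD j w x := fun j => by
    simpa [mul_assoc] using hYint ((c1c j).mul (contDiff_partialD hw j).continuous)
      fun x hx => by simp [c1Y j x hx]
  have i0 : Integrable fun x => (u x * cutoffZero a X x) * w x := by
    simpa [mul_assoc] using hYint (c0c.mul hw.continuous) fun x hx => by simp [c0Y x hx]
  simp only [hpt] at h0
  have iu1 : Integrable fun x => u x * ψ x + ∑ j, (u x * cutoffOne a X j x) * partialD j w x :=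
    iu.add (integrable_finsetSum _ fun j _ => i1 j)
  rw [integral_add iu1 i0, integral_add iu
    (integrable_finsetSum _ fun j _ => i1 j), integral_finsetSum _ fun j _ => i1 j] at h0
  have f1 : ∀ j, ∫ x, (u x * cutoffOne a X j x) * partialD j w x
      = -∫ x, partialD j (V (cutoffOne a X j)) x * ψ x := fun j => by
    rw [hpw j, integral_mul_correlation hY (isCompact_closedBall x₀ 1) hYB hS.continuousOn
      (hYint (c1c j) (c1Y j)) (fun y hy => by simp [c1Y j y hy])
      ((contDiff_partialD hψ j).continuous.integrable_of_hasCompactSupport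
        (hasCompactSupport_partialD hψc j))
      (hψB ((tsupport_fderiv_apply_subset ℝ _).trans hψU))]
    exact integral_mul_partialD_of_tsupport Metric.isOpen_ball (hVa (c1c j) (c1Y j)) hψ hψc hψU j
  have f0 : ∫ x, (u x * cutoffZero a X x) * w x = ∫ x, V (cutoffZero a X) x * ψ x :=
    integral_mul_correlation hY (isCompact_closedBall x₀ 1) hYB hS.continuousOn
      (hYint c0c c0Y) (fun y hy => by simp [c0Y y hy])
      (hψ.continuous.integrable_of_hasCompactSupport hψc) (hψB hψU)
  have comp : ∀ {f : RSpace n → ℂ}, ContinuousOn f (Metric.ball x₀ 1) →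
      Integrable fun x => f x * ψ x := by
    intro f hf
    have h1 : Continuous fun x => f x * ψ x :=
      (hf.mul hψ.continuous.continuousOn).continuous_of_tsupport_subset Metric.isOpen_ball
        ((tsupport_mul_subset_right).trans hψU)
    exact h1.integrable_of_hasCompactSupport hψc.mul_left
  have hd : ∀ j, ContinuousOn (partialD j (V (cutoffOne a X j))) (Metric.ball x₀ 1) :=
    fun j x hx => (((hVa (c1c j) (c1Y j)).fderiv x hx).continuousAt.clm_apply
      continuousAt_const).continuousWithinAt
  have hv : ∫ x, v x * ψ x = ∑ j, (∫ x, partialD j (V (cutoffOne a X j)) x * ψ x)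
      - ∫ x, V (cutoffZero a X) x * ψ x := by
    rw [← integral_finsetSum _ fun j _ => comp (hd j), ← integral_sub
      (integrable_finsetSum _ fun j _ => comp (hd j)) (comp (hVa c0c c0Y).continuousOn)]
    congr 1
    ext x
    rw [hvdef]
    simp only [sub_mul, Finset.sum_mul]
  have : ∫ x, g x • (u x - v x) = (∫ x, u x * ψ x) - ∫ x, v x * ψ x := by
    rw [← integral_sub iu (comp hva.continuousOn)]
    congr 1
    ext x
    simp only [hψdef, Complex.real_smul]
    ring
  rw [this, hv]
  simp only [f1, f0, Finset.sum_neg_distrib] at h0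
  linear_combination h0

end Weyl

end

noncomputable section

/-! ### Calculus in polar coordinates -/

section Polar

variable {n : ℕ}

lemma polar_mem {x : RSpace n} (hx : x ≠ 0) :
    polar x ∈ (Metric.sphere 0 1 ×ˢ Set.univ : Set (RSpace n × ℝ)) := by
  refine ⟨?_, trivial⟩
  rw [polar, mem_sphere_zero_iff_norm, norm_smul, norm_inv, norm_norm,
    inv_mul_cancel₀ (norm_ne_zero_iff.2 hx)]

lemma polar_snd_smul_fst {x : RSpace n} (hx : x ≠ 0) : (polar x).2 • (polar x).1 = x := by
  rw [polar, smul_smul, mul_inv_cancel₀ (norm_ne_zero_iff.2 hx), one_smul]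

lemma analyticAt_polar {x : RSpace n} (hx : x ≠ 0) : AnalyticAt ℝ polar x := by
  have h : ContDiffAt ℝ ω (fun x : RSpace n => ‖x‖) x := contDiffAt_norm ℝ hx
  exact (((h.inv (norm_ne_zero_iff.2 hx)).smul contDiffAt_id).prodMk h).analyticAt

lemma hasFDerivAt_norm_of_ne {x : RSpace n} (hx : x ≠ 0) :
    HasFDerivAt (fun x : RSpace n => ‖x‖) (‖x‖⁻¹ • innerSL ℝ x) x := by
  have h0 := norm_ne_zero_iff.2 hx
  have h := (hasStrictFDerivAt_norm_sq x).hasFDerivAt.sqrt (pow_ne_zero 2 h0)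
  simp only [Real.sqrt_sq (norm_nonneg _)] at h
  have e : (1 / (2 * ‖x‖)) • 2 • innerSL ℝ x = ‖x‖⁻¹ • innerSL ℝ x := by
    ext v
    simp
    field_simp
  rwa [e] at h

lemma hasFDerivAt_polar {x : RSpace n} (hx : x ≠ 0) :
    HasFDerivAt (polar (n := n))
      ((‖x‖⁻¹ • ContinuousLinearMap.id ℝ (RSpace n)
        + ((-(‖x‖ ^ 2)⁻¹) • ‖x‖⁻¹ • innerSL ℝ x).smulRight x).prod (‖x‖⁻¹ • innerSL ℝ x)) x := by
  have h := hasFDerivAt_norm_of_ne hx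
  have hi : HasFDerivAt (fun x : RSpace n => ‖x‖⁻¹) ((-(‖x‖ ^ 2)⁻¹) • ‖x‖⁻¹ • innerSL ℝ x) x :=
    (hasDerivAt_inv (norm_ne_zero_iff.2 hx)).comp_hasFDerivAt x h
  exact (hi.smul (hasFDerivAt_id x)).prodMk h

/-- The coefficient of `∂_j (|x|^k A(x/|x|,|x|))` in front of `|x|^(k-1)`. -/
def polarDer (k : ℤ) (j : Fin n) (A : RSpace n × ℝ → ℂ) (p : RSpace n × ℝ) : ℂ :=
  (k : ℂ) * (p.1 j : ℂ) * A p
    + fderiv ℝ A p (EuclideanSpace.single j 1 - p.1 j • p.1, p.2 * p.1 j)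

lemma hasFDerivAt_norm_zpow {x : RSpace n} (hx : x ≠ 0) (k : ℤ) :
    HasFDerivAt (fun x : RSpace n => ‖x‖ ^ k) ((k * ‖x‖ ^ (k - 1)) • ‖x‖⁻¹ • innerSL ℝ x) x :=
  (hasDerivAt_zpow k ‖x‖ (Or.inl (norm_ne_zero_iff.2 hx))).comp_hasFDerivAt x
    (hasFDerivAt_norm_of_ne hx)

lemma _root_.HasFDerivAt.ofReal_comp' {f : RSpace n → ℝ} {f' : RSpace n →L[ℝ] ℝ} {x : RSpace n}
    (h : HasFDerivAt f f' x) :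
    HasFDerivAt (fun x => (f x : ℂ)) (Complex.ofRealCLM.comp f') x :=
  Complex.ofRealCLM.hasFDerivAt.comp x h

/-- Along e_j the direction θ = x/|x| moves by |x|⁻¹ (e_j - θ_j θ) and the radius r = |x| by θ_j =
|x|⁻¹ (r θ_j), so exactly one power of |x| is lost. -/
lemma partialD_zpow_mul_polar {x : RSpace n} (hx : x ≠ 0) (k : ℤ) {A : RSpace n × ℝ → ℂ}
    (hA : DifferentiableAt ℝ A (polar x)) (j : Fin n) :
    partialD j (fun x => ((‖x‖ ^ k : ℝ) : ℂ) * A (polar x)) x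
      = ((‖x‖ ^ (k - 1) : ℝ) : ℂ) * polarDer k j A (polar x) := by
  have h0 := norm_ne_zero_iff.2 hx
  have h1 := (hasFDerivAt_norm_zpow hx k).ofReal_comp'
  have h2 : HasFDerivAt (fun x => A (polar x)) _ x :=
    hA.hasFDerivAt.comp x (hasFDerivAt_polar hx)
  rw [(h1.fun_mul h2).partialD_eq]
  have hin : innerSL ℝ x (EuclideanSpace.single j 1) = x j := by
    simp [EuclideanSpace.inner_single_right]
  have e : (((‖x‖⁻¹ • ContinuousLinearMap.id ℝ (RSpace n)
        + ((-(‖x‖ ^ 2)⁻¹) • ‖x‖⁻¹ • innerSL ℝ x).smulRight x).prod (‖x‖⁻¹ • innerSL ℝ x))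
          (EuclideanSpace.single j 1))
      = ‖x‖⁻¹ • (EuclideanSpace.single j 1 - (polar x).1 j • (polar x).1,
          (polar x).2 * (polar x).1 j) := by
    ext i
    · simp only [ContinuousLinearMap.prod_apply, add_apply,
        smul_apply, ContinuousLinearMap.smulRight_apply, hin, polar]
      simp only [PiLp.add_apply, PiLp.smul_apply, PiLp.sub_apply, Prod.smul_fst, smul_eq_mul,
        ContinuousLinearMap.id_apply]
      ring
    · simp only [ContinuousLinearMap.prod_apply,
        smul_apply, hin, polar]
      simp only [Prod.smul_snd, smul_eq_mul, PiLp.smul_apply]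
      field_simp
  simp only [add_apply, smul_apply, ContinuousLinearMap.comp_apply, hin, smul_eq_mul,
    Complex.ofRealCLM_apply, polarDer]
  rw [e, map_smul]
  have : (polar x).1 j = ‖x‖⁻¹ * x j := by simp [polar]
  rw [this, zpow_sub_one₀ h0]
  simp only [Complex.real_smul]
  push_cast
  ring

lemma IsAnalyticNearSphere.contDiffAt {F : Type*} [NormedAddCommGroup F] [NormedSpace ℝ F]
    [CompleteSpace F] {A : RSpace n × ℝ → F} (hA : IsAnalyticNearSphere A) {p : RSpace n × ℝ}
    (hp : p ∈ (Metric.sphere 0 1 ×ˢ Set.univ : Set (RSpace n × ℝ))) : ContDiffAt ℝ ω A p :=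
  (hA p hp).contDiffAt

lemma contDiff_coord (j : Fin n) {m : WithTop ℕ∞} : ContDiff ℝ m fun x : RSpace n => x j :=
  (EuclideanSpace.proj j : RSpace n →L[ℝ] ℝ).contDiff

lemma contDiffAt_ofReal {E : Type*} [NormedAddCommGroup E] [NormedSpace ℝ E] {f : E → ℝ}
    {m : WithTop ℕ∞} {x : E} (h : ContDiffAt ℝ m f x) : ContDiffAt ℝ m (fun x => (f x : ℂ)) x :=
  Complex.ofRealCLM.contDiff.contDiffAt.comp x h

lemma IsAnalyticNearSphere.polarDer {A : RSpace n × ℝ → ℂ} (hA : IsAnalyticNearSphere A)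
    (k : ℤ) (j : Fin n) : IsAnalyticNearSphere (polarDer k j A) := by
  intro p hp
  have h1 : ContDiffAt ℝ ω A p := hA.contDiffAt hp
  have h2 : ContDiffAt ℝ ω (fderiv ℝ A) p := (hA p hp).fderiv.contDiffAt
  have h3 : ContDiffAt ℝ ω (fun p : RSpace n × ℝ => p.1 j) p :=
    ((contDiff_coord j).comp contDiff_fst).contDiffAt
  refine ContDiffAt.analyticAt ?_
  exact ((contDiffAt_const.mul (contDiffAt_ofReal h3)).mul h1).add (h2.clm_apply
    ((contDiffAt_const.sub (h3.smul contDiffAt_fst)).prodMk (contDiffAt_snd.mul h3)))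

lemma IsAnalyticNearSphere.exists_bound {A : RSpace n × ℝ → ℂ} (hA : IsAnalyticNearSphere A)
    (R : ℝ) : ∃ c, 0 ≤ c ∧ ∀ x : RSpace n, x ≠ 0 → ‖x‖ ≤ R → ‖A (polar x)‖ ≤ c := by
  obtain ⟨c, hc⟩ := ((isCompact_sphere (0 : RSpace n) 1).prod
    (isCompact_Icc (a := (0 : ℝ)) (b := R))).exists_bound_of_continuousOn
    (hA.continuousOn.mono (Set.prod_mono_right (Set.subset_univ _)))
  refine ⟨max c 0, le_max_right _ _, fun x hx hR => (hc _ ⟨(polar_mem hx).1, norm_nonneg _, hR⟩).trans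
    (le_max_left _ _)⟩

/-- `f` is, off the origin, of the form `|x|^k A(x/|x|,|x|) + B(x) log |x|` with analytic `A`,
`B`. -/
def IsPolarLog (k : ℤ) (f : RSpace n → ℂ) : Prop :=
  ∃ (A : RSpace n × ℝ → ℂ) (B : RSpace n → ℂ), IsAnalyticNearSphere A ∧ AnalyticOnNhd ℝ B Set.univ ∧
    ∀ x, x ≠ 0 → f x = ((‖x‖ ^ k : ℝ) : ℂ) * A (polar x) + B x * (Real.log ‖x‖ : ℂ)

lemma analyticAt_log_norm {x : RSpace n} (hx : x ≠ 0) :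
    AnalyticAt ℝ (fun x : RSpace n => (Real.log ‖x‖ : ℂ)) x :=
  (contDiffAt_ofReal ((contDiffAt_norm ℝ hx).log (norm_ne_zero_iff.2 hx))).analyticAt

lemma analyticAt_norm_zpow {x : RSpace n} (hx : x ≠ 0) (k : ℤ) :
    AnalyticAt ℝ (fun x : RSpace n => ((‖x‖ ^ k : ℝ) : ℂ)) x := by
  have h : AnalyticAt ℝ (fun x : RSpace n => ‖x‖) x :=
    ContDiffAt.analyticAt (contDiffAt_norm ℝ hx)
  have h2 := (h.zpow (n := k) (norm_ne_zero_iff.2 hx)).contDiffAt (n := ω)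
  exact (contDiffAt_ofReal h2).analyticAt

lemma IsAnalyticNearSphere.comp_polar {A : RSpace n × ℝ → ℂ} (hA : IsAnalyticNearSphere A)
    {x : RSpace n} (hx : x ≠ 0) : AnalyticAt ℝ (fun x => A (polar x)) x :=
  (hA _ (polar_mem hx)).comp (analyticAt_polar hx)

lemma partialD_log_norm {x : RSpace n} (hx : x ≠ 0) (j : Fin n) :
    partialD j (fun x => (Real.log ‖x‖ : ℂ)) x = ((x j / ‖x‖ ^ 2 : ℝ) : ℂ) := by
  have h := ((hasFDerivAt_norm_of_ne hx).log (norm_ne_zero_iff.2 hx)).ofReal_comp'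
  rw [h.partialD_eq]
  simp [EuclideanSpace.inner_single_right]
  ring

lemma analyticAt_partialD {f : RSpace n → ℂ} {x : RSpace n} (h : AnalyticAt ℝ f x) (j : Fin n) :
    AnalyticAt ℝ (partialD j f) x :=
  ((h.fderiv.contDiffAt (n := ω)).clm_apply contDiffAt_const).analyticAt

lemma eventually_ne_zero {x : RSpace n} (hx : x ≠ 0) : ∀ᶠ y in 𝓝 x, y ≠ 0 :=
  isOpen_ne.mem_nhds hx

namespace IsPolarLog

variable {k : ℤ} {f g : RSpace n → ℂ}

lemma analyticAt (hf : IsPolarLog k f) {x : RSpace n} (hx : x ≠ 0) : AnalyticAt ℝ f x := by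
  obtain ⟨A, B, hA, hB, h⟩ := hf
  refine (((analyticAt_norm_zpow hx k).fun_mul (hA.comp_polar hx)).fun_add
    ((hB x trivial).fun_mul (analyticAt_log_norm hx))).congr ?_
  filter_upwards [eventually_ne_zero hx] with y hy using (h y hy).symm

lemma congr (hf : IsPolarLog k f) (h : ∀ x, x ≠ 0 → g x = f x) : IsPolarLog k g := by
  obtain ⟨A, B, hA, hB, hAB⟩ := hf
  exact ⟨A, B, hA, hB, fun x hx => (h x hx).trans (hAB x hx)⟩

lemma add (hf : IsPolarLog k f) (hg : IsPolarLog k g) : IsPolarLog k fun x => f x + g x := by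
  obtain ⟨A, B, hA, hB, hAB⟩ := hf
  obtain ⟨A', B', hA', hB', hAB'⟩ := hg
  refine ⟨fun p => A p + A' p, fun x => B x + B' x, fun p hp => (hA p hp).fun_add (hA' p hp),
    fun x hx => (hB x hx).fun_add (hB' x hx), fun x hx => ?_⟩
  simp only [hAB x hx, hAB' x hx]
  ring

lemma const_mul (hf : IsPolarLog k f) (c : ℂ) : IsPolarLog k fun x => c * f x := by
  obtain ⟨A, B, hA, hB, hAB⟩ := hf
  refine ⟨fun p => c * A p, fun x => c * B x, fun p hp => analyticAt_const.fun_mul (hA p hp),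
    fun x hx => analyticAt_const.fun_mul (hB x hx), fun x hx => ?_⟩
  simp only [hAB x hx]
  ring

/-- An analytic function times a nonnegative power of the radius is analytic near the sphere. -/
lemma _root_.isAnalyticNearSphere_pow_mul {B : RSpace n → ℂ} (hB : AnalyticOnNhd ℝ B Set.univ)
    (m : ℕ) : IsAnalyticNearSphere fun p : RSpace n × ℝ => ((p.2 ^ m : ℝ) : ℂ) * B (p.2 • p.1) := by
  intro p hp
  have h1 : ContDiffAt ℝ ω (fun p : RSpace n × ℝ => p.2 • p.1) p :=
    contDiffAt_snd.smul contDiffAt_fst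
  have h2 : ContDiffAt ℝ ω (fun p : RSpace n × ℝ => B (p.2 • p.1)) p :=
    ((hB (p.2 • p.1) trivial).contDiffAt (n := ω)).comp p h1
  exact ((contDiffAt_ofReal (contDiffAt_snd.pow m)).mul h2).analyticAt

/-- B(x) = |x|^k · r^(-k) B(rθ), where r^(-k) is a nonnegative integer power because k ≤ 0. -/
lemma of_analytic {B : RSpace n → ℂ} (hB : AnalyticOnNhd ℝ B Set.univ) (hk : k ≤ 0) :
    IsPolarLog k B := by
  obtain ⟨m, hm⟩ := Int.eq_ofNat_of_zero_le (neg_nonneg.2 hk)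
  refine ⟨_, 0, isAnalyticNearSphere_pow_mul hB m, analyticOnNhd_const, fun x hx => ?_⟩
  have h0 := norm_ne_zero_iff.2 hx
  simp only [polar_snd_smul_fst hx]
  rw [← mul_assoc, ← Complex.ofReal_mul]
  have : ‖x‖ ^ k * (polar x).2 ^ m = 1 := by
    change ‖x‖ ^ k * ‖x‖ ^ m = 1
    rw [← zpow_natCast, ← zpow_add₀ h0]
    simp [show k + m = 0 by omega]
  simp [this]

/-- Besides the derivative of the polar part and ∂_j B · log |x|, one gets B x_j / |x|². This equals
|x|^(k-1) θ_j r^(-k) B(rθ), and it is again of polar type because k ≤ 0. -/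
lemma partialD (hf : IsPolarLog k f) (hk : k ≤ 0) (j : Fin n) :
    IsPolarLog (k - 1) (partialD j f) := by
  obtain ⟨A, B, hA, hB, h⟩ := hf
  obtain ⟨m, hm⟩ := Int.eq_ofNat_of_zero_le (neg_nonneg.2 hk)
  refine ⟨fun p => polarDer k j A p + (p.1 j : ℂ) * (((p.2 ^ m : ℝ) : ℂ) * B (p.2 • p.1)),
    _root_.partialD j B, fun p hp => ?_, fun x hx => analyticAt_partialD (hB x hx) j,
    fun x hx => ?_⟩
  · refine (hA.polarDer k j p hp).fun_add (AnalyticAt.fun_mul ?_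
      (isAnalyticNearSphere_pow_mul hB m p hp))
    exact (contDiffAt_ofReal ((contDiff_coord j).comp contDiff_fst).contDiffAt).analyticAt
  · have h0 := norm_ne_zero_iff.2 hx
    have e : f =ᶠ[𝓝 x] fun x => ((‖x‖ ^ k : ℝ) : ℂ) * A (polar x) + B x * (Real.log ‖x‖ : ℂ) := by
      filter_upwards [eventually_ne_zero hx] with y hy using h y hy
    have hd1 := (analyticAt_norm_zpow hx k).differentiableAt.fun_mul
      (hA.comp_polar hx).differentiableAt
    have hdB := (hB x trivial).differentiableAt
    have hdl := (analyticAt_log_norm hx).differentiableAt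
    rw [e.partialD_eq, partialD_add j hd1 (hdB.fun_mul hdl), partialD_mul j hdB hdl,
      partialD_zpow_mul_polar hx k (hA _ (polar_mem hx)).differentiableAt j,
      partialD_log_norm hx]
    simp only [polar_snd_smul_fst hx]
    have e2 : x j / ‖x‖ ^ 2 = ‖x‖ ^ (k - 1) * ((polar x).1 j * (polar x).2 ^ m) := by
      have e3 : ‖x‖ ^ k * ‖x‖ ^ m = 1 := by
        rw [← zpow_natCast, ← zpow_add₀ h0]
        simp [show k + m = 0 by omega]
      have e4 : (polar x).1 j * (polar x).2 ^ m = ‖x‖⁻¹ * x j * ‖x‖ ^ m := by simp [polar]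
      rw [zpow_sub_one₀ h0, e4]
      calc x j / ‖x‖ ^ 2 = ‖x‖⁻¹ * ‖x‖⁻¹ * x j * (‖x‖ ^ k * ‖x‖ ^ m) := by
            rw [e3]; field_simp
        _ = _ := by ring
    rw [e2]
    push_cast
    ring

/-- On a bounded set |log |x|| is at most a constant times |x|⁻¹, and k ≤ -1 makes that a constant
times |x|^k. -/
lemma exists_bound (hf : IsPolarLog k f) (hk : k ≤ -1) (R : ℝ) :
    ∃ c, 0 ≤ c ∧ ∀ x : RSpace n, x ≠ 0 → ‖x‖ ≤ R → ‖f x‖ ≤ c * ‖x‖ ^ k := by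
  obtain ⟨A, B, hA, hB, h⟩ := hf
  obtain ⟨c, hc0, hc⟩ := hA.exists_bound R
  obtain ⟨d, hd⟩ := (isCompact_closedBall (0 : RSpace n) R).exists_bound_of_continuousOn
    (hB.continuousOn.mono (Set.subset_univ _))
  obtain ⟨m, hm⟩ := Int.eq_ofNat_of_zero_le (show 0 ≤ -1 - k by omega)
  refine ⟨c + max d 0 * ((1 + R ^ 2) * (max R 0) ^ m), by positivity, fun x hx hR => ?_⟩
  have h0 : 0 < ‖x‖ := norm_pos_iff.2 hx
  have hR0 : 0 < R := h0.trans_le hR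
  have hlog : |Real.log ‖x‖| ≤ (1 + R ^ 2) * ‖x‖⁻¹ := by
    rw [abs_le]
    have h1 := Real.log_le_sub_one_of_pos h0
    have h2 := Real.one_sub_inv_le_log_of_pos h0
    have h3 : 0 < ‖x‖⁻¹ := by positivity
    have h4 : ‖x‖ ≤ R ^ 2 * ‖x‖⁻¹ := by
      rw [← div_eq_mul_inv, le_div_iff₀ h0]
      nlinarith
    constructor <;> nlinarith [sq_nonneg R]
  have hzp : ‖x‖⁻¹ ≤ (max R 0) ^ m * ‖x‖ ^ k := by
    have : ‖x‖⁻¹ = ‖x‖ ^ m * ‖x‖ ^ k := by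
      rw [← zpow_natCast, ← zpow_add₀ h0.ne', ← zpow_neg_one]
      congr 1
      omega
    rw [this]
    gcongr
    exact hR.trans (le_max_left _ _)
  rw [h x hx]
  have hz : 0 < ‖x‖ ^ k := by positivity
  calc ‖((‖x‖ ^ k : ℝ) : ℂ) * A (polar x) + B x * (Real.log ‖x‖ : ℂ)‖
      ≤ ‖x‖ ^ k * ‖A (polar x)‖ + ‖B x‖ * |Real.log ‖x‖| := by
        refine (norm_add_le _ _).trans (le_of_eq ?_)
        rw [norm_mul, norm_mul, Complex.norm_real, Complex.norm_real, Real.norm_eq_abs,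
          Real.norm_eq_abs, abs_of_pos hz]
    _ ≤ ‖x‖ ^ k * c + max d 0 * ((1 + R ^ 2) * ((max R 0) ^ m * ‖x‖ ^ k)) := by
        gcongr
        · exact hc x hx hR
        · exact (hd x (by simpa using hR)).trans (le_max_left _ _)
        · exact hlog.trans (by gcongr)
    _ = _ := by ring

/-- The local Lipschitz estimate away from the origin. -/
lemma exists_lipschitz (hf : IsPolarLog k f) (hk : k ≤ 0) (R : ℝ) :
    ∃ c, 0 ≤ c ∧ ∀ x y : RSpace n, x ≠ 0 → ‖x‖ ≤ R → 2 * ‖x - y‖ ≤ ‖x‖ →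
      ‖f x - f y‖ ≤ c * ‖x‖ ^ (k - 1) * ‖x - y‖ := by
  choose c hc0 hc using fun j => (hf.partialD hk j).exists_bound (by omega) (2 * R)
  obtain ⟨m, hm⟩ := Int.eq_ofNat_of_zero_le (show 0 ≤ -(k - 1) by omega)
  refine ⟨∑ j, c j * 2 ^ m, Finset.sum_nonneg fun j _ => mul_nonneg (hc0 j) (by positivity),
    fun x y hx hR hxy => ?_⟩
  have h0 : 0 < ‖x‖ := norm_pos_iff.2 hx
  -- The ball of radius |x|/2 around x contains y and avoids the origin, and the norm is comparable
  -- to |x| on it. The mean value inequality applies there, and the factor 2^m comes from the points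
  -- of norm |x|/2.
  have hseg : ∀ z ∈ Metric.closedBall x (‖x‖ / 2), ‖x‖ / 2 ≤ ‖z‖ ∧ ‖z‖ ≤ 2 * ‖x‖ := by
    intro z hz
    rw [mem_closedBall_iff_norm] at hz
    have h1 := norm_sub_norm_le x z
    have h2 := norm_sub_norm_le z x
    rw [norm_sub_rev] at h1
    constructor <;> linarith
  have hbd : ∀ z ∈ Metric.closedBall x (‖x‖ / 2),
      ‖fderiv ℝ f z‖ ≤ (∑ j, c j * 2 ^ m) * ‖x‖ ^ (k - 1) := by
    intro z hz
    obtain ⟨h1, h2⟩ := hseg z hz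
    have hz0 : 0 < ‖z‖ := by linarith
    have hzk : ‖z‖ ^ (k - 1) ≤ 2 ^ m * ‖x‖ ^ (k - 1) := by
      have e : k - 1 = -(m : ℤ) := by omega
      rw [e, zpow_neg, zpow_neg, zpow_natCast, zpow_natCast, ← div_eq_mul_inv, ← div_pow, ← inv_pow]
      gcongr
      rw [inv_le_comm₀ hz0 (by positivity), inv_div]
      exact h1
    have hj : ∀ j, ‖fderiv ℝ f z (EuclideanSpace.single j 1)‖ ≤ c j * 2 ^ m * ‖x‖ ^ (k - 1) := by
      intro j
      refine (hc j z (norm_pos_iff.1 hz0) (by linarith)).trans ?_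
      rw [mul_assoc]
      exact mul_le_mul_of_nonneg_left hzk (hc0 j)
    refine ContinuousLinearMap.opNorm_le_bound _ (mul_nonneg (Finset.sum_nonneg fun j _ =>
      mul_nonneg (hc0 j) (by positivity)) (by positivity)) fun v => ?_
    have hv : v = ∑ j, v j • EuclideanSpace.single j (1 : ℝ) := by
      ext i
      simp [Finset.sum_apply, Pi.single_apply]
    conv_lhs => rw [hv]
    rw [map_sum, Finset.sum_mul, Finset.sum_mul]
    refine (norm_sum_le _ _).trans (Finset.sum_le_sum fun j _ => ?_)
    rw [map_smul, norm_smul, mul_comm]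
    gcongr
    · exact (norm_nonneg _).trans (hj j)
    · exact hj j
    · exact PiLp.norm_apply_le v j
  have := (convex_closedBall x (‖x‖ / 2)).norm_image_sub_le_of_norm_fderiv_le (𝕜 := ℝ) (f := f)
    (fun z hz => (hf.analyticAt (norm_pos_iff.1 ((by positivity : 0 < ‖x‖ / 2).trans_le
      (hseg z hz).1))).differentiableAt) hbd
    (x := y) (y := x) (by rw [mem_closedBall_iff_norm, norm_sub_rev]; linarith)
    (by simp; positivity)
  exact this

end IsPolarLog

end Polar

end

noncomputable section

/-! ### Existence of the expansions -/

section Leading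

variable {n : ℕ} {A T : Matrix (Fin n) (Fin n) ℝ}

lemma hasFDerivAt_norm_invApply (hT : IsUnit T) {x : RSpace n} (hx : x ≠ 0) :
    HasFDerivAt (fun x => ‖invApply T x‖)
      ((‖invApply T x‖⁻¹ • innerSL ℝ (invApply T x)).comp (invApplyL T)) x :=
  HasFDerivAt.comp x (hasFDerivAt_norm_of_ne (invApply_ne_zero hT hx)) (invApplyL T).hasFDerivAt

lemma partialD_norm_invApply_zpow (hT : IsUnit T) (hA : A = T * T.transpose) {x : RSpace n}
    (hx : x ≠ 0) (k : ℤ) (j : Fin n) :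
    partialD j (fun x => ((‖invApply T x‖ ^ k : ℝ) : ℂ)) x
      = ((k * ‖invApply T x‖ ^ (k - 2) * invForm A x j : ℝ) : ℂ) := by
  have h0 := norm_ne_zero_iff.2 (invApply_ne_zero hT hx)
  have h := ((hasDerivAt_zpow k ‖invApply T x‖ (Or.inl h0)).comp_hasFDerivAt x
    (hasFDerivAt_norm_invApply hT hx)).ofReal_comp'
  have h' : HasFDerivAt (fun x => ((‖invApply T x‖ ^ k : ℝ) : ℂ)) _ x := h
  rw [h'.partialD_eq]
  simp only [ContinuousLinearMap.comp_apply, smul_apply, Complex.ofRealCLM_apply, invApplyL_apply,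
    innerSL_apply_apply, inner_invApply_single hA, smul_eq_mul]
  rw [show k - 2 = k - 1 - 1 by ring, zpow_sub_one₀ h0 (k - 1)]
  push_cast
  ring

lemma partialD_log_norm_invApply (hT : IsUnit T) (hA : A = T * T.transpose) {x : RSpace n}
    (hx : x ≠ 0) (j : Fin n) :
    partialD j (fun x => (Real.log ‖invApply T x‖ : ℂ)) x
      = ((‖invApply T x‖ ^ (-2 : ℤ) * invForm A x j : ℝ) : ℂ) := by
  have h0 := norm_ne_zero_iff.2 (invApply_ne_zero hT hx)
  have h := ((hasFDerivAt_norm_invApply hT hx).log h0).ofReal_comp'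
  rw [h.partialD_eq]
  simp only [ContinuousLinearMap.comp_apply, smul_apply, Complex.ofRealCLM_apply, invApplyL_apply,
    innerSL_apply_apply, inner_invApply_single hA, smul_eq_mul]
  congr 1
  rw [zpow_neg]
  simp only [zpow_ofNat]
  field_simp

lemma analyticAt_norm_invApply (hT : IsUnit T) {x : RSpace n} (hx : x ≠ 0) :
    AnalyticAt ℝ (fun x => ‖invApply T x‖) x := by
  have h : ContDiffAt ℝ ω (fun x => ‖invApplyL T x‖) x :=
    (invApplyL T).contDiff.contDiffAt.norm ℝ (invApply_ne_zero hT hx)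
  exact h.analyticAt

lemma analyticAt_norm_invApply_zpow (hT : IsUnit T) {x : RSpace n} (hx : x ≠ 0) (k : ℤ) :
    AnalyticAt ℝ (fun x => ((‖invApply T x‖ ^ k : ℝ) : ℂ)) x := by
  have h := ((analyticAt_norm_invApply hT hx).zpow (n := k)
    (norm_ne_zero_iff.2 (invApply_ne_zero hT hx))).contDiffAt (n := ω)
  exact (contDiffAt_ofReal h).analyticAt

lemma analyticAt_log_norm_invApply (hT : IsUnit T) {x : RSpace n} (hx : x ≠ 0) :
    AnalyticAt ℝ (fun x => (Real.log ‖invApply T x‖ : ℂ)) x :=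
  (contDiffAt_ofReal (((analyticAt_norm_invApply hT hx).contDiffAt (n := ω)).log
    (norm_ne_zero_iff.2 (invApply_ne_zero hT hx)))).analyticAt

/-- The leading term of the expansion of a fundamental solution. -/
def leadingTerm (T : Matrix (Fin n) (Fin n) ℝ) (x : RSpace n) : ℂ :=
  ((1 / |T.det| * laplaceFundamentalSolution n (invApply T x) : ℝ) : ℂ)

lemma leadingTerm_of_eq (h : n = 2) (T : Matrix (Fin n) (Fin n) ℝ) :
    leadingTerm T = fun x => ((1 / (|T.det| * sphereArea n) : ℝ) : ℂ)
      * (Real.log ‖invApply T x‖ : ℂ) := by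
  ext x
  rw [leadingTerm, laplaceFundamentalSolution, if_pos h, ← Complex.ofReal_mul, ← mul_assoc,
    one_div_mul_one_div]

lemma leadingTerm_of_ne (h : n ≠ 2) (T : Matrix (Fin n) (Fin n) ℝ) :
    leadingTerm T = fun x => ((1 / (|T.det| * ((2 - (n : ℝ)) * sphereArea n)) : ℝ) : ℂ)
      * ((‖invApply T x‖ ^ (2 - (n : ℤ)) : ℝ) : ℂ) := by
  ext x
  rw [leadingTerm, laplaceFundamentalSolution, if_neg h, ← Complex.ofReal_mul, ← mul_assoc,
    one_div_mul_one_div]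

lemma analyticAt_leadingTerm (hT : IsUnit T) {x : RSpace n} (hx : x ≠ 0) :
    AnalyticAt ℝ (leadingTerm T) x := by
  by_cases h : n = 2
  · rw [leadingTerm_of_eq h]
    exact analyticAt_const.fun_mul (analyticAt_log_norm_invApply hT hx)
  · rw [leadingTerm_of_ne h]
    exact analyticAt_const.fun_mul (analyticAt_norm_invApply_zpow hT hx _)

lemma partialD_leadingTerm (hT : IsUnit T) (hA : A = T * T.transpose) {x : RSpace n}
    (hx : x ≠ 0) (j : Fin n) :
    partialD j (leadingTerm T) x = ((1 / (sphereArea n * |T.det|) * ‖invApply T x‖ ^ (-(n : ℤ))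
      * invForm A x j : ℝ) : ℂ) := by
  by_cases h : n = 2
  · rw [leadingTerm_of_eq h, partialD_const_mul j _
      (analyticAt_log_norm_invApply hT hx).differentiableAt, partialD_log_norm_invApply hT hA hx,
      ← Complex.ofReal_mul, ← mul_assoc]
    rw [show (-(n : ℤ)) = -2 by omega, mul_comm |T.det|]
  · have h2 : (2 : ℝ) - n ≠ 0 := by
      intro h'
      exact h (by exact_mod_cast (sub_eq_zero.1 h').symm)
    rw [leadingTerm_of_ne h, partialD_const_mul j _
      (analyticAt_norm_invApply_zpow hT hx _).differentiableAt,
      partialD_norm_invApply_zpow hT hA hx, ← Complex.ofReal_mul]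
    congr 1
    rw [show 2 - (n : ℤ) - 2 = -(n : ℤ) by ring]
    push_cast
    rw [← mul_assoc, ← mul_assoc]
    congr 2
    -- If one of these denominators vanished, both sides would be zero by the convention for
    -- division, so no positivity is needed.
    by_cases hs : sphereArea n = 0
    · simp [hs]
    by_cases hd : |T.det| = 0
    · simp [hd]
    field_simp

end Leading

/-! ### Differentiating the expansion: the coefficient A₂. -/

section GradientExpansion

variable {n : ℕ}

/-- The coefficient `A₂` obtained by differentiating `|x|^(3-n) A₁ + (B₁ + b) log |x|`, when
`B₁ + b = |x|^(3-n) N`. -/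
def gradCoeff (A₁ N : RSpace n × ℝ → ℂ) (p : RSpace n × ℝ) (j : Fin n) : ℂ :=
  polarDer (3 - (n : ℤ)) j A₁ p + N p * (p.1 j : ℂ)

lemma isAnalyticNearSphere_gradCoeff {A₁ N : RSpace n × ℝ → ℂ} (hA : IsAnalyticNearSphere A₁)
    (hN : IsAnalyticNearSphere N) : IsAnalyticNearSphere (gradCoeff A₁ N) := by
  intro p hp
  refine analyticAt_pi_iff.2 fun j => ?_
  refine (hA.polarDer (3 - (n : ℤ)) j p hp).fun_add ((hN p hp).fun_mul ?_)
  exact (contDiffAt_ofReal ((contDiff_coord j).comp contDiff_fst).contDiffAt).analyticAt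

/-- At r = 0 each term is even: θ_j A₁ and θ_j N are products of two odd functions, the gradient of
an odd function is even, and so is e_j - θ_j θ. Oddness is assumed for all θ ≠ 0, because ambient
directions are differentiated, not only those tangent to the sphere. -/
lemma gradCoeff_even {A₁ N : RSpace n × ℝ → ℂ} (hA : IsAnalyticNearSphere A₁)
    (hAo : ∀ θ : RSpace n, θ ≠ 0 → A₁ (-θ, 0) = -A₁ (θ, 0))
    (hNo : ∀ θ : RSpace n, θ ≠ 0 → N (-θ, 0) = -N (θ, 0)) {θ : RSpace n} (hθ : ‖θ‖ = 1) :
    gradCoeff A₁ N (-θ, 0) = gradCoeff A₁ N (θ, 0) := by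
  have h0 : θ ≠ 0 := by
    intro h
    simp [h] at hθ
  have hmem : ∀ η : RSpace n, ‖η‖ = 1 →
      (η, (0 : ℝ)) ∈ (Metric.sphere 0 1 ×ˢ Set.univ : Set (RSpace n × ℝ)) := by
    intro η hη
    exact ⟨by simpa using hη, trivial⟩
  have hD : ∀ η : RSpace n, ‖η‖ = 1 → HasFDerivAt (fun η => A₁ (η, 0))
      ((fderiv ℝ A₁ (η, 0)).comp (ContinuousLinearMap.inl ℝ (RSpace n) ℝ)) η := fun η hη =>
    HasFDerivAt.comp (g := A₁) (f := fun η : RSpace n => (η, (0 : ℝ))) η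
      (hA _ (hmem η hη)).differentiableAt.hasFDerivAt (hasFDerivAt_prodMk_left η 0)
  have key : ∀ v : RSpace n, fderiv ℝ A₁ (-θ, 0) (v, 0) = fderiv ℝ A₁ (θ, 0) (v, 0) := by
    intro v
    have h1 := hD θ hθ
    have h2 : HasFDerivAt (fun η : RSpace n => A₁ (-η, 0)) _ θ :=
      HasFDerivAt.comp (g := fun η => A₁ (η, 0)) (f := fun η : RSpace n => -η) θ
        (hD (-θ) (by simpa using hθ)) (hasFDerivAt_id θ).fun_neg
    have he : (fun η : RSpace n => A₁ (η, 0)) =ᶠ[𝓝 θ] -fun η : RSpace n => A₁ (-η, 0) := by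
      filter_upwards [eventually_ne_zero h0] with η hη
      simp [hAo η hη]
    have h4 := congrArg (fun L : RSpace n →L[ℝ] ℂ => L v)
      (h1.unique (h2.neg.congr_of_eventuallyEq he))
    simp only [ContinuousLinearMap.comp_apply, ContinuousLinearMap.inl_apply, neg_apply,
      ContinuousLinearMap.id_apply] at h4
    rw [h4, ← map_neg]
    simp
  ext j
  simp only [gradCoeff, polarDer, hAo θ h0, hNo θ h0, zero_mul, key]
  simp

/-- The derivative of log |x| brings in (B₁ + b) x_j / |x|². Factoring |x|^(3-n) out of B₁ + b turns
it into |x|^(2-n) N θ_j, which joins A₂. -/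
lemma partialD_expansion {L S C : RSpace n → ℂ} {A₁ N : RSpace n × ℝ → ℂ} {b : ℂ}
    {B₁ : RSpace n → ℂ} (hA : IsAnalyticNearSphere A₁) (hB : AnalyticOnNhd ℝ B₁ Set.univ)
    (hC : AnalyticOnNhd ℝ C Set.univ)
    (hN : ∀ x, x ≠ 0 → B₁ x + b = ((‖x‖ ^ (3 - (n : ℤ)) : ℝ) : ℂ) * N (polar x))
    (hS : ∀ x, x ≠ 0 → S x = L x + ((‖x‖ ^ (3 - (n : ℤ)) : ℝ) : ℂ) * A₁ (polar x)
      + (B₁ x + b) * (Real.log ‖x‖ : ℂ) + C x) {x : RSpace n} (hx : x ≠ 0)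
    (hL : DifferentiableAt ℝ L x) (j : Fin n) :
    partialD j S x = partialD j L x + ((‖x‖ ^ (2 - (n : ℤ)) : ℝ) : ℂ)
      * gradCoeff A₁ N (polar x) j + partialD j B₁ x * (Real.log ‖x‖ : ℂ) + partialD j C x := by
  have h0 := norm_ne_zero_iff.2 hx
  have e : S =ᶠ[𝓝 x] fun x => L x + ((‖x‖ ^ (3 - (n : ℤ)) : ℝ) : ℂ) * A₁ (polar x)
      + (B₁ x + b) * (Real.log ‖x‖ : ℂ) + C x := by
    filter_upwards [eventually_ne_zero hx] with y hy using hS y hy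
  have d1 := (analyticAt_norm_zpow hx (3 - (n : ℤ))).differentiableAt.fun_mul
      (hA.comp_polar hx).differentiableAt
  have dB := (hB x trivial).differentiableAt
  have dBb : DifferentiableAt ℝ (fun x => B₁ x + b) x := dB.add_const b
  have dl := (analyticAt_log_norm hx).differentiableAt
  have dC := (hC x trivial).differentiableAt
  have pb : partialD j (fun x => B₁ x + b) x = partialD j B₁ x := by
    rw [partialD, fderiv_add_const, partialD]
  rw [e.partialD_eq, partialD_add j ((hL.fun_add d1).fun_add (dBb.fun_mul dl)) dC,
    partialD_add j (hL.fun_add d1) (dBb.fun_mul dl), partialD_add j hL d1,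
    partialD_mul j dBb dl, pb, partialD_log_norm hx,
    partialD_zpow_mul_polar hx _ (hA _ (polar_mem hx)).differentiableAt, hN x hx, gradCoeff,
    show (3 : ℤ) - n - 1 = 2 - n by ring]
  have e2 : ‖x‖ ^ (3 - (n : ℤ)) * (x j / ‖x‖ ^ 2) = ‖x‖ ^ (2 - (n : ℤ)) * (polar x).1 j := by
    rw [show (3 : ℤ) - n = (2 - n) + 1 by ring, zpow_add_one₀ h0]
    simp only [polar, PiLp.smul_apply, smul_eq_mul]
    field_simp
  have e3 := congrArg (fun r : ℝ => (r : ℂ)) e2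
  simp only [Complex.ofReal_mul] at e3
  linear_combination N (polar x) * e3

end GradientExpansion

/-! ### Dividing out one power of the radius along rays. -/

section Division

variable {n : ℕ} {T : Matrix (Fin n) (Fin n) ℝ} {β : Fin n → ℂ} {F : ℂ → ℂ}

lemma contDiff_of_entire (hF : Differentiable ℂ F) {m : WithTop ℕ∞} : ContDiff ℝ m F :=
  hF.contDiff.restrict_scalars ℝ

lemma differentiable_dslope (hF : Differentiable ℂ F) : Differentiable ℂ (dslope F 0) :=
  differentiableOn_univ.1 ((Complex.differentiableOn_dslope Filter.univ_mem).2 hF.differentiableOn)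

/-- The quotient `(e^{-r β·θ} F(r² |T⁻¹θ|²) - F(0)) / r`, extended to `r = 0`. -/
def radialQuotient (T : Matrix (Fin n) (Fin n) ℝ) (β : Fin n → ℂ) (F : ℂ → ℂ)
    (p : RSpace n × ℝ) : ℂ :=
  F ((p.2 ^ 2 * ‖invApply T p.1‖ ^ 2 : ℝ) : ℂ)
      * (-pairing β p.1 * dslope Complex.exp 0 (-((p.2 : ℂ) * pairing β p.1)))
    + ((p.2 * ‖invApply T p.1‖ ^ 2 : ℝ) : ℂ)
      * dslope F 0 ((p.2 ^ 2 * ‖invApply T p.1‖ ^ 2 : ℝ) : ℂ)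

lemma contDiff_norm_invApply_sq {m : WithTop ℕ∞} :
    ContDiff ℝ m fun x : RSpace n => ‖invApply T x‖ ^ 2 :=
  (invApplyL T).contDiff.norm_sq ℝ

lemma analyticAt_radialQuotient (hF : Differentiable ℂ F) (p : RSpace n × ℝ) :
    AnalyticAt ℝ (radialQuotient T β F) p := by
  have hq : ContDiff ℝ ω fun p : RSpace n × ℝ => ‖invApply T p.1‖ ^ 2 :=
    contDiff_norm_invApply_sq.comp contDiff_fst
  have hr : ContDiff ℝ ω fun p : RSpace n × ℝ => p.2 := contDiff_snd
  have hs : ContDiff ℝ ω fun p : RSpace n × ℝ => ((p.2 ^ 2 * ‖invApply T p.1‖ ^ 2 : ℝ) : ℂ) :=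
    Complex.ofRealCLM.contDiff.comp ((hr.pow 2).mul hq)
  have hb : ContDiff ℝ ω fun p : RSpace n × ℝ => pairing β p.1 :=
    (pairing β).contDiff.comp contDiff_fst
  have hrc : ContDiff ℝ ω fun p : RSpace n × ℝ => (p.2 : ℂ) := Complex.ofRealCLM.contDiff.comp hr
  have h1 := (contDiff_of_entire hF (m := ω)).comp hs
  have h2 := (contDiff_of_entire (differentiable_dslope hF) (m := ω)).comp hs
  have h3 := (contDiff_of_entire (differentiable_dslope Complex.differentiable_exp) (m := ω)).comp
    (hrc.mul hb).neg
  have h4 : ContDiff ℝ ω fun p : RSpace n × ℝ => ((p.2 * ‖invApply T p.1‖ ^ 2 : ℝ) : ℂ) :=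
    Complex.ofRealCLM.contDiff.comp (hr.mul hq)
  exact ((h1.mul (hb.neg.mul h3)).add (h4.mul h2)).contDiffAt.analyticAt

lemma radialQuotient_neg (θ : RSpace n) :
    radialQuotient T β F (-θ, 0) = -radialQuotient T β F (θ, 0) := by
  simp [radialQuotient]

lemma norm_invApply_polar {x : RSpace n} (hx : x ≠ 0) :
    ‖invApply T x‖ = ‖x‖ * ‖invApply T (polar x).1‖ := by
  have h := (invApplyL T).map_smul (polar x).2 (polar x).1
  rw [polar_snd_smul_fst hx] at h
  have h' : invApply T x = ‖x‖ • invApply T (polar x).1 := h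
  conv_lhs => rw [h', norm_smul, norm_norm]

/-- Write e^z = 1 + z · dslope and F(s) = F(0) + s · dslope. Here z = -β·x carries one factor |x|
and s = |T⁻¹x|² carries two. The slope functions are entire, so the quotient stays analytic down to
r = 0. -/
lemma expFactor_mul_eq {x : RSpace n} (hx : x ≠ 0) :
    expFactor β x * F ((‖invApply T x‖ ^ 2 : ℝ) : ℂ)
      = F 0 + (‖x‖ : ℂ) * radialQuotient T β F (polar x) := by
  have e1 : (polar x).2 ^ 2 * ‖invApply T (polar x).1‖ ^ 2 = ‖invApply T x‖ ^ 2 := by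
    rw [norm_invApply_polar hx, mul_pow]
    rfl
  have e2 : ((polar x).2 : ℂ) * pairing β (polar x).1 = pairing β x := by
    conv_rhs => rw [← polar_snd_smul_fst hx, map_smul, Complex.real_smul]
  have e3 := sub_smul_dslope Complex.exp 0 (-pairing β x)
  have e4 := sub_smul_dslope F 0 ((‖invApply T x‖ ^ 2 : ℝ) : ℂ)
  have e5 : (‖x‖ : ℂ) * pairing β (polar x).1 = pairing β x := e2
  have e6 : (‖x‖ : ℂ) * (((polar x).2 * ‖invApply T (polar x).1‖ ^ 2 : ℝ) : ℂ)
      = ((‖invApply T x‖ ^ 2 : ℝ) : ℂ) := by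
    rw [← e1, ← Complex.ofReal_mul]
    congr 1
    change ‖x‖ * (‖x‖ * _) = ‖x‖ ^ 2 * _
    ring
  rw [radialQuotient, e1, e2, expFactor_eq]
  simp only [sub_zero, smul_eq_mul, Complex.exp_zero] at e3 e4
  linear_combination -F ((‖invApply T x‖ ^ 2 : ℝ) : ℂ) * e3 - e4
    + F ((‖invApply T x‖ ^ 2 : ℝ) : ℂ) * dslope Complex.exp 0 (-pairing β x) * e5
    - dslope F 0 ((‖invApply T x‖ ^ 2 : ℝ) : ℂ) * e6

end Division

end

noncomputable section

/-! ### Expansion of the explicit solution, and its transfer to an arbitrary one. -/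

section Existence

variable {n : ℕ} {T : Matrix (Fin n) (Fin n) ℝ} {β : Fin n → ℂ} {G J : ℂ → ℂ}

lemma contDiff_expFactor_mul {F : ℂ → ℂ} (hF : Differentiable ℂ F) :
    ContDiff ℝ ω fun x : RSpace n => expFactor β x * F ((‖invApply T x‖ ^ 2 : ℝ) : ℂ) := by
  have h1 : ContDiff ℝ ω fun x : RSpace n => ((‖invApply T x‖ ^ 2 : ℝ) : ℂ) :=
    Complex.ofRealCLM.contDiff.comp contDiff_norm_invApply_sq
  rw [expFactor_eq]
  exact ((contDiff_of_entire Complex.differentiable_exp).comp (pairing β).contDiff.neg).mul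
    ((contDiff_of_entire hF).comp h1)

lemma log_norm_invApply_sq (hT : IsUnit T) {x : RSpace n} (hx : x ≠ 0) :
    Real.log (‖invApply T x‖ ^ 2)
      = 2 * Real.log ‖x‖ + 2 * Real.log ‖invApply T (polar x).1‖ := by
  have h1 := norm_ne_zero_iff.2 hx
  have h2 : ‖invApply T x‖ ≠ 0 := norm_ne_zero_iff.2 (invApply_ne_zero hT hx)
  rw [Real.log_pow, norm_invApply_polar hx]
  rw [norm_invApply_polar hx] at h2
  rw [Real.log_mul h1 (right_ne_zero_of_mul h2)]
  push_cast
  ring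

lemma fst_ne_zero_of_mem_sphere {p : RSpace n × ℝ}
    (hp : p ∈ (Metric.sphere 0 1 ×ˢ Set.univ : Set (RSpace n × ℝ))) : p.1 ≠ 0 := by
  intro h
  have := hp.1
  simp [h] at this

lemma isAnalyticNearSphere_log (hT : IsUnit T) :
    IsAnalyticNearSphere fun p : RSpace n × ℝ => (Real.log ‖invApply T p.1‖ : ℂ) := fun _ hp =>
  (analyticAt_log_norm_invApply hT (fst_ne_zero_of_mem_sphere hp)).comp analyticAt_fst

lemma isAnalyticNearSphere_zpow (hT : IsUnit T) (k : ℤ) :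
    IsAnalyticNearSphere fun p : RSpace n × ℝ => ((‖invApply T p.1‖ ^ k : ℝ) : ℂ) := fun _ hp =>
  (analyticAt_norm_invApply_zpow hT (fst_ne_zero_of_mem_sphere hp) k).comp analyticAt_fst

lemma norm_invApply_neg (θ : RSpace n) : ‖invApply T (-θ)‖ = ‖invApply T θ‖ := by
  rw [← invApplyL_apply, map_neg, norm_neg, invApplyL_apply]

/-- The expansion of the explicit fundamental solution, together with the information needed to
differentiate it. -/
lemma exists_expansion_profileSolution (hn : 2 ≤ n) (hT : IsUnit T) {κ : ℂ}
    (hGJ : IsRadialProfile n κ G J) :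
    ∃ (A₁ N : RSpace n × ℝ → ℂ) (b₀ : ℂ) (B₁ C : RSpace n → ℂ),
      IsAnalyticNearSphere A₁ ∧ IsAnalyticNearSphere N ∧
      (∀ θ : RSpace n, θ ≠ 0 → A₁ (-θ, 0) = -A₁ (θ, 0)) ∧
      (∀ θ : RSpace n, θ ≠ 0 → N (-θ, 0) = -N (θ, 0)) ∧
      AnalyticOnNhd ℝ B₁ Set.univ ∧ B₁ 0 = 0 ∧ AnalyticOnNhd ℝ C Set.univ ∧
      (Odd n → b₀ = 0 ∧ ∀ x, B₁ x = 0) ∧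
      (∀ x, x ≠ 0 → B₁ x + b₀ * (if n = 2 then 0 else 1)
        = ((‖x‖ ^ (3 - (n : ℤ)) : ℝ) : ℂ) * N (polar x)) ∧
      ∀ x, x ≠ 0 → profileSolution T β G J x = leadingTerm T x
        + ((‖x‖ ^ (3 - (n : ℤ)) : ℝ) : ℂ) * A₁ (polar x)
        + (B₁ x + b₀ * (if n = 2 then 0 else 1)) * (Real.log ‖x‖ : ℂ) + C x := by
  obtain ⟨k, hk⟩ : ∃ k : ℂ, ((profileConst n / |T.det| : ℝ) : ℂ) = k := ⟨_, rfl⟩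
  have hBan : AnalyticOnNhd ℝ (fun x : RSpace n => 2 * k
      * (expFactor β x * J ((‖invApply T x‖ ^ 2 : ℝ) : ℂ) - J 0)) Set.univ := fun x _ =>
    (contDiff_const.mul ((contDiff_expFactor_mul hGJ.diffJ).sub
      contDiff_const)).contDiffAt.analyticAt
  have hB0 : 2 * k * (expFactor β (0 : RSpace n)
      * J ((‖invApply T (0 : RSpace n)‖ ^ 2 : ℝ) : ℂ) - J 0) = 0 := by
    simp [expFactor, cpair, ← invApplyL_apply]
  have hodd : Odd n → 2 * k * J 0 = 0 ∧ ∀ x : RSpace n, 2 * k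
      * (expFactor β x * J ((‖invApply T x‖ ^ 2 : ℝ) : ℂ) - J 0) = 0 := by
    intro ho
    simp [hGJ.odd_dim ho]
  by_cases h2 : n = 2
  -- For n = 2 the part J(0) log |T⁻¹x|² is the leading term; the factor 2 from the square cancels
  -- the one in `profileConst`. The rest of the logarithmic term carries a factor |x| and splits by
  -- log |T⁻¹x| = log |x| + log |T⁻¹θ| into B₁ and A₁. The constant b₀ is irrelevant because of the
  -- factor 1 - δ_{2,n}.
  · have hJ0 := hGJ.leading_two h2
    refine ⟨fun p => 2 * k * radialQuotient T β J p * (Real.log ‖invApply T p.1‖ : ℂ),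
      fun p => 2 * k * radialQuotient T β J p, 2 * k * J 0,
      fun x => 2 * k * (expFactor β x * J ((‖invApply T x‖ ^ 2 : ℝ) : ℂ) - J 0),
      fun x => k * (expFactor β x * G ((‖invApply T x‖ ^ 2 : ℝ) : ℂ)),
      fun p hp => (analyticAt_const.fun_mul (analyticAt_radialQuotient hGJ.diffJ p)).fun_mul
        (isAnalyticNearSphere_log hT p hp),
      fun p hp => analyticAt_const.fun_mul (analyticAt_radialQuotient hGJ.diffJ p),
      fun θ _ => ?_, fun θ _ => ?_, hBan, hB0, fun x _ => (contDiff_const.mul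
        (contDiff_expFactor_mul hGJ.diffG)).contDiffAt.analyticAt, hodd, fun x hx => ?_,
      fun x hx => ?_⟩
    · simp only [radialQuotient_neg, norm_invApply_neg]
      ring
    · simp only [radialQuotient_neg]
      ring
    · have he := expFactor_mul_eq (T := T) (β := β) (F := J) hx
      rw [if_pos h2, show (3 : ℤ) - n = 1 by omega, zpow_one]
      linear_combination 2 * k * he
    · have he := expFactor_mul_eq (T := T) (β := β) (F := J) hx
      have hlog := congrArg (fun r : ℝ => (r : ℂ)) (log_norm_invApply_sq hT hx)
      have hlog2 : Real.log (‖invApply T x‖ ^ 2) = 2 * Real.log ‖invApply T x‖ := by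
        rw [Real.log_pow]; norm_num
      have hlead : leadingTerm T x = k * (Real.log (‖invApply T x‖ ^ 2) : ℂ) := by
        simp only [leadingTerm_of_eq h2]
        rw [hlog2, ← hk, profileConst, if_pos h2, ← Complex.ofReal_mul, ← Complex.ofReal_mul]
        congr 1
        field_simp
      have hp : (1 - (n : ℝ) / 2) = 0 := by rw [h2]; norm_num
      rw [profileSolution, frobeniusFn, hk, hlead, if_pos h2, hp, Real.rpow_zero,
        show (3 : ℤ) - n = 1 by omega, zpow_one]
      simp only [Complex.ofReal_mul, Complex.ofReal_add, Complex.ofReal_ofNat] at hlog ⊢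
      rw [hJ0] at he ⊢
      push_cast at he hlog ⊢
      linear_combination (k * (Real.log (‖invApply T x‖ ^ 2) : ℂ) - 2 * k * (Real.log ‖x‖ : ℂ))
        * he + k * (‖x‖ : ℂ) * radialQuotient T β J (polar x) * hlog
  · have hG0 := hGJ.leading h2
    have hn3 : 3 ≤ n := by omega
    -- With m = n - 3 the logarithmic term is |x|^(3-n) r^m times an analytic function. Its part 2
    -- log |T⁻¹θ| goes into A₁ and its part 2 log |x| gives B₁ + b₀, so C can be taken to be 0.
    obtain ⟨m, rfl⟩ := Nat.exists_eq_add_of_le hn3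
    have hpow : ∀ x : RSpace (3 + m), x ≠ 0 → ‖x‖ ^ (3 - ((3 + m : ℕ) : ℤ)) * ‖x‖ ^ m = 1 := by
      intro x hx
      have h0 := norm_ne_zero_iff.2 hx
      rw [← zpow_natCast, ← zpow_add₀ h0]
      simp
    -- At r = 0 the logarithmic contribution must vanish to keep A₁ odd. The power 0^m does this for
    -- n > 3; for n = 3 the dimension is odd and J = 0.
    have hJ3 : ∀ F : ℂ, ((0 : ℝ) ^ m : ℝ) * (J 0 * F) = 0 := by
      intro F
      rcases Nat.eq_zero_or_pos m with rfl | hm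
      · simp [hGJ.odd_dim (by decide)]
      · simp [hm.ne']
    have hEJ : AnalyticOnNhd ℝ (fun x : RSpace (3 + m) => expFactor β x
        * J ((‖invApply T x‖ ^ 2 : ℝ) : ℂ)) Set.univ := fun x _ =>
      (contDiff_expFactor_mul hGJ.diffJ).contDiffAt.analyticAt
    have hEJ0 : expFactor β (0 : RSpace (3 + m))
        * J ((‖invApply T (0 : RSpace (3 + m))‖ ^ 2 : ℝ) : ℂ) = J 0 := by
      simp [expFactor, cpair, ← invApplyL_apply]
    refine ⟨fun p => k * (((‖invApply T p.1‖ ^ (2 - ((3 + m : ℕ) : ℤ)) : ℝ) : ℂ)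
          * radialQuotient T β G p
        + ((p.2 ^ m : ℝ) : ℂ) * (expFactor β (p.2 • p.1)
          * J ((‖invApply T (p.2 • p.1)‖ ^ 2 : ℝ) : ℂ)) * (2 * (Real.log ‖invApply T p.1‖ : ℂ))),
      fun p => 2 * k * (((p.2 ^ m : ℝ) : ℂ) * (expFactor β (p.2 • p.1)
          * J ((‖invApply T (p.2 • p.1)‖ ^ 2 : ℝ) : ℂ))), 2 * k * J 0,
      fun x => 2 * k * (expFactor β x * J ((‖invApply T x‖ ^ 2 : ℝ) : ℂ) - J 0),
      fun x => 0, fun p hp => ?_, fun p hp => analyticAt_const.fun_mul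
        (isAnalyticNearSphere_pow_mul hEJ m p hp), fun θ _ => ?_, fun θ _ => ?_, hBan, hB0,
      analyticOnNhd_const, hodd, fun x hx => ?_, fun x hx => ?_⟩
    · exact analyticAt_const.fun_mul (((isAnalyticNearSphere_zpow hT _ p hp).fun_mul
        (analyticAt_radialQuotient hGJ.diffG p)).fun_add
        ((isAnalyticNearSphere_pow_mul hEJ m p hp).fun_mul
          (analyticAt_const.fun_mul (isAnalyticNearSphere_log hT p hp))))
    · simp only [radialQuotient_neg, norm_invApply_neg, zero_smul, hEJ0, mul_assoc, hJ3]
      ring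
    · simp only [zero_smul, hEJ0]
      have := hJ3 1
      rw [mul_one] at this
      simp only [this, mul_zero, neg_zero]
    · have e := congrArg (fun r : ℝ => (r : ℂ)) (hpow x hx)
      simp only [Complex.ofReal_mul, Complex.ofReal_one] at e
      simp only [polar_snd_smul_fst hx, if_neg h2]
      change _ = _ * (2 * k * (((‖x‖ ^ m : ℝ) : ℂ) * _))
      linear_combination -2 * k * (expFactor β x * J ((‖invApply T x‖ ^ 2 : ℝ) : ℂ)) * e
    · have h0 := norm_ne_zero_iff.2 hx
      have he := expFactor_mul_eq (T := T) (β := β) (F := G) hx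
      have e := congrArg (fun r : ℝ => (r : ℂ)) (hpow x hx)
      simp only [Complex.ofReal_mul, Complex.ofReal_one] at e
      have hlog := congrArg (fun r : ℝ => (r : ℂ)) (log_norm_invApply_sq hT hx)
      simp only [Complex.ofReal_mul, Complex.ofReal_add, Complex.ofReal_ofNat] at hlog
      have hq : (‖invApply T x‖ ^ 2) ^ (1 - ((3 + m : ℕ) : ℝ) / 2)
          = ‖invApply T x‖ ^ (2 - ((3 + m : ℕ) : ℤ)) := by
        rw [← Real.rpow_intCast, ← Real.rpow_natCast, ← Real.rpow_mul (norm_nonneg _)]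
        congr 1
        push_cast
        ring
      have hq2 : ‖invApply T x‖ ^ (2 - ((3 + m : ℕ) : ℤ))
          = ‖x‖ ^ (2 - ((3 + m : ℕ) : ℤ))
            * ‖invApply T (polar x).1‖ ^ (2 - ((3 + m : ℕ) : ℤ)) := by
        rw [norm_invApply_polar hx, mul_zpow]
      have hq3 : ‖x‖ ^ (3 - ((3 + m : ℕ) : ℤ)) = ‖x‖ ^ (2 - ((3 + m : ℕ) : ℤ)) * ‖x‖ := by
        rw [show (3 : ℤ) - ((3 + m : ℕ) : ℤ) = 2 - ((3 + m : ℕ) : ℤ) + 1 by ring, zpow_add_one₀ h0]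
      have hq4 := congrArg (fun r : ℝ => (r : ℂ)) hq2
      have hq5 := congrArg (fun r : ℝ => (r : ℂ)) hq3
      simp only [Complex.ofReal_mul] at hq4 hq5
      have hlead : leadingTerm T x
          = k * ((‖invApply T x‖ ^ (2 - ((3 + m : ℕ) : ℤ)) : ℝ) : ℂ) := by
        simp only [leadingTerm_of_ne h2]
        rw [← hk, profileConst, if_neg h2, ← Complex.ofReal_mul, ← Complex.ofReal_mul,
          mul_comm |T.det|, div_div]
      rw [profileSolution, frobeniusFn, hk, hlead, if_neg h2, hq]
      simp only [polar_snd_smul_fst hx]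
      change _ = _ + _ * (k * (_ + ((‖x‖ ^ m : ℝ) : ℂ) * _ * _)) + _ + _
      rw [hG0] at he
      linear_combination k * ((‖invApply T x‖ ^ (2 - ((3 + m : ℕ) : ℤ)) : ℝ) : ℂ) * he
        + k * (expFactor β x * J ((‖invApply T x‖ ^ 2 : ℝ) : ℂ)) * hlog
        - 2 * k * (expFactor β x * J ((‖invApply T x‖ ^ 2 : ℝ) : ℂ))
          * (Real.log ‖invApply T (polar x).1‖ : ℂ) * e
        + k * (‖x‖ : ℂ) * radialQuotient T β G (polar x) * hq4
        - k * ((‖invApply T (polar x).1‖ ^ (2 - ((3 + m : ℕ) : ℤ)) : ℝ) : ℂ)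
          * radialQuotient T β G (polar x) * hq5

/-- A function that agrees almost everywhere, near each point, with an analytic function, and is
continuous off the origin, is analytic up to its value at the origin. -/
lemma exists_analytic_of_local {u : RSpace n → ℂ} (hu : ContinuousOn u {0}ᶜ)
    (h : ∀ x₀, ∃ v, AnalyticOnNhd ℝ v (Metric.ball x₀ 1) ∧
      ∀ᵐ x, x ∈ Metric.ball x₀ 1 → u x = v x) :
    ∃ C : RSpace n → ℂ, AnalyticOnNhd ℝ C Set.univ ∧ ∀ x, x ≠ 0 → u x = C x := by
  choose v hv hvu using h
  -- Two local representatives agree almost everywhere on the open overlap, hence everywhere on it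
  -- by continuity, so taking each at its own centre glues them.
  have h1 : ∀ x₀ x, x ∈ Metric.ball x₀ 1 → v x x = v x₀ x := by
    intro x₀ x hx
    have hU : IsOpen (Metric.ball x₀ 1 ∩ Metric.ball x (1 : ℝ)) :=
      Metric.isOpen_ball.inter Metric.isOpen_ball
    refine Measure.eqOn_open_of_ae_eq (μ := volume) ?_ hU
      ((hv x).continuousOn.mono Set.inter_subset_right)
      ((hv x₀).continuousOn.mono Set.inter_subset_left) ⟨hx, Metric.mem_ball_self one_pos⟩
    refine (ae_restrict_iff' hU.measurableSet).2 ?_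
    filter_upwards [hvu x, hvu x₀] with z h1 h2 hz
    rw [← h1 hz.2, ← h2 hz.1]
  refine ⟨fun x => v x x, fun x _ => ?_, fun x hx => ?_⟩
  · refine (hv x x (Metric.mem_ball_self one_pos)).congr ?_
    filter_upwards [Metric.ball_mem_nhds x one_pos] with y hy using (h1 x y hy).symm
  · have hU : IsOpen (Metric.ball x 1 ∩ {0}ᶜ) := Metric.isOpen_ball.inter isOpen_compl_singleton
    refine Measure.eqOn_open_of_ae_eq (μ := volume) ?_ hU (hu.mono Set.inter_subset_right)
      ((hv x).continuousOn.mono Set.inter_subset_left) ⟨Metric.mem_ball_self one_pos, hx⟩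
    refine (ae_restrict_iff' hU.measurableSet).2 ?_
    filter_upwards [hvu x] with z h1 hz using h1 hz.1

lemma exists_firstOrder {a : (Fin n → ℕ) → ℂ} (har : HasRealPrincipalPart a) (hT : IsUnit T)
    (hA : realCoeffTwo a = T * T.transpose) :
    ∃ β : Fin n → ℂ, ∀ l, 2 * ∑ j, coeffTwo a l j * β j = coeffOne a l := by
  have hu : IsUnit (realCoeffTwo a).det := factor_isUnit_det hT hA
  have hM : ∀ l m : Fin n, ∑ j, (realCoeffTwo a l j : ℂ) * ((realCoeffTwo a)⁻¹ j m : ℂ)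
      = if l = m then 1 else 0 := by
    intro l m
    have h := congrFun (congrFun (Matrix.mul_nonsing_inv _ hu) l) m
    rw [Matrix.mul_apply, Matrix.one_apply] at h
    have h' := congrArg (fun r : ℝ => (r : ℂ)) h
    push_cast at h'
    rw [h']
    split_ifs <;> simp
  refine ⟨fun j => ∑ m, ((realCoeffTwo a)⁻¹ j m : ℂ) * (coeffOne a m / 2), fun l => ?_⟩
  simp only [coeffTwo_eq_ofReal har, Finset.mul_sum]
  rw [Finset.sum_comm]
  calc _ = ∑ m, (∑ j, (realCoeffTwo a l j : ℂ) * ((realCoeffTwo a)⁻¹ j m : ℂ))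
          * coeffOne a m := by
        refine Finset.sum_congr rfl fun m _ => ?_
        rw [Finset.sum_mul]
        refine Finset.sum_congr rfl fun j _ => ?_
        ring
    _ = coeffOne a l := by simp [hM]

/-- All singular terms come from the explicit solution. The difference of two fundamental solutions
solves the homogeneous equation weakly, hence is analytic, and is added to C. Analyticity off the
origin is needed only for the explicit solution, so `S` may be any continuous one. -/
theorem exists_expansion {a : (Fin n → ℕ) → ℂ} {S : RSpace n → ℂ} (hn : 2 ≤ n)
    (ha : IsElliptic a) (har : HasRealPrincipalPart a) (hS : IsFundamentalSolution a S) :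
    ∃ (T : Matrix (Fin n) (Fin n) ℝ) (A₁ : RSpace n × ℝ → ℂ) (b₀ : ℂ) (B₁ C : RSpace n → ℂ)
      (A₂ : RSpace n × ℝ → Fin n → ℂ),
      IsExpansion a S T A₁ b₀ B₁ C ∧ IsGradientExpansion a S T B₁ C A₂ := by
  obtain ⟨T, hT, hA⟩ := exists_factor ha har
  obtain ⟨β, hβ⟩ := exists_firstOrder har hT hA
  obtain ⟨G, J, hGJ⟩ := exists_isRadialProfile n (by omega)
    (a 0 - ∑ l, ∑ j, coeffTwo a l j * β l * β j)
  have hS₀ := isFundamentalSolution_profileSolution hn har hT hA hβ hGJ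
  obtain ⟨A₁, N, b₀, B₁, C₀, hA₁, hN, hA₁o, hNo, hB, hB0, hC₀, hodd, hNe, hexp⟩ :=
    exists_expansion_profileSolution (β := β) hn hT hGJ
  have hS₀a : ∀ x, x ≠ 0 → AnalyticAt ℝ (profileSolution T β G J) x := by
    intro x hx
    refine ((((analyticAt_leadingTerm hT hx).fun_add ((analyticAt_norm_zpow hx
      (3 - (n : ℤ))).fun_mul (hA₁.comp_polar hx))).fun_add (((hB x trivial).fun_add
      (analyticAt_const (v := b₀ * (if n = 2 then 0 else 1)))).fun_mul
      (analyticAt_log_norm hx))).fun_add (hC₀ x trivial)).congr ?_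
    filter_upwards [eventually_ne_zero hx] with y hy using (hexp y hy).symm
  have hu : ContinuousOn (fun x => S x - profileSolution T β G J x) {0}ᶜ :=
    hS.continuousOn.sub hS₀.continuousOn
  have hweak : ∀ φ : RSpace n → ℂ, ContDiff ℝ ∞ φ → HasCompactSupport φ →
      ∫ x, (S x - profileSolution T β G J x) * transposeOp a φ x = 0 := by
    intro φ hφ hφc
    have hc := contDiff_transposeOp a hφ
    have hcs : HasCompactSupport (transposeOp a φ) := by
      refine hφc.of_isClosed_subset (isClosed_tsupport _) (closure_minimal ?_ (isClosed_tsupport _))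
      intro x hx
      by_contra hx'
      apply hx
      have h0 : φ =ᶠ[𝓝 x] 0 := notMem_tsupport_iff_eventuallyEq.1 hx'
      have h1 : ∀ j, partialD j φ =ᶠ[𝓝 x] 0 := by
        intro j
        filter_upwards [h0.eventuallyEq_nhds] with y hy
        rw [hy.partialD_eq]
        simp [partialD]
      have h2 : ∀ l j, partialD l (partialD j φ) x = 0 := by
        intro l j
        rw [(h1 j).partialD_eq]
        simp [partialD]
      simp [transposeOp, h2, (h1 _).eq_of_nhds, h0.eq_of_nhds]
    have i1 : Integrable fun x => S x * transposeOp a φ x := by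
      simpa [mul_comm] using hS.locallyIntegrable.integrable_smul_left_of_hasCompactSupport hc hcs
    have i2 : Integrable fun x => profileSolution T β G J x * transposeOp a φ x := by
      simpa [mul_comm] using hS₀.locallyIntegrable.integrable_smul_left_of_hasCompactSupport hc hcs
    simp only [sub_mul]
    rw [integral_sub i1 i2, hS.weak_eq φ hφ hφc, hS₀.weak_eq φ hφ hφc, sub_self]
  obtain ⟨C₁, hC₁, hC₁u⟩ := exists_analytic_of_local hu
    (exists_analytic_of_weak_solution hS₀ hS₀a
      (hS.locallyIntegrable.sub hS₀.locallyIntegrable) hweak)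
  have hC : AnalyticOnNhd ℝ (fun x => C₀ x + C₁ x) Set.univ := fun x hx =>
    (hC₀ x hx).fun_add (hC₁ x hx)
  have hSe : ∀ x, x ≠ 0 → S x = leadingTerm T x
      + ((‖x‖ ^ (3 - (n : ℤ)) : ℝ) : ℂ) * A₁ (polar x)
      + (B₁ x + b₀ * (if n = 2 then 0 else 1)) * (Real.log ‖x‖ : ℂ) + (C₀ x + C₁ x) := by
    intro x hx
    rw [← hC₁u x hx, hexp x hx]
    ring
  refine ⟨T, A₁, b₀, B₁, fun x => C₀ x + C₁ x, gradCoeff A₁ N,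
    ⟨hT, hA, hA₁, fun θ hθ => hA₁o θ ?_, hB, hB0, hC, hodd, fun x hx => ?_⟩,
    ⟨isAnalyticNearSphere_gradCoeff hA₁ hN, fun θ hθ => gradCoeff_even hA₁ hA₁o hNo hθ,
      fun x hx j => ?_⟩⟩
  · rintro rfl
    simp at hθ
  · rw [hSe x hx, leadingTerm, sqrt_det_eq hA]
  · rw [partialD_expansion hA₁ hB hC hNe hSe hx (analyticAt_leadingTerm hT hx).differentiableAt j,
      partialD_leadingTerm hT hA hx, sqrt_det_eq hA]
    rfl

end Existence

end

noncomputable section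

/-! ### Geometry of the boundary -/

section Boundary

variable {n : ℕ} {α : ℝ} {Ω : Set (RSpace n)}

/-- `Φ` is, on the ball of radius `ρ` around `p`, a defining function of `Ω` with Hölder continuous
gradient `g`, increasing at unit speed along `e`. -/
structure IsLocalDefining (α : ℝ) (Ω : Set (RSpace n)) (p e : RSpace n) (ρ c : ℝ)
    (Φ : RSpace n → ℝ) (g : RSpace n → RSpace n) : Prop where
  pos : 0 < ρ
  hasFDerivAt : ∀ x ∈ Metric.ball p ρ, HasFDerivAt Φ (innerSL ℝ (g x)) x
  one_le_norm : ∀ x, 1 ≤ ‖g x‖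
  holder : ∀ x ∈ Metric.ball p ρ, ∀ y ∈ Metric.ball p ρ, ‖g x - g y‖ ≤ c * ‖x - y‖ ^ α
  mem_iff : ∀ x ∈ Metric.ball p ρ, (x ∈ Ω ↔ Φ x < 0)
  translate : ∀ x (s : ℝ), Φ (x + s • e) = Φ x + s

/-- Take Φ(x) = ⟨e, x - p⟩ - γ(π(x - p)), with π the orthogonal projection onto the complement of e.
Its gradient is e minus a vector orthogonal to e, hence of norm at least 1; the Hölder bound passes
from γ because π does not increase norms. -/
lemma exists_isLocalDefining (hα : 0 < α) (hΩ : IsOfClassC1Holder α Ω) {p : RSpace n}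
    (hp : p ∈ frontier Ω) : ∃ e ρ c Φ g, IsLocalDefining α Ω p e ρ c Φ g := by
  obtain ⟨e, r, δ, γ, he, hr, hδ, -, -, hγC, ⟨c, hc⟩, hmem⟩ := hΩ p hp
  let V := (Submodule.span ℝ {e})ᗮ
  let π : RSpace n →L[ℝ] V := V.orthogonalProjectionOnto
  let grad : V → V := fun η => (InnerProductSpace.toDual ℝ V).symm (fderiv ℝ γ η)
  have hπe : π e = 0 := by
    refine Submodule.orthogonalProjectionOnto_eq_zero_iff.2 ?_
    exact Submodule.le_orthogonal_orthogonal _ (Submodule.mem_span_singleton_self e)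
  have hπn : ∀ v, ‖π v‖ ≤ ‖v‖ := V.norm_orthogonalProjectionOnto_apply_le
  have horth : ∀ η : V, inner ℝ e (η : RSpace n) = 0 := fun η =>
    Submodule.mem_orthogonal_singleton_iff_inner_right.1 η.2
  have hdec : ∀ x, p + (π (x - p) : RSpace n) + inner ℝ e (x - p) • e = x := by
    intro x
    have h1 : (π (x - p) : RSpace n) = (x - p) - inner ℝ e (x - p) • e := by
      have := Submodule.starProjection_orthogonal_val (K := Submodule.span ℝ {e}) (x - p)
      rw [Submodule.starProjection_unit_singleton ℝ he] at this
      exact this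
    rw [h1]
    abel
  have hball : ∀ x ∈ Metric.ball p (min r δ),
      π (x - p) ∈ Metric.ball (0 : V) r ∧ |inner ℝ e (x - p)| < δ := by
    intro x hx
    rw [mem_ball_iff_norm, lt_min_iff] at hx
    refine ⟨by simpa using (hπn _).trans_lt hx.1, ?_⟩
    have := abs_real_inner_le_norm e (x - p)
    rw [he, one_mul] at this
    exact this.trans_lt hx.2
  refine ⟨e, min r δ, |c|, fun x => inner ℝ e (x - p) - γ (π (x - p)),
    fun x => e - (grad (π (x - p)) : RSpace n), lt_min hr hδ, fun x hx => ?_, fun x => ?_,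
    fun x hx y hy => ?_, fun x hx => ?_, fun x s => ?_⟩
  · have h1 : HasFDerivAt (fun x => x - p) (ContinuousLinearMap.id ℝ (RSpace n)) x :=
      (hasFDerivAt_id x).sub_const p
    have h2 : HasFDerivAt (fun x => inner ℝ e (x - p)) (innerSL ℝ e) x := by
      exact HasFDerivAt.comp x (innerSL ℝ e).hasFDerivAt h1
    have h3 : HasFDerivAt γ (fderiv ℝ γ (π (x - p))) (π (x - p)) :=
      ((hγC.contDiffAt (Metric.isOpen_ball.mem_nhds (hball x hx).1)).differentiableAt
        one_ne_zero).hasFDerivAt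
    have h4 : HasFDerivAt (fun x => γ (π (x - p))) ((fderiv ℝ γ (π (x - p))).comp π) x := by
      have h5 : HasFDerivAt (fun x => π (x - p)) π x := by
        exact HasFDerivAt.comp x π.hasFDerivAt h1
      exact HasFDerivAt.comp x h3 h5
    have h6 := h2.fun_sub h4
    have e6 : innerSL ℝ (e - (grad (π (x - p)) : RSpace n))
        = innerSL ℝ e - (fderiv ℝ γ (π (x - p))).comp π := by
      ext v
      have : inner ℝ (grad (π (x - p)) : RSpace n) v = fderiv ℝ γ (π (x - p)) (π v) := by
        rw [← InnerProductSpace.toDual_symm_apply]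
        exact (Submodule.inner_orthogonalProjectionOnto_eq_of_mem_left _ v).symm
      simp only [innerSL_apply_apply, inner_sub_left, this]
      rfl
    rw [e6]
    exact h6
  · have h1 : inner ℝ e (e - (grad (π (x - p)) : RSpace n)) = 1 := by
      rw [inner_sub_right, horth, real_inner_self_eq_norm_sq, he]
      norm_num
    have h2 := real_inner_le_norm e (e - (grad (π (x - p)) : RSpace n))
    rwa [h1, he, one_mul] at h2
  · have h1 : e - (grad (π (x - p)) : RSpace n) - (e - (grad (π (y - p)) : RSpace n))
        = ((grad (π (y - p)) - grad (π (x - p)) : V) : RSpace n) := by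
      push_cast
      abel
    have h3 : ‖((grad (π (y - p)) - grad (π (x - p)) : V) : RSpace n)‖
        = ‖fderiv ℝ γ (π (y - p)) - fderiv ℝ γ (π (x - p))‖ := by
      change ‖grad (π (y - p)) - grad (π (x - p))‖ = _
      have h4 := (InnerProductSpace.toDual ℝ V).symm.map_sub (fderiv ℝ γ (π (y - p)))
        (fderiv ℝ γ (π (x - p)))
      rw [← LinearIsometryEquiv.norm_map (InnerProductSpace.toDual ℝ V).symm, h4]
    rw [h1, h3]
    refine (hc _ (hball y hy).1 _ (hball x hx).1).trans ?_
    have h2 : ‖π (y - p) - π (x - p)‖ ≤ ‖x - y‖ := by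
      rw [← map_sub, norm_sub_rev x y]
      refine (hπn _).trans (le_of_eq ?_)
      congr 1
      abel
    exact mul_le_mul (le_abs_self c) (Real.rpow_le_rpow (norm_nonneg _) h2 hα.le)
      (by positivity) (abs_nonneg c)
  · have h := hmem _ (hball x hx).1 _ (hball x hx).2
    rw [hdec x] at h
    rw [h, sub_neg]
  · have h1 : x + s • e - p = (x - p) + s • e := by abel
    rw [h1, inner_add_right, map_add, map_smul, hπe, smul_zero, add_zero, inner_smul_right,
      real_inner_self_eq_norm_sq, he]
    ring

namespace IsLocalDefining

variable {p e : RSpace n} {ρ c : ℝ} {Φ : RSpace n → ℝ} {g : RSpace n → RSpace n}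

/-- Where Φ > 0 a whole neighbourhood misses Ω. Where Φ = 0, moving slightly along -e enters Ω,
since Φ changes at unit speed in that direction. -/
lemma mem_frontier_iff (h : IsLocalDefining α Ω p e ρ c Φ g) (hΩo : IsOpen Ω) {x : RSpace n}
    (hx : x ∈ Metric.ball p ρ) : x ∈ frontier Ω ↔ Φ x = 0 := by
  have hU : Metric.ball p ρ ∈ 𝓝 x := Metric.isOpen_ball.mem_nhds hx
  have hcont : ContinuousAt Φ x := (h.hasFDerivAt x hx).continuousAt
  rw [hΩo.frontier_eq, Set.mem_sdiff, h.mem_iff x hx, not_lt]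
  refine ⟨fun ⟨h1, h2⟩ => le_antisymm ?_ h2, fun h0 => ⟨?_, h0.ge⟩⟩
  · by_contra hlt
    have h3 : ∀ᶠ z in 𝓝 x, z ∉ Ω := by
      filter_upwards [hU, hcont.eventually (lt_mem_nhds (not_le.1 hlt))] with z hz1 hz2
      rw [h.mem_iff z hz1, not_lt]
      exact hz2.le
    rw [mem_closure_iff_frequently] at h1
    exact h1 h3
  · have ht : Tendsto (fun s : ℝ => x + s • e) (𝓝[<] 0) (𝓝 x) := by
      have : Continuous fun s : ℝ => x + s • e := by fun_prop
      simpa using (this.tendsto 0).mono_left nhdsWithin_le_nhds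
    refine mem_closure_of_tendsto ht ?_
    filter_upwards [ht.eventually hU, self_mem_nhdsWithin] with s hs1 hs2
    rw [h.mem_iff _ hs1, h.translate, h0, zero_add]
    exact hs2

lemma tendsto_line (h : IsLocalDefining α Ω p e ρ c Φ g) {x : RSpace n} (hx : x ∈ Metric.ball p ρ)
    (h0 : Φ x = 0) (v : RSpace n) :
    Tendsto (fun s : ℝ => s⁻¹ * Φ (x + s • v)) (𝓝[>] 0) (𝓝 (inner ℝ (g x) v)) := by
  have h1 : HasDerivAt (fun s : ℝ => x + s • v) v 0 := by
    simpa using ((hasDerivAt_id (0 : ℝ)).smul_const v).const_add x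
  have h2 : HasDerivAt (fun s : ℝ => Φ (x + s • v)) (inner ℝ (g x) v) 0 := by
    have h3 : HasFDerivAt Φ (innerSL ℝ (g x)) (x + (0 : ℝ) • v) := by
      simpa using h.hasFDerivAt x hx
    exact h3.comp_hasDerivAt 0 h1
  have := h2.tendsto_slope_zero_right
  simpa [h0] using this

lemma tendsto_add_smul (x v : RSpace n) : Tendsto (fun s : ℝ => x + s • v) (𝓝[>] 0) (𝓝 x) := by
  have : Continuous fun s : ℝ => x + s • v := by fun_prop
  simpa using (this.tendsto 0).mono_left nhdsWithin_le_nhds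

/-- If v is orthogonal to the gradient, then Φ(x + s v) = o(s). Correcting x + s v by -Φ(x + s v) e
lands exactly on the boundary, and the correction is lost in the limit of the secants. -/
lemma mem_tangentConeAt (h : IsLocalDefining α Ω p e ρ c Φ g) (hΩo : IsOpen Ω) {x : RSpace n}
    (hx : x ∈ Metric.ball p ρ) (h0 : Φ x = 0) {v : RSpace n} (hv : inner ℝ (g x) v = 0) :
    v ∈ tangentConeAt ℝ (frontier Ω) x := by
  have hU : Metric.ball p ρ ∈ 𝓝 x := Metric.isOpen_ball.mem_nhds hx
  have ht := h.tendsto_line hx h0 v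
  rw [hv] at ht
  have hs : Tendsto (fun s : ℝ => s) (𝓝[>] 0) (𝓝 0) := tendsto_id.mono_left nhdsWithin_le_nhds
  have hΦ : Tendsto (fun s : ℝ => Φ (x + s • v)) (𝓝[>] 0) (𝓝 0) := by
    have := ((h.hasFDerivAt x hx).continuousAt.tendsto).comp (tendsto_add_smul x v)
    rwa [h0] at this
  have hd : Tendsto (fun s : ℝ => s • v + (-Φ (x + s • v)) • e) (𝓝[>] 0) (𝓝 0) := by
    simpa using (hs.smul_const v).add (hΦ.neg.smul_const e)
  refine mem_tangentConeAt_of_seq (𝓝[>] (0 : ℝ)) (fun s => s⁻¹)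
    (fun s => s • v + (-Φ (x + s • v)) • e) hd ?_ ?_
  · have hd' : Tendsto (fun s : ℝ => x + (s • v + (-Φ (x + s • v)) • e)) (𝓝[>] 0) (𝓝 x) := by
      simpa using hd.const_add x
    filter_upwards [hd'.eventually hU] with s hs1
    rw [h.mem_frontier_iff hΩo hs1, ← add_assoc, h.translate]
    ring
  · have h2 : Tendsto (fun s : ℝ => v + (-(s⁻¹ * Φ (x + s • v))) • e) (𝓝[>] 0) (𝓝 v) := by
      simpa using (ht.neg.smul_const e).const_add v
    refine h2.congr' ?_
    filter_upwards [self_mem_nhdsWithin] with s hs1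
    have hs0 : s ≠ 0 := (Set.mem_Ioi.1 hs1).ne'
    rw [smul_add, smul_smul, smul_smul, inv_mul_cancel₀ hs0, one_smul, mul_neg]

/-- Φ vanishes on the boundary, so along it both the gradient of Φ and 0 are differentials, and
these agree on the tangent cone. -/
lemma inner_eq_zero (h : IsLocalDefining α Ω p e ρ c Φ g) (hΩo : IsOpen Ω) {x : RSpace n}
    (hx : x ∈ Metric.ball p ρ) (h0 : Φ x = 0) {v : RSpace n}
    (hv : v ∈ tangentConeAt ℝ (frontier Ω) x) : inner ℝ (g x) v = 0 := by
  have h1 : HasFDerivWithinAt Φ (innerSL ℝ (g x)) (frontier Ω) x :=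
    (h.hasFDerivAt x hx).hasFDerivWithinAt
  have h2 : HasFDerivWithinAt Φ (0 : RSpace n →L[ℝ] ℝ) (frontier Ω) x := by
    refine (hasFDerivWithinAt_const (0 : ℝ) x (frontier Ω)).congr_of_eventuallyEq ?_ h0
    filter_upwards [self_mem_nhdsWithin,
      mem_nhdsWithin_of_mem_nhds (Metric.isOpen_ball.mem_nhds hx)] with z hz1 hz2
    exact (h.mem_frontier_iff hΩo hz2).1 hz1
  simpa using h1.unique_on h2 hv

lemma eventually_mem (h : IsLocalDefining α Ω p e ρ c Φ g) {x : RSpace n}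
    (hx : x ∈ Metric.ball p ρ) (h0 : Φ x = 0) {v : RSpace n} (hv : inner ℝ (g x) v < 0) :
    ∀ᶠ s : ℝ in 𝓝[>] 0, x + s • v ∈ Ω := by
  filter_upwards [(h.tendsto_line hx h0 v).eventually (gt_mem_nhds hv), self_mem_nhdsWithin,
    (tendsto_add_smul x v).eventually (Metric.isOpen_ball.mem_nhds hx)] with s h1 h2 h3
  have hs : 0 < s := h2
  rw [h.mem_iff _ h3]
  exact neg_of_mul_neg_right h1 (by positivity)

lemma eventually_notMem_closure (h : IsLocalDefining α Ω p e ρ c Φ g) (hΩo : IsOpen Ω)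
    {x : RSpace n} (hx : x ∈ Metric.ball p ρ) (h0 : Φ x = 0) {v : RSpace n}
    (hv : 0 < inner ℝ (g x) v) : ∀ᶠ s : ℝ in 𝓝[>] 0, x + s • v ∉ closure Ω := by
  filter_upwards [(h.tendsto_line hx h0 v).eventually (lt_mem_nhds hv), self_mem_nhdsWithin,
    (tendsto_add_smul x v).eventually (Metric.isOpen_ball.mem_nhds hx)] with s h1 h2 h3 h4
  have hs : 0 < s := h2
  have hpos : 0 < Φ (x + s • v) := pos_of_mul_pos_right h1 (by positivity)
  by_cases hm : x + s • v ∈ Ω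
  · exact absurd ((h.mem_iff _ h3).1 hm) hpos.not_gt
  · have : x + s • v ∈ frontier Ω := by
      rw [hΩo.frontier_eq]
      exact ⟨h4, hm⟩
    exact hpos.ne' ((h.mem_frontier_iff hΩo h3).1 this)

/-- The component of v orthogonal to the gradient is itself a tangent vector, so it is orthogonal to
v and vanishes. Hence v is a unit multiple of the gradient; a negative multiple would point into Ω.
This makes the normal chosen in `outerNormal` an explicit Hölder function. -/
lemma isOuterUnitNormal_iff (h : IsLocalDefining α Ω p e ρ c Φ g) (hΩo : IsOpen Ω) {x : RSpace n}
    (hx : x ∈ Metric.ball p ρ) (h0 : Φ x = 0) {v : RSpace n} :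
    IsOuterUnitNormal Ω x v ↔ v = ‖g x‖⁻¹ • g x := by
  have hg : 0 < ‖g x‖ := one_pos.trans_le (h.one_le_norm x)
  constructor
  · intro hv
    set t : ℝ := (‖g x‖ ^ 2)⁻¹ * inner ℝ (g x) v with ht
    have h1 : inner ℝ (g x) (v - t • g x) = 0 := by
      rw [inner_sub_right, inner_smul_right, real_inner_self_eq_norm_sq, ht]
      field_simp
      ring
    have h2 := hv.orthogonal _ (h.mem_tangentConeAt hΩo hx h0 h1)
    have h3 : v - t • g x = 0 := by
      rw [← inner_self_eq_zero (𝕜 := ℝ), inner_sub_left (v) (t • g x) (v - t • g x),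
        inner_smul_left, h1, h2]
      simp
    have h4 : v = t • g x := sub_eq_zero.1 h3
    have h5 : |t| * ‖g x‖ = 1 := by
      rw [← hv.norm_eq, h4, norm_smul, Real.norm_eq_abs]
    have h6 : 0 ≤ t := by
      by_contra hneg
      have h7 : inner ℝ (g x) v < 0 := by
        rw [h4, inner_smul_right, real_inner_self_eq_norm_sq]
        exact mul_neg_of_neg_of_pos (not_le.1 hneg) (by positivity)
      obtain ⟨s, hs1, hs2⟩ := ((h.eventually_mem hx h0 h7).and hv.outward).exists
      exact hs2 (subset_closure hs1)
    rw [h4]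
    congr 1
    rw [abs_of_nonneg h6] at h5
    field_simp
    exact h5
  · rintro rfl
    refine ⟨?_, fun w hw => ?_, h.eventually_notMem_closure hΩo hx h0 ?_⟩
    · rw [norm_smul, norm_inv, norm_norm, inv_mul_cancel₀ hg.ne']
    · rw [inner_smul_left, h.inner_eq_zero hΩo hx h0 hw]
      simp
    · rw [inner_smul_right, real_inner_self_eq_norm_sq]
      positivity

lemma outerNormal_eq (h : IsLocalDefining α Ω p e ρ c Φ g) (hΩo : IsOpen Ω) {x : RSpace n}
    (hx : x ∈ Metric.ball p ρ) (h0 : Φ x = 0) : outerNormal Ω x = ‖g x‖⁻¹ • g x := by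
  have hex : ∃ v, IsOuterUnitNormal Ω x v := ⟨_, (h.isOuterUnitNormal_iff hΩo hx h0).2 rfl⟩
  rw [outerNormal, dif_pos hex]
  exact (h.isOuterUnitNormal_iff hΩo hx h0).1 hex.choose_spec

lemma norm_outerNormal_sub_le (h : IsLocalDefining α Ω p e ρ c Φ g) (hΩo : IsOpen Ω)
    {x y : RSpace n} (hx : x ∈ Metric.ball p ρ) (hx0 : Φ x = 0) (hy : y ∈ Metric.ball p ρ)
    (hy0 : Φ y = 0) : ‖outerNormal Ω x - outerNormal Ω y‖ ≤ 2 * c * ‖x - y‖ ^ α := by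
  rw [h.outerNormal_eq hΩo hx hx0, h.outerNormal_eq hΩo hy hy0]
  have hgx := h.one_le_norm x
  have hgy := h.one_le_norm y
  have e1 : ‖g x‖⁻¹ • g x - ‖g y‖⁻¹ • g y
      = ‖g x‖⁻¹ • (g x - g y) + (‖g x‖⁻¹ * (‖g y‖ - ‖g x‖)) • ‖g y‖⁻¹ • g y := by
    have : ‖g x‖⁻¹ * (‖g y‖ - ‖g x‖) * ‖g y‖⁻¹ = ‖g x‖⁻¹ - ‖g y‖⁻¹ := by
      field_simp
    rw [smul_smul, this, smul_sub, sub_smul]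
    abel
  have hinv : ‖g x‖⁻¹ ≤ 1 := inv_le_one_of_one_le₀ hgx
  have e2 : ‖‖g y‖⁻¹ • g y‖ = 1 := by
    rw [norm_smul, norm_inv, norm_norm, inv_mul_cancel₀ (by linarith)]
  have e3 : |‖g y‖ - ‖g x‖| ≤ ‖g x - g y‖ := by
    rw [norm_sub_rev]
    exact abs_norm_sub_norm_le _ _
  calc ‖‖g x‖⁻¹ • g x - ‖g y‖⁻¹ • g y‖
      ≤ ‖g x‖⁻¹ * ‖g x - g y‖ + ‖g x‖⁻¹ * |‖g y‖ - ‖g x‖| := by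
        rw [e1]
        refine (norm_add_le _ _).trans (le_of_eq ?_)
        rw [norm_smul, norm_smul _ (‖g y‖⁻¹ • g y), e2, norm_inv, norm_norm, Real.norm_eq_abs,
          abs_mul, abs_inv, abs_norm, mul_one]
    _ ≤ 1 * ‖g x - g y‖ + 1 * ‖g x - g y‖ := by gcongr
    _ ≤ 2 * c * ‖x - y‖ ^ α := by linarith [h.holder x hx y hy]

/-- Since Φ(x) = Φ(y) = 0, the linear part g(y)·(x - y) equals the error of linearisation. On the
segment this is at most the oscillation of g, of order |x - y|^α, times |x - y|. -/
lemma abs_inner_outerNormal_le (h : IsLocalDefining α Ω p e ρ c Φ g) (hα : 0 < α) (hΩo : IsOpen Ω)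
    {x y : RSpace n} (hx : x ∈ Metric.ball p ρ) (hx0 : Φ x = 0) (hy : y ∈ Metric.ball p ρ)
    (hy0 : Φ y = 0) : |inner ℝ (outerNormal Ω y) (x - y)| ≤ |c| * ‖x - y‖ ^ (1 + α) := by
  by_cases hxy : x = y
  · simp only [hxy, sub_self, inner_zero_right, abs_zero]
    positivity
  have hd : 0 < ‖x - y‖ := norm_pos_iff.2 (sub_ne_zero.2 hxy)
  have hgy := h.one_le_norm y
  have hseg : segment ℝ y x ⊆ Metric.ball p ρ := (convex_ball p ρ).segment_subset hy hx
  have h1 := Convex.norm_image_sub_le_of_norm_hasFDerivWithin_le' (𝕜 := ℝ) (f := Φ)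
    (C := |c| * ‖x - y‖ ^ α) (s := segment ℝ y x) (x := y) (y := x)
    (f' := fun z => innerSL ℝ (g z)) (φ := innerSL ℝ (g y))
    (fun z hz => (h.hasFDerivAt z (hseg hz)).hasFDerivWithinAt)
    (fun z hz => ?_) (convex_segment y x) (left_mem_segment ℝ y x) (right_mem_segment ℝ y x)
  · rw [hx0, hy0, sub_zero, zero_sub, norm_neg, innerSL_apply_apply, Real.norm_eq_abs] at h1
    rw [h.outerNormal_eq hΩo hy hy0, inner_smul_left, abs_mul, Real.rpow_add hd, Real.rpow_one]
    have hinv : |‖g y‖⁻¹| ≤ 1 := by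
      rw [abs_inv, abs_norm]
      exact inv_le_one_of_one_le₀ hgy
    calc |(starRingEnd ℝ) ‖g y‖⁻¹| * |inner ℝ (g y) (x - y)|
        ≤ 1 * (|c| * ‖x - y‖ ^ α * ‖x - y‖) := by
          refine mul_le_mul hinv h1 (abs_nonneg _) zero_le_one
      _ = _ := by ring
  · have h2 : ‖z - y‖ ≤ ‖x - y‖ := by
      obtain ⟨a, b, ha, hb, hab, rfl⟩ := hz
      have : a • y + b • x - y = b • (x - y) := by
        rw [show a = 1 - b by linarith, sub_smul, smul_sub, one_smul]
        abel
      rw [this, norm_smul, Real.norm_eq_abs, abs_of_nonneg hb]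
      have hb1 : b ≤ 1 := by linarith
      nlinarith
    rw [← map_sub, innerSL_apply_norm]
    refine (h.holder z (hseg hz) y hy).trans ?_
    exact mul_le_mul (le_abs_self c) (Real.rpow_le_rpow (norm_nonneg _) h2 hα.le)
      (by positivity) (abs_nonneg c)

end IsLocalDefining

lemma norm_outerNormal (hα : 0 < α) (hΩo : IsOpen Ω) (hΩ : IsOfClassC1Holder α Ω) {x : RSpace n}
    (hx : x ∈ frontier Ω) : ‖outerNormal Ω x‖ = 1 := by
  obtain ⟨e, ρ, c, Φ, g, h⟩ := exists_isLocalDefining hα hΩ hx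
  have hxb := Metric.mem_ball_self (x := x) h.pos
  have h0 := (h.mem_frontier_iff hΩo hxb).1 hx
  rw [h.outerNormal_eq hΩo hxb h0]
  exact ((h.isOuterUnitNormal_iff hΩo hxb h0).2 rfl).norm_eq

lemma inner_outerNormal_eq_zero_iff (hα : 0 < α) (hΩo : IsOpen Ω) (hΩ : IsOfClassC1Holder α Ω)
    {x : RSpace n} (hx : x ∈ frontier Ω) {v : RSpace n} :
    inner ℝ (outerNormal Ω x) v = 0 ↔ v ∈ tangentConeAt ℝ (frontier Ω) x := by
  obtain ⟨e, ρ, c, Φ, g, h⟩ := exists_isLocalDefining hα hΩ hx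
  have hxb := Metric.mem_ball_self (x := x) h.pos
  have h0 := (h.mem_frontier_iff hΩo hxb).1 hx
  have hg : ‖g x‖ ≠ 0 := (one_pos.trans_le (h.one_le_norm x)).ne'
  rw [h.outerNormal_eq hΩo hxb h0]
  refine ⟨fun hv => h.mem_tangentConeAt hΩo hxb h0 ?_, fun hv => ?_⟩
  · rw [inner_smul_left] at hv
    simpa [hg] using hv
  · rw [inner_smul_left, h.inner_eq_zero hΩo hxb h0 hv]
    simp

/-- The outer normal of a bounded domain of class `C^{1,α}` is `α`-Hölder continuous, and
the boundary deviates from its tangent planes with order `1 + α`. -/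
lemma exists_boundary_estimates (hα : 0 < α) (hΩo : IsOpen Ω) (hΩb : Bornology.IsBounded Ω)
    (hΩ : IsOfClassC1Holder α Ω) :
    ∃ c, 0 ≤ c ∧ ∀ x ∈ frontier Ω, ∀ y ∈ frontier Ω,
      ‖outerNormal Ω x - outerNormal Ω y‖ ≤ c * ‖x - y‖ ^ α ∧
      |inner ℝ (outerNormal Ω y) (x - y)| ≤ c * ‖x - y‖ ^ (1 + α) := by
  have hcomp : IsCompact (frontier Ω) :=
    Metric.isCompact_of_isClosed_isBounded isClosed_frontier
      (hΩb.closure.subset frontier_subset_closure)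
  suffices H : ∃ c, 0 ≤ c ∧ ∀ q ∈ frontier Ω ×ˢ frontier Ω, q.1 ∈ frontier Ω → q.2 ∈ frontier Ω →
      ‖outerNormal Ω q.1 - outerNormal Ω q.2‖ ≤ c * ‖q.1 - q.2‖ ^ α ∧
      |inner ℝ (outerNormal Ω q.2) (q.1 - q.2)| ≤ c * ‖q.1 - q.2‖ ^ (1 + α) by
    obtain ⟨c, hc0, hc⟩ := H
    exact ⟨c, hc0, fun x hx y hy => hc (x, y) ⟨hx, hy⟩ hx hy⟩
  refine (hcomp.prod hcomp).induction_on (p := fun s => ∃ c, 0 ≤ c ∧ ∀ q ∈ s,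
    q.1 ∈ frontier Ω → q.2 ∈ frontier Ω →
      ‖outerNormal Ω q.1 - outerNormal Ω q.2‖ ≤ c * ‖q.1 - q.2‖ ^ α ∧
      |inner ℝ (outerNormal Ω q.2) (q.1 - q.2)| ≤ c * ‖q.1 - q.2‖ ^ (1 + α)) ?_ ?_ ?_ ?_
  · exact ⟨0, le_rfl, by simp⟩
  · rintro s t hst ⟨c, hc0, hc⟩
    exact ⟨c, hc0, fun q hq => hc q (hst hq)⟩
  · rintro s t ⟨c, hc0, hc⟩ ⟨d, hd0, hd⟩
    refine ⟨c + d, add_nonneg hc0 hd0, fun q hq h1 h2 => ?_⟩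
    have e1 : 0 ≤ ‖q.1 - q.2‖ ^ α := by positivity
    have e2 : 0 ≤ ‖q.1 - q.2‖ ^ (1 + α) := by positivity
    rcases hq with hq | hq
    · obtain ⟨h3, h4⟩ := hc q hq h1 h2
      exact ⟨h3.trans (by nlinarith), h4.trans (by nlinarith)⟩
    · obtain ⟨h3, h4⟩ := hd q hq h1 h2
      exact ⟨h3.trans (by nlinarith), h4.trans (by nlinarith)⟩
  · rintro ⟨x, y⟩ ⟨hx, hy⟩
    simp only at hx hy
    -- The product of the boundary with itself is compact, so local bounds suffice. Near the
    -- diagonal a single defining function serves both points; elsewhere |x - y| is bounded below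
    -- and unit normals give a trivial bound.
    by_cases hxy : x = y
    · subst hxy
      obtain ⟨e, ρ, c, Φ, g, h⟩ := exists_isLocalDefining hα hΩ hx
      refine ⟨Metric.ball x ρ ×ˢ Metric.ball x ρ, mem_nhdsWithin_of_mem_nhds
        (prod_mem_nhds (Metric.ball_mem_nhds x h.pos) (Metric.ball_mem_nhds x h.pos)), 2 * |c|,
        by positivity, fun q hq h1 h2 => ?_⟩
      have h1' := (h.mem_frontier_iff hΩo hq.1).1 h1
      have h2' := (h.mem_frontier_iff hΩo hq.2).1 h2
      have e1 : 0 ≤ ‖q.1 - q.2‖ ^ α := by positivity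
      have e2 : 0 ≤ ‖q.1 - q.2‖ ^ (1 + α) := by positivity
      refine ⟨(h.norm_outerNormal_sub_le hΩo hq.1 h1' hq.2 h2').trans ?_,
        (h.abs_inner_outerNormal_le hα hΩo hq.1 h1' hq.2 h2').trans ?_⟩
      · have := le_abs_self c
        gcongr
      · have := abs_nonneg c
        gcongr
        linarith
    · have hd : 0 < ‖x - y‖ := norm_pos_iff.2 (sub_ne_zero.2 hxy)
      have hcont : Continuous fun q : RSpace n × RSpace n => ‖q.1 - q.2‖ := by fun_prop
      refine ⟨{q | ‖x - y‖ / 2 < ‖q.1 - q.2‖}, mem_nhdsWithin_of_mem_nhds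
        ((isOpen_lt continuous_const hcont).mem_nhds (show ‖x - y‖ / 2 < ‖x - y‖ by linarith)),
        2 * ((‖x - y‖ / 2) ^ α)⁻¹, by positivity, fun q hq h1 h2 => ?_⟩
      have hq' : ‖x - y‖ / 2 < ‖q.1 - q.2‖ := hq
      have hq0 : 0 < ‖q.1 - q.2‖ := by linarith
      have h3 : 1 ≤ ((‖x - y‖ / 2) ^ α)⁻¹ * ‖q.1 - q.2‖ ^ α := by
        rw [← div_eq_inv_mul, one_le_div (by positivity)]
        exact Real.rpow_le_rpow (by positivity) hq'.le hα.le
      have n1 := norm_outerNormal hα hΩo hΩ h1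
      have n2 := norm_outerNormal hα hΩo hΩ h2
      constructor
      · refine (norm_sub_le _ _).trans ?_
        rw [n1, n2]
        linarith
      · refine (abs_real_inner_le_norm _ _).trans ?_
        rw [n2, one_mul, Real.rpow_add hq0, Real.rpow_one]
        nlinarith

end Boundary

end

noncomputable section

/-! ### The tangential gradient of the double layer kernel -/

section TangentialGradient

variable {n : ℕ} {α : ℝ} {Ω : Set (RSpace n)} {x : RSpace n}

/-- The tangential part of a vector, as a linear form in each component. -/
def tangentialPartL (Ω : Set (RSpace n)) (x : RSpace n) (h : Fin n) : (Fin n → ℂ) →ₗ[ℂ] ℂ where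
  toFun F := tangentialPart Ω x F h
  map_add' F F' := by
    simp only [tangentialPart, Pi.add_apply, ← Finset.sum_add_distrib]
    exact Finset.sum_congr rfl fun l _ => by ring
  map_smul' c F := by
    simp only [tangentialPart, Pi.smul_apply, smul_eq_mul, Finset.mul_sum, RingHom.id_apply]
    exact Finset.sum_congr rfl fun l _ => by ring

lemma tangentialPartL_apply (h : Fin n) (F : Fin n → ℂ) :
    tangentialPartL Ω x h F = tangentialPart Ω x F h := rfl

/-- `v ↦ v a⁽²⁾ w` as a linear form. -/
def rowMatColL (a : (Fin n → ℕ) → ℂ) (w : RSpace n) : (Fin n → ℂ) →ₗ[ℂ] ℂ where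
  toFun v := rowMatCol a v w
  map_add' v v' := by
    simp only [rowMatCol, Pi.add_apply, ← Finset.sum_add_distrib]
    exact Finset.sum_congr rfl fun l _ => Finset.sum_congr rfl fun j _ => by ring
  map_smul' c v := by
    simp only [rowMatCol, Pi.smul_apply, smul_eq_mul, Finset.mul_sum, RingHom.id_apply]
    exact Finset.sum_congr rfl fun l _ => Finset.sum_congr rfl fun j _ => by ring

lemma rowMatColL_apply (a : (Fin n → ℕ) → ℂ) (v : Fin n → ℂ) (w : RSpace n) :
    rowMatColL a w v = rowMatCol a v w := rfl

lemma sum_outerNormal_sq (hν : ‖outerNormal Ω x‖ = 1) :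
    ∑ l, (outerNormal Ω x l : ℂ) * (outerNormal Ω x l : ℂ) = 1 := by
  have h := EuclideanSpace.real_norm_sq_eq (outerNormal Ω x)
  rw [hν] at h
  have h' := congrArg (fun r : ℝ => (r : ℂ)) h
  push_cast at h'
  simp only [← pow_two]
  rw [← h']
  norm_num

lemma tangentialPart_eq (hν : ‖outerNormal Ω x‖ = 1) (F : Fin n → ℂ) (h : Fin n) :
    tangentialPart Ω x F h
      = F h - (outerNormal Ω x h : ℂ) * ∑ l, (outerNormal Ω x l : ℂ) * F l := by
  simp only [tangentialPart, mul_sub, Finset.sum_sub_distrib, Finset.mul_sum]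
  congr 1
  · simp only [← mul_assoc, ← Finset.sum_mul, sum_outerNormal_sq hν, one_mul]
  · exact Finset.sum_congr rfl fun l _ => by ring

lemma sum_outerNormal_mul_tangentialPart (hν : ‖outerNormal Ω x‖ = 1) (F : Fin n → ℂ) :
    ∑ h, (outerNormal Ω x h : ℂ) * tangentialPart Ω x F h = 0 := by
  simp only [tangentialPart_eq hν, mul_sub, Finset.sum_sub_distrib, ← mul_assoc, ← Finset.sum_mul,
    sum_outerNormal_sq hν]
  ring

lemma eq_sum_smul_single (v : RSpace n) : v = ∑ j, v j • EuclideanSpace.single j (1 : ℝ) := by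
  ext i
  simp [Finset.sum_apply, Pi.single_apply]

lemma fderiv_eq_pairing (f : RSpace n → ℂ) (x : RSpace n) :
    fderiv ℝ f x = pairing fun l => partialD l f x := by
  ext v
  conv_lhs => rw [eq_sum_smul_single v]
  rw [← cpair_eq_pairing, map_sum, cpair]
  refine Finset.sum_congr rfl fun j _ => ?_
  rw [map_smul, Complex.real_smul, mul_comm]
  rfl

lemma pairing_apply_ofReal (v : Fin n → ℂ) (w : RSpace n) :
    pairing v w = ∑ l, v l * (w l : ℂ) := (cpair_eq_pairing v w).symm

lemma inner_eq_sum (v w : RSpace n) : inner ℝ v w = ∑ l, v l * w l := by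
  rw [PiLp.inner_apply]
  simp [mul_comm]

/-- Along the boundary, the zero function is differentiable with differential `⟨ν, ·⟩`. -/
lemma hasFDerivWithinAt_zero_outerNormal (hα : 0 < α) (hΩo : IsOpen Ω)
    (hΩ : IsOfClassC1Holder α Ω) (hx : x ∈ frontier Ω) :
    HasFDerivWithinAt (fun _ : RSpace n => (0 : ℝ)) (innerSL ℝ (outerNormal Ω x))
      (frontier Ω) x := by
  obtain ⟨e, ρ, c, Φ, g, h⟩ := exists_isLocalDefining hα hΩ hx
  have hxb := Metric.mem_ball_self (x := x) h.pos
  have h0 := (h.mem_frontier_iff hΩo hxb).1 hx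
  rw [h.outerNormal_eq hΩo hxb h0, map_smul]
  have h1 : HasFDerivWithinAt (fun _ : RSpace n => (0 : ℝ)) (innerSL ℝ (g x)) (frontier Ω) x := by
    refine (h.hasFDerivAt x hxb).hasFDerivWithinAt.congr_of_eventuallyEq ?_ h0.symm
    filter_upwards [self_mem_nhdsWithin,
      mem_nhdsWithin_of_mem_nhds (Metric.ball_mem_nhds x h.pos)] with z hz1 hz2
    exact ((h.mem_frontier_iff hΩo hz2).1 hz1).symm
  have h2 := h1.const_smul ‖g x‖⁻¹
  have e2 : ‖g x‖⁻¹ • (fun _ : RSpace n => (0 : ℝ)) = fun _ => 0 := by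
    ext
    simp
  rwa [e2] at h2

/-- Differentials along the boundary are determined only up to multiples of ⟨ν, ·⟩, because the zero
function admits that differential. Subtracting the normal component of the full gradient is
therefore harmless. -/
lemma hasTangentialGradientAt_tangentialPart (hα : 0 < α) (hΩo : IsOpen Ω)
    (hΩ : IsOfClassC1Holder α Ω) (hx : x ∈ frontier Ω) {f : RSpace n → ℂ}
    (hf : DifferentiableAt ℝ f x) :
    HasTangentialGradientAt Ω f x (tangentialPart Ω x fun l => partialD l f x) := by
  have hν := norm_outerNormal hα hΩo hΩ hx
  refine ⟨sum_outerNormal_mul_tangentialPart hν _, ?_⟩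
  set t : ℂ := ∑ l, (outerNormal Ω x l : ℂ) * partialD l f x
  have h1 : HasFDerivWithinAt f (fderiv ℝ f x) (frontier Ω) x := hf.hasFDerivAt.hasFDerivWithinAt
  have h2 : HasFDerivWithinAt (fun _ : RSpace n => (0 : ℝ) • t)
      ((innerSL ℝ (outerNormal Ω x)).smulRight t) (frontier Ω) x :=
    (hasFDerivWithinAt_zero_outerNormal hα hΩo hΩ hx).smul_const t
  have h3 := h1.fun_sub h2
  have e : pairing (tangentialPart Ω x fun l => partialD l f x)
      = fderiv ℝ f x - (innerSL ℝ (outerNormal Ω x)).smulRight t := by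
    ext w
    rw [fderiv_eq_pairing, sub_apply, ContinuousLinearMap.smulRight_apply, innerSL_apply_apply,
      pairing_apply_ofReal, pairing_apply_ofReal, inner_eq_sum, Complex.real_smul]
    simp only [tangentialPart_eq hν, sub_mul, Finset.sum_sub_distrib, Complex.ofReal_sum,
      Complex.ofReal_mul, Finset.sum_mul]
    congr 1
    exact Finset.sum_congr rfl fun l _ => by ring
  rw [e]
  simpa using h3

/-- The differential is determined on the tangent cone, which is the orthogonal complement of ν, and
tangency fixes its value on ν. -/
lemma HasTangentialGradientAt.unique (hα : 0 < α) (hΩo : IsOpen Ω)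
    (hΩ : IsOfClassC1Holder α Ω) (hx : x ∈ frontier Ω) {f : RSpace n → ℂ} {v w : Fin n → ℂ}
    (hv : HasTangentialGradientAt Ω f x v) (hw : HasTangentialGradientAt Ω f x w) : v = w := by
  have hν := norm_outerNormal hα hΩo hΩ hx
  have h1 := hv.differential.unique_on hw.differential
  have hN : ∀ u : Fin n → ℂ, ∑ l, (outerNormal Ω x l : ℂ) * u l = 0 →
      pairing u (outerNormal Ω x) = 0 := by
    intro u hu
    rw [pairing_apply_ofReal, ← hu]
    exact Finset.sum_congr rfl fun l _ => mul_comm _ _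
  ext j
  rw [← pairing_single v j, ← pairing_single w j]
  set e : RSpace n := EuclideanSpace.single j 1
  have h2 : e - inner ℝ (outerNormal Ω x) e • outerNormal Ω x
      ∈ tangentConeAt ℝ (frontier Ω) x := by
    rw [← inner_outerNormal_eq_zero_iff hα hΩo hΩ hx, inner_sub_right, inner_smul_right,
      real_inner_self_eq_norm_sq, hν]
    ring
  have h3 := h1 h2
  rw [map_sub, map_sub, map_smul, map_smul, hN v hv.tangent, hN w hw.tangent] at h3
  simpa using h3

lemma tangentialGradient_eq (hα : 0 < α) (hΩo : IsOpen Ω) (hΩ : IsOfClassC1Holder α Ω)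
    (hx : x ∈ frontier Ω) {f : RSpace n → ℂ} (hf : DifferentiableAt ℝ f x) :
    tangentialGradient Ω f x = tangentialPart Ω x fun l => partialD l f x := by
  have h := hasTangentialGradientAt_tangentialPart hα hΩo hΩ hx hf
  have hex : ∃ v, HasTangentialGradientAt Ω f x v := ⟨_, h⟩
  rw [tangentialGradient, dif_pos hex]
  exact hex.choose_spec.unique hα hΩo hΩ hx h

end TangentialGradient

/-! ### First derivatives of the kernel and second derivatives of the fundamental solution. -/

section Kernel

variable {n : ℕ} {Ω : Set (RSpace n)} {a : (Fin n → ℕ) → ℂ} {S : RSpace n → ℂ}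

lemma doubleLayerKernel_eq (x y : RSpace n) :
    doubleLayerKernel Ω a S x y
      = -rowMatCol a (fun j => partialD j S (x - y)) (outerNormal Ω y)
        - (∑ l, (outerNormal Ω y l : ℂ) * coeffOne a l) * S (x - y) := by
  rw [doubleLayerKernel, rowMatCol, Finset.sum_comm, Finset.sum_mul]
  congr 2
  exact Finset.sum_congr rfl fun l _ => Finset.sum_congr rfl fun j _ => by ring

lemma differentiableAt_rowMatCol {V : Fin n → RSpace n → ℂ} {x : RSpace n} (w : RSpace n)
    (hV : ∀ j, DifferentiableAt ℝ (V j) x) :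
    DifferentiableAt ℝ (fun x => rowMatCol a (fun j => V j x) w) x := by
  simp only [rowMatCol]
  exact DifferentiableAt.fun_sum fun j _ => DifferentiableAt.fun_sum fun z _ =>
    ((hV j).mul_const _).mul_const _

lemma partialD_rowMatCol {V : Fin n → RSpace n → ℂ} {x : RSpace n} (w : RSpace n)
    (hV : ∀ j, DifferentiableAt ℝ (V j) x) (l : Fin n) :
    partialD l (fun x => rowMatCol a (fun j => V j x) w) x
      = rowMatCol a (fun j => partialD l (V j) x) w := by
  have e : (fun x => rowMatCol a (fun j => V j x) w)
      = fun x => ∑ j, ∑ z, coeffTwo a j z * (w z : ℂ) * V j x := by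
    ext x
    exact Finset.sum_congr rfl fun j _ => Finset.sum_congr rfl fun z _ => by ring
  rw [e, partialD_sum _ l fun j _ => DifferentiableAt.fun_sum fun z _ => (hV j).const_mul _,
    rowMatCol]
  refine Finset.sum_congr rfl fun j _ => ?_
  rw [partialD_sum _ l fun z _ => (hV j).const_mul _]
  refine Finset.sum_congr rfl fun z _ => ?_
  rw [partialD_const_mul l _ (hV j)]
  ring

lemma differentiableAt_doubleLayerKernel (hS : ∀ x, x ≠ 0 → AnalyticAt ℝ S x) {x y : RSpace n}
    (hxy : x ≠ y) : DifferentiableAt ℝ (fun x' => doubleLayerKernel Ω a S x' y) x := by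
  have hw : x - y ≠ 0 := sub_ne_zero.2 hxy
  simp only [doubleLayerKernel_eq]
  have h1 : ∀ f : RSpace n → ℂ, AnalyticAt ℝ f (x - y) →
      DifferentiableAt ℝ (fun x => f (x - y)) x := fun f hf =>
    DifferentiableAt.comp x hf.differentiableAt (differentiableAt_id.sub_const y)
  exact (differentiableAt_rowMatCol _ fun j => h1 _ (analyticAt_partialD (hS _ hw) j)).fun_neg.fun_sub
    ((h1 _ (hS _ hw)).const_mul _)

lemma partialD_doubleLayerKernel (hS : ∀ x, x ≠ 0 → AnalyticAt ℝ S x) {x y : RSpace n}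
    (hxy : x ≠ y) (l : Fin n) :
    partialD l (fun x' => doubleLayerKernel Ω a S x' y) x
      = -rowMatCol a (fun j => partialD l (partialD j S) (x - y)) (outerNormal Ω y)
        - (∑ l, (outerNormal Ω y l : ℂ) * coeffOne a l) * partialD l S (x - y) := by
  have hw : x - y ≠ 0 := sub_ne_zero.2 hxy
  obtain ⟨F, hF⟩ : ∃ F : RSpace n → ℂ, F = fun w =>
      (-1 : ℂ) * rowMatCol a (fun j => partialD j S w) (outerNormal Ω y)
        - (∑ l, (outerNormal Ω y l : ℂ) * coeffOne a l) * S w := ⟨_, rfl⟩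
  have e : (fun x' => doubleLayerKernel Ω a S x' y) = fun x' => F (x' - y) := by
    ext x'
    rw [doubleLayerKernel_eq, hF]
    ring
  have hd := fun j => (analyticAt_partialD (hS _ hw) j).differentiableAt
  have hr := differentiableAt_rowMatCol (a := a) (outerNormal Ω y) hd
  rw [e, partialD_comp_sub, hF, partialD_sub l (hr.const_mul _) ((hS _ hw).differentiableAt.const_mul _),
    partialD_const_mul l _ hr, partialD_const_mul l _ (hS _ hw).differentiableAt,
    partialD_rowMatCol _ hd]
  ring

variable {T : Matrix (Fin n) (Fin n) ℝ} {A₁ : RSpace n × ℝ → ℂ} {b₀ : ℂ} {B₁ C : RSpace n → ℂ}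
  {A₂ : RSpace n × ℝ → Fin n → ℂ}

lemma IsExpansion.analyticAt (hE : IsExpansion a S T A₁ b₀ B₁ C) {x : RSpace n} (hx : x ≠ 0) :
    AnalyticAt ℝ S x := by
  refine ((((analyticAt_leadingTerm hE.isUnit hx).fun_add ((analyticAt_norm_zpow hx
    (3 - (n : ℤ))).fun_mul (hE.analytic_A.comp_polar hx))).fun_add
    (((hE.analytic_B x trivial).fun_add
      (analyticAt_const (v := b₀ * (if n = 2 then 0 else 1)))).fun_mul
    (analyticAt_log_norm hx))).fun_add (hE.analytic_C x trivial)).congr ?_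
  filter_upwards [eventually_ne_zero hx] with y hy
  rw [hE.expansion y hy, leadingTerm, sqrt_det_eq hE.factor]

/-- The second derivatives of the fundamental solution. -/
lemma partialD_partialD_of_expansion (hE : IsExpansion a S T A₁ b₀ B₁ C)
    (hG : IsGradientExpansion a S T B₁ C A₂) {w : RSpace n} (hw : w ≠ 0) (l j : Fin n) :
    partialD l (partialD j S) w
      = (1 / (sphereArea n * √(realCoeffTwo a).det) : ℝ)
          * (((-(n : ℤ) : ℤ) * ‖invApply T w‖ ^ (-(n : ℤ) - 2) * invForm (realCoeffTwo a) w l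
              * invForm (realCoeffTwo a) w j
            + ‖invApply T w‖ ^ (-(n : ℤ)) * (realCoeffTwo a)⁻¹ l j : ℝ) : ℂ)
        + ((‖w‖ ^ (1 - (n : ℤ)) : ℝ) : ℂ)
          * polarDer (2 - (n : ℤ)) l (fun p => A₂ p j) (polar w)
        + (partialD l (partialD j B₁) w * (Real.log ‖w‖ : ℂ)
          + partialD j B₁ w * ((w l / ‖w‖ ^ 2 : ℝ) : ℂ))
        + partialD l (partialD j C) w := by
  have hT := hE.isUnit
  have hA := hE.factor
  have hAj : IsAnalyticNearSphere fun p => A₂ p j := fun p hp =>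
    analyticAt_pi_iff.1 (hG.analytic_A p hp) j
  have e : partialD j S =ᶠ[𝓝 w] fun x =>
      ((1 / (sphereArea n * √(realCoeffTwo a).det) : ℝ) : ℂ)
        * (((‖invApply T x‖ ^ (-(n : ℤ)) : ℝ) : ℂ) * (invForm (realCoeffTwo a) x j : ℂ))
      + ((‖x‖ ^ (2 - (n : ℤ)) : ℝ) : ℂ) * A₂ (polar x) j
      + partialD j B₁ x * (Real.log ‖x‖ : ℂ) + partialD j C x := by
    filter_upwards [eventually_ne_zero hw] with y hy
    rw [hG.expansion y hy j, ← Complex.ofReal_mul, ← Complex.ofReal_mul, invForm, mul_assoc]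
  have d1 := (analyticAt_norm_invApply_zpow hT hw (-(n : ℤ))).differentiableAt
  have d2 : DifferentiableAt ℝ (fun x => (invForm (realCoeffTwo a) x j : ℂ)) w :=
    (hasFDerivAt_invForm (realCoeffTwo a) j w).ofReal_comp'.differentiableAt
  have d3 := (analyticAt_norm_zpow hw (2 - (n : ℤ))).differentiableAt.fun_mul
    (hAj.comp_polar hw).differentiableAt
  have d4 := (analyticAt_partialD (hE.analytic_B w trivial) j).differentiableAt
  have d5 := (analyticAt_log_norm hw).differentiableAt
  have d6 := (analyticAt_partialD (hE.analytic_C w trivial) j).differentiableAt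
  rw [e.partialD_eq,
    partialD_add l ((((d1.fun_mul d2).const_mul _).fun_add d3).fun_add (d4.fun_mul d5)) d6,
    partialD_add l (((d1.fun_mul d2).const_mul _).fun_add d3) (d4.fun_mul d5),
    partialD_add l ((d1.fun_mul d2).const_mul _) d3, partialD_const_mul l _ (d1.fun_mul d2),
    partialD_mul l d1 d2, partialD_mul l d4 d5, partialD_log_norm hw,
    partialD_norm_invApply_zpow hT hA hw, partialD_invForm,
    partialD_zpow_mul_polar hw _ (hAj _ (polar_mem hw)).differentiableAt,
    show (2 : ℤ) - n - 1 = 1 - n by ring]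
  push_cast
  ring

end Kernel

end

noncomputable section

/-! ### The nine-term formula. -/

section Formula

variable {n : ℕ} {Ω : Set (RSpace n)} {a : (Fin n → ℕ) → ℂ} {S : RSpace n → ℂ}
  {T : Matrix (Fin n) (Fin n) ℝ} {A₁ : RSpace n × ℝ → ℂ} {b₀ : ℂ} {B₁ C : RSpace n → ℂ}
  {A₂ : RSpace n × ℝ → Fin n → ℂ}

/-- The matrix a⁽²⁾ of the conormal derivative cancels the inverse in the leading part of `DS`. What
remains is w·ν(y), the quantity that is small on the boundary. -/
lemma rowMatCol_invForm (har : HasRealPrincipalPart a) (hT : IsUnit T)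
    (hA : realCoeffTwo a = T * T.transpose) (w v : RSpace n) :
    rowMatCol a (fun j => (invForm (realCoeffTwo a) w j : ℂ)) v = ((∑ i, w i * v i : ℝ) : ℂ) := by
  rw [rowMatCol, Finset.sum_comm, Complex.ofReal_sum]
  refine Finset.sum_congr rfl fun z _ => ?_
  rw [← Finset.sum_mul, Complex.ofReal_mul, ← sum_mul_invForm hT hA w z, Complex.ofReal_sum]
  congr 1
  refine Finset.sum_congr rfl fun j _ => ?_
  rw [coeffTwo_eq_ofReal har, Complex.ofReal_mul, mul_comm]

lemma rowMatCol_inv (har : HasRealPrincipalPart a) (hT : IsUnit T)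
    (hA : realCoeffTwo a = T * T.transpose) (l : Fin n) (v : RSpace n) :
    rowMatCol a (fun j => ((realCoeffTwo a)⁻¹ l j : ℂ)) v = (v l : ℂ) := by
  have hu : IsUnit (realCoeffTwo a).det := factor_isUnit_det hT hA
  have hM : ∀ z : Fin n, ∑ j, ((realCoeffTwo a)⁻¹ l j : ℂ) * coeffTwo a j z
      = if l = z then 1 else 0 := by
    intro z
    have h := congrFun (congrFun (Matrix.nonsing_inv_mul _ hu) l) z
    rw [Matrix.mul_apply, Matrix.one_apply] at h
    have h' := congrArg (fun r : ℝ => (r : ℂ)) h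
    push_cast at h'
    simp only [coeffTwo_eq_ofReal har]
    rw [h']
    split_ifs <;> simp
  rw [rowMatCol, Finset.sum_comm]
  simp only [← Finset.sum_mul, hM]
  simp

lemma fderiv_component {A : RSpace n × ℝ → Fin n → ℂ} {p : RSpace n × ℝ}
    (hA : DifferentiableAt ℝ A p) (j : Fin n) (v : RSpace n × ℝ) :
    fderiv ℝ (fun p => A p j) p v = fderiv ℝ A p v j := by
  rw [(hasFDerivAt_pi'.1 hA.hasFDerivAt j).fderiv]
  rfl

/-- The direction (e_l - θ_l θ, r θ_l) is resolved into coordinates, which produces the separate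
partial derivatives of the formula. On the unit sphere this direction is tangent to it; only the
individual summands depend on the analytic extension. -/
lemma rowMatCol_polarDer {A : RSpace n × ℝ → Fin n → ℂ} {p : RSpace n × ℝ}
    (hA : DifferentiableAt ℝ A p) (k : ℤ) (l : Fin n) (v : RSpace n) :
    rowMatCol a (fun j => polarDer k l (fun p => A p j) p) v
      = (k : ℂ) * (p.1 l : ℂ) * rowMatCol a (A p) v
        + ∑ j, ((((if j = l then 1 else 0) - p.1 j * p.1 l : ℝ)) : ℂ)
          * rowMatCol a (fderiv ℝ A p (EuclideanSpace.single j 1, 0)) v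
        + ((p.2 * p.1 l : ℝ) : ℂ) * rowMatCol a (fderiv ℝ A p (0, 1)) v := by
  have hdir : ((EuclideanSpace.single l 1 - p.1 l • p.1, p.2 * p.1 l) : RSpace n × ℝ)
      = ∑ j, ((if j = l then 1 else 0) - p.1 j * p.1 l) •
          ((EuclideanSpace.single j 1, 0) : RSpace n × ℝ) + (p.2 * p.1 l) • (0, 1) := by
    have h1 := eq_sum_smul_single (EuclideanSpace.single l 1 - p.1 l • p.1)
    refine Prod.ext ?_ ?_
    · rw [Prod.fst_add, Prod.fst_sum]
      simp only [Prod.smul_fst, smul_zero, add_zero]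
      refine h1.trans (Finset.sum_congr rfl fun j _ => ?_)
      congr 1
      simp
      ring
    · rw [Prod.snd_add, Prod.snd_sum]
      simp
  have e : (fun j => polarDer k l (fun p => A p j) p)
      = ((k : ℂ) * (p.1 l : ℂ)) • A p
        + ∑ j, ((((if j = l then 1 else 0) - p.1 j * p.1 l : ℝ)) : ℂ)
          • fderiv ℝ A p (EuclideanSpace.single j 1, 0)
        + ((p.2 * p.1 l : ℝ) : ℂ) • fderiv ℝ A p (0, 1) := by
    ext i
    rw [polarDer, fderiv_component hA, hdir, map_add, map_sum, map_smul]
    simp only [map_smul, Pi.add_apply, Finset.sum_apply, Pi.smul_apply, smul_eq_mul,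
      Complex.real_smul]
    ring
  rw [e, ← rowMatColL_apply, map_add, map_add, map_sum, map_smul, map_smul]
  simp only [map_smul, smul_eq_mul, rowMatColL_apply]

lemma gradientFormula_eq (har : HasRealPrincipalPart a) (hE : IsExpansion a S T A₁ b₀ B₁ C)
    (hG : IsGradientExpansion a S T B₁ C A₂) {x y : RSpace n} (hxy : x ≠ y) (h : Fin n) :
    gradientFormula Ω a S T B₁ C A₂ h x y = tangentialPart Ω x
      (fun l => partialD l (fun x' => doubleLayerKernel Ω a S x' y) x) h := by
  have hw : x - y ≠ 0 := sub_ne_zero.2 hxy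
  have h0 : ‖x - y‖ ≠ 0 := norm_ne_zero_iff.2 hw
  have hT0 : ‖invApply T (x - y)‖ ≠ 0 := norm_ne_zero_iff.2 (invApply_ne_zero hE.isUnit hw)
  set w := x - y with hwdef
  have hwi : ∀ i, x i - y i = w i := fun i => rfl
  set ν := outerNormal Ω y with hνdef
  have hrow : ∀ l, rowMatCol a (fun j => partialD l (partialD j S) w) ν
      = (1 / (sphereArea n * √(realCoeffTwo a).det) : ℝ)
          * (((-(n : ℤ) : ℤ) * ‖invApply T w‖ ^ (-(n : ℤ) - 2) * invForm (realCoeffTwo a) w l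
              * (∑ i, w i * ν i) + ‖invApply T w‖ ^ (-(n : ℤ)) * ν l : ℝ) : ℂ)
        + ((‖w‖ ^ (1 - (n : ℤ)) : ℝ) : ℂ)
          * rowMatCol a (fun j => polarDer (2 - (n : ℤ)) l (fun p => A₂ p j) (polar w)) ν
        + (rowMatCol a (fun j => partialD l (partialD j B₁) w) ν * (Real.log ‖w‖ : ℂ)
          + rowMatCol a (fun j => partialD j B₁ w) ν * ((w l / ‖w‖ ^ 2 : ℝ) : ℂ))
        + rowMatCol a (fun j => partialD l (partialD j C) w) ν := by
    intro l
    have e : (fun j => partialD l (partialD j S) w)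
        = ((1 / (sphereArea n * √(realCoeffTwo a).det) : ℝ) : ℂ) •
            (((((-(n : ℤ) : ℤ) * ‖invApply T w‖ ^ (-(n : ℤ) - 2)
                * invForm (realCoeffTwo a) w l : ℝ)) : ℂ) •
              (fun j => (invForm (realCoeffTwo a) w j : ℂ))
            + ((‖invApply T w‖ ^ (-(n : ℤ)) : ℝ) : ℂ) • fun j => ((realCoeffTwo a)⁻¹ l j : ℂ))
        + ((‖w‖ ^ (1 - (n : ℤ)) : ℝ) : ℂ) •
            (fun j => polarDer (2 - (n : ℤ)) l (fun p => A₂ p j) (polar w))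
        + ((Real.log ‖w‖ : ℂ) • (fun j => partialD l (partialD j B₁) w)
          + ((w l / ‖w‖ ^ 2 : ℝ) : ℂ) • fun j => partialD j B₁ w)
        + fun j => partialD l (partialD j C) w := by
      ext j
      rw [partialD_partialD_of_expansion hE hG hw]
      simp only [Pi.add_apply, Pi.smul_apply, smul_eq_mul]
      push_cast
      ring
    rw [e, ← rowMatColL_apply]
    simp only [map_add, map_smul, smul_eq_mul]
    simp only [rowMatColL_apply, rowMatCol_invForm har hE.isUnit hE.factor,
      rowMatCol_inv har hE.isUnit hE.factor]
    push_cast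
    ring
  -- The nine terms already match as vectors, before projection; applying the complex-linear
  -- tangential part then finishes.
  have hvec : (fun l => partialD l (fun x' => doubleLayerKernel Ω a S x' y) x)
      = ((n / (sphereArea n * √(realCoeffTwo a).det)
          * ((∑ i, w i * ν i) / ‖invApply T w‖ ^ n) : ℝ) : ℂ) •
          (fun l => (((∑ j, ∑ z, T⁻¹ j z * w z * T⁻¹ j l) / ‖invApply T w‖ ^ 2 : ℝ) : ℂ))
        - (((sphereArea n * √(realCoeffTwo a).det * ‖invApply T w‖ ^ n : ℝ) : ℂ))⁻¹ •
          (fun l => (ν l : ℂ))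
        - ((2 - (n : ℂ)) * ((‖w‖ ^ (1 - (n : ℤ)) : ℝ) : ℂ) * rowMatCol a (A₂ (polar w)) ν) •
          (fun l => ((w l / ‖w‖ : ℝ) : ℂ))
        - ∑ j, (rowMatCol a (fderiv ℝ A₂ (polar w) (EuclideanSpace.single j 1, 0)) ν
            * ((‖w‖ ^ (-(n : ℤ)) : ℝ) : ℂ)) •
          (fun l => (((if j = l then 1 else 0) * ‖w‖ - w j * w l / ‖w‖ : ℝ) : ℂ))
        - rowMatCol a (fderiv ℝ A₂ (polar w) (0, 1)) ν •
          (fun l => ((w l / ‖w‖ ^ (n - 1 : ℤ) : ℝ) : ℂ))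
        - ∑ j, ∑ z, (coeffTwo a j z * (ν z : ℂ) * (Real.log ‖w‖ : ℂ)) •
          (fun l => partialD l (partialD j B₁) w)
        - rowMatCol a (fun j => partialD j B₁ w) ν • (fun l => ((w l / ‖w‖ ^ 2 : ℝ) : ℂ))
        - ∑ j, ∑ z, (coeffTwo a j z * (ν z : ℂ)) • (fun l => partialD l (partialD j C) w)
        - (∑ l, (ν l : ℂ) * coeffOne a l) • (fun l => partialD l S w) := by
    ext l
    rw [partialD_doubleLayerKernel (fun x hx => hE.analyticAt hx) hxy, hrow,
      rowMatCol_polarDer (hG.analytic_A _ (polar_mem hw)).differentiableAt]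
    simp only [Pi.sub_apply, Pi.smul_apply, Finset.sum_apply, smul_eq_mul]
    have s1 : rowMatCol a (fun j => partialD l (partialD j B₁) w) ν * (Real.log ‖w‖ : ℂ)
        = ∑ j, ∑ z, coeffTwo a j z * (ν z : ℂ) * (Real.log ‖w‖ : ℂ)
          * partialD l (partialD j B₁) w := by
      rw [rowMatCol, Finset.sum_mul]
      refine Finset.sum_congr rfl fun j _ => ?_
      rw [Finset.sum_mul]
      exact Finset.sum_congr rfl fun z _ => by ring
    have s2 : rowMatCol a (fun j => partialD l (partialD j C) w) ν
        = ∑ j, ∑ z, coeffTwo a j z * (ν z : ℂ) * partialD l (partialD j C) w :=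
      Finset.sum_congr rfl fun j _ => Finset.sum_congr rfl fun z _ => by ring
    have s3 : ((‖w‖ ^ (1 - (n : ℤ)) : ℝ) : ℂ)
          * ∑ j, ((((if j = l then 1 else 0) - (polar w).1 j * (polar w).1 l : ℝ)) : ℂ)
            * rowMatCol a (fderiv ℝ A₂ (polar w) (EuclideanSpace.single j 1, 0)) ν
        = ∑ j, rowMatCol a (fderiv ℝ A₂ (polar w) (EuclideanSpace.single j 1, 0)) ν
            * ((‖w‖ ^ (-(n : ℤ)) : ℝ) : ℂ)
            * (((if j = l then 1 else 0) * ‖w‖ - w j * w l / ‖w‖ : ℝ) : ℂ) := by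
      rw [Finset.mul_sum]
      refine Finset.sum_congr rfl fun j _ => ?_
      have : ‖w‖ ^ (1 - (n : ℤ)) * ((if j = l then 1 else 0) - (polar w).1 j * (polar w).1 l)
          = ‖w‖ ^ (-(n : ℤ)) * ((if j = l then 1 else 0) * ‖w‖ - w j * w l / ‖w‖) := by
        rw [show 1 - (n : ℤ) = -n + 1 by ring, zpow_add_one₀ h0]
        simp only [polar, PiLp.smul_apply, smul_eq_mul]
        field_simp
      have := congrArg (fun r : ℝ => (r : ℂ)) this
      simp only [Complex.ofReal_mul] at this
      linear_combination
        rowMatCol a (fderiv ℝ A₂ (polar w) (EuclideanSpace.single j 1, 0)) ν * this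
    have s4 : ‖w‖ ^ (1 - (n : ℤ)) * ((polar w).2 * (polar w).1 l) = w l / ‖w‖ ^ (n - 1 : ℤ) := by
      rw [show (n - 1 : ℤ) = -(1 - n) by ring, zpow_neg]
      simp only [polar, PiLp.smul_apply, smul_eq_mul]
      field_simp
    have s5 : (polar w).1 l = w l / ‖w‖ := by
      simp only [polar, PiLp.smul_apply, smul_eq_mul]
      field_simp
    have s6 : 1 / (sphereArea n * √(realCoeffTwo a).det)
          * ((-(n : ℤ) : ℤ) * ‖invApply T w‖ ^ (-(n : ℤ) - 2) * invForm (realCoeffTwo a) w l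
              * (∑ i, w i * ν i) + ‖invApply T w‖ ^ (-(n : ℤ)) * ν l)
        = -(n / (sphereArea n * √(realCoeffTwo a).det)
          * ((∑ i, w i * ν i) / ‖invApply T w‖ ^ n)
            * ((∑ j, ∑ z, T⁻¹ j z * w z * T⁻¹ j l) / ‖invApply T w‖ ^ 2))
          + (sphereArea n * √(realCoeffTwo a).det * ‖invApply T w‖ ^ n)⁻¹ * ν l := by
      rw [← invForm_eq hE.factor, show -(n : ℤ) - 2 = -((n + 2 : ℕ) : ℤ) by push_cast; ring,
        zpow_neg, zpow_neg, zpow_natCast, zpow_natCast, pow_add, mul_inv, mul_inv, mul_inv]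
      push_cast
      ring
    have t4 := congrArg (fun r : ℝ => (r : ℂ)) s4
    have t6 := congrArg (fun r : ℝ => (r : ℂ)) s6
    simp only [Complex.ofReal_mul] at t4
    simp only [Complex.ofReal_mul, Complex.ofReal_add, Complex.ofReal_neg, Complex.ofReal_inv]
      at t6 ⊢
    simp only [s5] at s3 t4 ⊢
    rw [s1, s2]
    push_cast at s3 t4 t6 ⊢
    linear_combination -t6 - s3 - rowMatCol a (fderiv ℝ A₂ (polar w) (0, 1)) ν * t4
  rw [hvec, ← tangentialPartL_apply, gradientFormula]
  simp only [map_sub, map_smul, map_sum, smul_eq_mul, hwi, ← hwdef, ← hνdef]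
  simp only [tangentialPartL_apply]
  have r1 : ∀ D : RSpace n → ℂ, ∀ c : ℂ, ∑ j, ∑ z, tangentialPart Ω x
        (fun l => partialD l (partialD j D) w) h * (coeffTwo a j z * (ν z : ℂ)) * c
      = ∑ j, ∑ z, coeffTwo a j z * (ν z : ℂ) * c
        * tangentialPart Ω x (fun l => partialD l (partialD j D) w) h := fun D c =>
    Finset.sum_congr rfl fun j _ => Finset.sum_congr rfl fun z _ => by ring
  have r2 := r1 C 1
  simp only [mul_one] at r2
  rw [r1, r2]
  ring

end Formula

end

noncomputable section

/-! ### Kernel classes -/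

section KernelClass

variable {n : ℕ} {s₁ s₂ s₃ : ℝ} {X Y : Set (RSpace n)} {K K' : RSpace n → RSpace n → ℂ}

lemma ne_of_notMem_ball {x' x'' y : RSpace n} (h : x' ≠ x'')
    (hy : y ∉ Metric.ball x' (2 * ‖x' - x''‖)) :
    2 * ‖x' - x''‖ ≤ ‖x' - y‖ ∧ x' ≠ y ∧ x'' ≠ y := by
  have hd : 0 < ‖x' - x''‖ := norm_pos_iff.2 (sub_ne_zero.2 h)
  rw [mem_ball_iff_norm, not_lt, norm_sub_rev y x'] at hy
  refine ⟨hy, ?_, ?_⟩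
  · rintro rfl
    simp at hy
    linarith
  · rintro rfl
    linarith

lemma MemKernelClass.congr (h : MemKernelClass s₁ s₂ s₃ X Y K)
    (hK : ∀ x ∈ X, ∀ y ∈ Y, x ≠ y → K' x y = K x y) : MemKernelClass s₁ s₂ s₃ X Y K' := by
  refine ⟨h.continuousOn.congr fun q hq => hK _ hq.1 _ hq.2.1 hq.2.2, ?_, ?_⟩
  · obtain ⟨c, hc⟩ := h.bounded
    exact ⟨c, fun x hx y hy hxy => by rw [hK x hx y hy hxy]; exact hc x hx y hy hxy⟩
  · obtain ⟨c, hc⟩ := h.holder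
    refine ⟨c, fun x' hx' x'' hx'' hne y hy => ?_⟩
    obtain ⟨-, h1, h2⟩ := ne_of_notMem_ball hne hy.2
    rw [hK x' hx' y hy.1 h1, hK x'' hx'' y hy.1 h2]
    exact hc x' hx' x'' hx'' hne y hy

lemma memKernelClass_zero : MemKernelClass s₁ s₂ s₃ X Y fun _ _ => 0 :=
  ⟨continuousOn_const, ⟨0, by simp⟩, ⟨0, by simp⟩⟩

lemma MemKernelClass.add (h : MemKernelClass s₁ s₂ s₃ X Y K)
    (h' : MemKernelClass s₁ s₂ s₃ X Y K') :
    MemKernelClass s₁ s₂ s₃ X Y fun x y => K x y + K' x y := by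
  refine ⟨h.continuousOn.add h'.continuousOn, ?_, ?_⟩
  · obtain ⟨c, hc⟩ := h.bounded
    obtain ⟨c', hc'⟩ := h'.bounded
    refine ⟨c + c', fun x hx y hy hxy => le_trans ?_ (add_le_add (hc x hx y hy hxy)
      (hc' x hx y hy hxy))⟩
    rw [← mul_add]
    exact mul_le_mul_of_nonneg_left (norm_add_le _ _) (by positivity)
  · obtain ⟨c, hc⟩ := h.holder
    obtain ⟨c', hc'⟩ := h'.holder
    refine ⟨c + c', fun x' hx' x'' hx'' hne y hy => le_trans ?_
      (add_le_add (hc x' hx' x'' hx'' hne y hy) (hc' x' hx' x'' hx'' hne y hy))⟩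
    rw [← mul_add, add_sub_add_comm]
    exact mul_le_mul_of_nonneg_left (norm_add_le _ _) (by positivity)

lemma MemKernelClass.const_mul (h : MemKernelClass s₁ s₂ s₃ X Y K) (t : ℂ) :
    MemKernelClass s₁ s₂ s₃ X Y fun x y => t * K x y := by
  refine ⟨continuousOn_const.mul h.continuousOn, ?_, ?_⟩
  · obtain ⟨c, hc⟩ := h.bounded
    refine ⟨‖t‖ * c, fun x hx y hy hxy => ?_⟩
    rw [norm_mul, mul_left_comm]
    exact mul_le_mul_of_nonneg_left (hc x hx y hy hxy) (norm_nonneg t)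
  · obtain ⟨c, hc⟩ := h.holder
    refine ⟨‖t‖ * c, fun x' hx' x'' hx'' hne y hy => ?_⟩
    rw [← mul_sub, norm_mul, mul_left_comm]
    exact mul_le_mul_of_nonneg_left (hc x' hx' x'' hx'' hne y hy) (norm_nonneg t)

lemma memKernelClass_sum {ι : Type*} (s : Finset ι) {k : ι → RSpace n → RSpace n → ℂ}
    (h : ∀ i ∈ s, MemKernelClass s₁ s₂ s₃ X Y (k i)) :
    MemKernelClass s₁ s₂ s₃ X Y fun x y => ∑ i ∈ s, k i x y := by
  classical
  induction s using Finset.induction_on with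
  | empty => simpa using memKernelClass_zero
  | insert i s hi ih =>
    simp only [Finset.sum_insert hi]
    exact (h i (Finset.mem_insert_self i s)).add
      (ih fun j hj => h j (Finset.mem_insert_of_mem hj))

lemma rpow_le_of_comparable {r t : ℝ} (hr : 0 < r) (h1 : r / 2 ≤ t) (h2 : t ≤ 2 * r) (e : ℝ) :
    t ^ e ≤ 2 ^ |e| * r ^ e := by
  have ht : 0 < t := by linarith
  have h3 : t ^ e = (t / r) ^ e * r ^ e := by
    rw [← Real.mul_rpow (by positivity) hr.le, div_mul_cancel₀ _ hr.ne']
  rw [h3]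
  refine mul_le_mul_of_nonneg_right ?_ (by positivity)
  rcases le_total 0 e with he | he
  · rw [abs_of_nonneg he]
    exact Real.rpow_le_rpow (by positivity) ((div_le_iff₀ hr).2 h2) he
  · rw [abs_of_nonpos he, Real.rpow_neg (by norm_num), ← Real.inv_rpow (by norm_num)]
    refine Real.rpow_le_rpow_of_nonpos (by norm_num) ?_ he
    rw [le_div_iff₀ hr]
    linarith

/-- A function of `x - y` of polar type of degree `-n-s`, multiplied by a coefficient that vanishes
on the diagonal with order `s + α`, belongs to the class `𝒦_{n-α,n,α}`. -/
lemma memKernelClass_mul_polarLog {α : ℝ} (hα1 : α ≤ 1) {F : Set (RSpace n)}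
    {R : ℝ} (hR : ∀ x ∈ F, ∀ y ∈ F, ‖x - y‖ ≤ R) {s : ℤ} (hs : -(n : ℤ) - s ≤ -1)
    {f : RSpace n → ℂ} (hf : IsPolarLog (-(n : ℤ) - s) f) {p : RSpace n → RSpace n → ℂ}
    (hpc : ContinuousOn (fun q : RSpace n × RSpace n => p q.1 q.2) (F ×ˢ F)) {c : ℝ} (hc : 0 ≤ c)
    (hp1 : ∀ x ∈ F, ∀ y ∈ F, x ≠ y → ‖p x y‖ ≤ c * ‖x - y‖ ^ ((s : ℝ) + α))
    (hp2 : ∀ x' ∈ F, ∀ x'' ∈ F, ∀ y ∈ F, x' ≠ x'' → 2 * ‖x' - x''‖ ≤ ‖x' - y‖ →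
      ‖p x' y - p x'' y‖ ≤ c * ‖x' - x''‖ ^ α * ‖x' - y‖ ^ (s : ℝ)) :
    MemKernelClass ((n : ℝ) - α) n α F F fun x y => p x y * f (x - y) := by
  obtain ⟨cf, hcf0, hcf⟩ := hf.exists_bound hs R
  obtain ⟨cl, hcl0, hcl⟩ := hf.exists_lipschitz (by omega) R
  refine ⟨?_, ⟨c * cf, fun x hx y hy hxy => ?_⟩, ⟨c * cf + c * 2 ^ |(s : ℝ) + α| * cl,
    fun x' hx' x'' hx'' hne y hy => ?_⟩⟩
  · refine (hpc.mono fun q hq => ⟨hq.1, hq.2.1⟩).mul ?_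
    have h1 : ContinuousOn f {0}ᶜ := fun x hx => (hf.analyticAt hx).continuousAt.continuousWithinAt
    refine h1.comp (f := fun q : RSpace n × RSpace n => q.1 - q.2) (by fun_prop) ?_
    intro q hq
    exact sub_ne_zero.2 hq.2.2
  · have hw : x - y ≠ 0 := sub_ne_zero.2 hxy
    have hr : 0 < ‖x - y‖ := norm_pos_iff.2 hw
    have h1 := hcf _ hw (hR x hx y hy)
    rw [← Real.rpow_intCast] at h1
    calc ‖x - y‖ ^ ((n : ℝ) - α) * ‖p x y * f (x - y)‖
        ≤ ‖x - y‖ ^ ((n : ℝ) - α) * ((c * ‖x - y‖ ^ ((s : ℝ) + α))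
            * (cf * ‖x - y‖ ^ ((-(n : ℤ) - s : ℤ) : ℝ))) := by
          rw [norm_mul]
          have := hp1 x hx y hy hxy
          gcongr
      _ = c * cf * (‖x - y‖ ^ ((n : ℝ) - α) * ‖x - y‖ ^ ((s : ℝ) + α)
            * ‖x - y‖ ^ ((-(n : ℤ) - s : ℤ) : ℝ)) := by ring
      _ = c * cf := by
          rw [← Real.rpow_add hr, ← Real.rpow_add hr]
          push_cast
          rw [show (n : ℝ) - α + (s + α) + (-n - s) = 0 by ring, Real.rpow_zero, mul_one]
  · obtain ⟨h2d, hne1, hne2⟩ := ne_of_notMem_ball hne hy.2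
    have hy' := hy.1
    have hw : x' - y ≠ 0 := sub_ne_zero.2 hne1
    have hr : 0 < ‖x' - y‖ := norm_pos_iff.2 hw
    have hd : 0 < ‖x' - x''‖ := norm_pos_iff.2 (sub_ne_zero.2 hne)
    have e0 : x' - y - (x'' - y) = x' - x'' := by abel
    have h1 := hcf _ hw (hR x' hx' y hy')
    have h2 := hcl (x' - y) (x'' - y) hw (hR x' hx' y hy') (by rw [e0]; exact h2d)
    have h3 := hp2 x' hx' x'' hx'' y hy' hne h2d
    have h4 := hp1 x'' hx'' y hy' hne2
    have hcmp : ‖x' - y‖ / 2 ≤ ‖x'' - y‖ ∧ ‖x'' - y‖ ≤ 2 * ‖x' - y‖ := by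
      have e1 := norm_sub_norm_le (x' - y) (x'' - y)
      have e2 := norm_sub_norm_le (x'' - y) (x' - y)
      rw [norm_sub_rev (x'' - y), e0] at e2
      rw [e0] at e1
      constructor <;> linarith
    have h5 := h4.trans (mul_le_mul_of_nonneg_left
      (rpow_le_of_comparable hr hcmp.1 hcmp.2 ((s : ℝ) + α)) hc)
    rw [e0, ← Real.rpow_intCast] at h2
    rw [← Real.rpow_intCast] at h1
    -- This trades the surplus 1 - α powers of |x' - x''| for powers of |x' - y|, using |x' - x''| ≤
    -- |x' - y| and α ≤ 1.
    have h6 : ‖x' - x''‖ ≤ ‖x' - x''‖ ^ α * ‖x' - y‖ ^ (1 - α) := by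
      calc ‖x' - x''‖ = ‖x' - x''‖ ^ α * ‖x' - x''‖ ^ (1 - α) := by
            rw [← Real.rpow_add hd, add_sub_cancel, Real.rpow_one]
        _ ≤ _ := by
            gcongr
            · linarith
    -- The coefficient difference is taken at x' for f, and the difference of f is multiplied by the
    -- coefficient at x'', whose distance to y is comparable to that of x'.
    have h7 : ‖p x' y * f (x' - y) - p x'' y * f (x'' - y)‖
        ≤ ‖p x' y - p x'' y‖ * ‖f (x' - y)‖ + ‖p x'' y‖ * ‖f (x' - y) - f (x'' - y)‖ := by
      rw [← norm_mul, ← norm_mul]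
      refine le_trans (le_of_eq ?_) (norm_add_le _ _)
      congr 1
      ring
    have h8 : ‖p x' y * f (x' - y) - p x'' y * f (x'' - y)‖
        ≤ c * ‖x' - x''‖ ^ α * ‖x' - y‖ ^ (s : ℝ)
            * (cf * ‖x' - y‖ ^ ((-(n : ℤ) - s : ℤ) : ℝ))
          + c * (2 ^ |(s : ℝ) + α| * ‖x' - y‖ ^ ((s : ℝ) + α))
            * (cl * ‖x' - y‖ ^ ((-(n : ℤ) - s - 1 : ℤ) : ℝ)
              * (‖x' - x''‖ ^ α * ‖x' - y‖ ^ (1 - α))) := by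
      refine h7.trans (add_le_add (mul_le_mul h3 h1 (norm_nonneg _) (by positivity))
        (mul_le_mul h5 (h2.trans ?_) (norm_nonneg _) (by positivity)))
      exact mul_le_mul_of_nonneg_left h6 (by positivity)
    have e1 : ‖x' - y‖ ^ (s : ℝ) * ‖x' - y‖ ^ ((-(n : ℤ) - s : ℤ) : ℝ) = ‖x' - y‖ ^ (-(n : ℝ)) := by
      rw [← Real.rpow_add hr]
      congr 1
      push_cast
      ring
    have e2 : ‖x' - y‖ ^ ((s : ℝ) + α) * ‖x' - y‖ ^ ((-(n : ℤ) - s - 1 : ℤ) : ℝ)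
        * ‖x' - y‖ ^ (1 - α) = ‖x' - y‖ ^ (-(n : ℝ)) := by
      rw [← Real.rpow_add hr, ← Real.rpow_add hr]
      congr 1
      push_cast
      ring
    have e3 : ‖x' - y‖ ^ (n : ℝ) * ‖x' - y‖ ^ (-(n : ℝ)) = 1 := by
      rw [← Real.rpow_add hr, add_neg_cancel, Real.rpow_zero]
    have hda : 0 < ‖x' - x''‖ ^ α := by positivity
    calc ‖x' - y‖ ^ (n : ℝ) / ‖x' - x''‖ ^ α
          * ‖p x' y * f (x' - y) - p x'' y * f (x'' - y)‖
        ≤ ‖x' - y‖ ^ (n : ℝ) / ‖x' - x''‖ ^ α * _ :=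
          mul_le_mul_of_nonneg_left h8 (by positivity)
      _ = ‖x' - y‖ ^ (n : ℝ) / ‖x' - x''‖ ^ α * (‖x' - x''‖ ^ α
          * (c * cf * (‖x' - y‖ ^ (s : ℝ) * ‖x' - y‖ ^ ((-(n : ℤ) - s : ℤ) : ℝ))
            + c * 2 ^ |(s : ℝ) + α| * cl * (‖x' - y‖ ^ ((s : ℝ) + α)
              * ‖x' - y‖ ^ ((-(n : ℤ) - s - 1 : ℤ) : ℝ) * ‖x' - y‖ ^ (1 - α)))) := by ring
      _ = (c * cf + c * 2 ^ |(s : ℝ) + α| * cl)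
          * (‖x' - y‖ ^ (n : ℝ) * ‖x' - y‖ ^ (-(n : ℝ))) := by
          rw [e1, e2]
          field_simp
      _ = _ := by rw [e3, mul_one]

end KernelClass

/-! ### Smallness and Hölder continuity of the coefficients built from the normal. -/

section NormalCoefficients

variable {n : ℕ} {α : ℝ} {Ω : Set (RSpace n)}

/-- The entries of the matrix of the orthogonal projection onto the tangent space. -/
def tangentProj (Ω : Set (RSpace n)) (h l : Fin n) (x : RSpace n) : ℝ :=
  (if h = l then 1 else 0) - outerNormal Ω x h * outerNormal Ω x l

lemma tangentialPart_eq_sum {x : RSpace n} (hν : ‖outerNormal Ω x‖ = 1) (F : Fin n → ℂ)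
    (h : Fin n) : tangentialPart Ω x F h = ∑ l, (tangentProj Ω h l x : ℂ) * F l := by
  rw [tangentialPart_eq hν]
  simp only [tangentProj, Complex.ofReal_sub, sub_mul, Finset.sum_sub_distrib, Finset.mul_sum,
    Complex.ofReal_mul, mul_assoc]
  congr 1
  rw [Finset.sum_eq_single h]
  · simp
  · intro b _ hb
    simp [hb.symm]
  · simp

/-- The tangential part at `x` of the normal at `y`. -/
def tangentNormal (Ω : Set (RSpace n)) (h : Fin n) (x y : RSpace n) : ℝ :=
  outerNormal Ω y h - outerNormal Ω x h * inner ℝ (outerNormal Ω x) (outerNormal Ω y)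

lemma tangentNormal_eq_sum (h : Fin n) (x y : RSpace n) :
    tangentNormal Ω h x y = ∑ l, tangentProj Ω h l x * outerNormal Ω y l := by
  simp only [tangentNormal, tangentProj, inner_eq_sum, sub_mul, Finset.sum_sub_distrib,
    Finset.mul_sum, mul_assoc]
  congr 1
  rw [Finset.sum_eq_single h]
  · simp
  · intro b _ hb
    simp [hb.symm]
  · simp

lemma abs_apply_le (v : RSpace n) (l : Fin n) : |v l| ≤ ‖v‖ := PiLp.norm_apply_le v l

/-- `c` bounds the Hölder constant of the normal and the deviation from the tangent planes, and the
normals are unit vectors. -/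
structure HasBoundaryBound (α : ℝ) (Ω : Set (RSpace n)) (c : ℝ) : Prop where
  nonneg : 0 ≤ c
  norm_eq : ∀ x ∈ frontier Ω, ‖outerNormal Ω x‖ = 1
  holder : ∀ x ∈ frontier Ω, ∀ y ∈ frontier Ω,
    ‖outerNormal Ω x - outerNormal Ω y‖ ≤ c * ‖x - y‖ ^ α
  flat : ∀ x ∈ frontier Ω, ∀ y ∈ frontier Ω,
    |inner ℝ (outerNormal Ω y) (x - y)| ≤ c * ‖x - y‖ ^ (1 + α)

namespace HasBoundaryBound

variable {c : ℝ}

lemma continuousOn (hc : HasBoundaryBound α Ω c) (hα : 0 < α) :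
    ContinuousOn (outerNormal Ω) (frontier Ω) := by
  intro x hx
  rw [ContinuousWithinAt, tendsto_iff_norm_sub_tendsto_zero]
  have h1 : Tendsto (fun y => c * ‖y - x‖ ^ α) (𝓝[frontier Ω] x) (𝓝 0) := by
    have h2 : Continuous fun y : RSpace n => c * ‖y - x‖ ^ α :=
      continuous_const.mul ((continuous_norm.comp (continuous_id.sub continuous_const)).rpow_const
        fun _ => Or.inr hα.le)
    have h3 := (h2.tendsto x).mono_left (nhdsWithin_le_nhds (s := frontier Ω))
    simpa [Real.zero_rpow hα.ne'] using h3
  refine squeeze_zero' (Eventually.of_forall fun _ => norm_nonneg _) ?_ h1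
  filter_upwards [self_mem_nhdsWithin] with y hy using hc.holder y hy x hx

lemma abs_coord_le (hc : HasBoundaryBound α Ω c) {x : RSpace n} (hx : x ∈ frontier Ω)
    (l : Fin n) : |outerNormal Ω x l| ≤ 1 :=
  (abs_apply_le _ l).trans (hc.norm_eq x hx).le

lemma abs_coord_sub_le (hc : HasBoundaryBound α Ω c) {x y : RSpace n} (hx : x ∈ frontier Ω)
    (hy : y ∈ frontier Ω) (l : Fin n) :
    |outerNormal Ω x l - outerNormal Ω y l| ≤ c * ‖x - y‖ ^ α :=
  (abs_apply_le (outerNormal Ω x - outerNormal Ω y) l).trans (hc.holder x hx y hy)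

lemma abs_tangentProj_le (hc : HasBoundaryBound α Ω c) {x : RSpace n} (hx : x ∈ frontier Ω)
    (h l : Fin n) : |tangentProj Ω h l x| ≤ 2 := by
  rw [tangentProj]
  refine (abs_sub _ _).trans ?_
  have h1 : |(if h = l then 1 else 0 : ℝ)| ≤ 1 := by split_ifs <;> simp
  have h2 : |outerNormal Ω x h * outerNormal Ω x l| ≤ 1 := by
    rw [abs_mul]
    exact mul_le_one₀ (hc.abs_coord_le hx h) (abs_nonneg _) (hc.abs_coord_le hx l)
  linarith

lemma abs_tangentProj_sub_le (hc : HasBoundaryBound α Ω c) {x y : RSpace n}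
    (hx : x ∈ frontier Ω) (hy : y ∈ frontier Ω) (h l : Fin n) :
    |tangentProj Ω h l x - tangentProj Ω h l y| ≤ 2 * c * ‖x - y‖ ^ α := by
  have e : tangentProj Ω h l x - tangentProj Ω h l y
      = -(outerNormal Ω x h * (outerNormal Ω x l - outerNormal Ω y l)
        + (outerNormal Ω x h - outerNormal Ω y h) * outerNormal Ω y l) := by
    simp only [tangentProj]
    ring
  rw [e, abs_neg]
  refine (abs_add_le _ _).trans ?_
  rw [abs_mul, abs_mul]
  have h1 := mul_le_mul (hc.abs_coord_le hx h) (hc.abs_coord_sub_le hx hy l) (abs_nonneg _)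
    zero_le_one
  have h2 := mul_le_mul (hc.abs_coord_sub_le hx hy h) (hc.abs_coord_le hy l) (abs_nonneg _)
    (mul_nonneg hc.nonneg (by positivity))
  linarith

/-- The tangential projection at x annihilates ν(x), so only ν(y) - ν(x) contributes. -/
lemma abs_tangentNormal_le (hc : HasBoundaryBound α Ω c) {x y : RSpace n}
    (hx : x ∈ frontier Ω) (hy : y ∈ frontier Ω) (h : Fin n) :
    |tangentNormal Ω h x y| ≤ 2 * c * ‖x - y‖ ^ α := by
  have e : tangentNormal Ω h x y = -(outerNormal Ω x h - outerNormal Ω y h)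
      + outerNormal Ω x h * inner ℝ (outerNormal Ω x) (outerNormal Ω x - outerNormal Ω y) := by
    rw [inner_sub_right, real_inner_self_eq_norm_sq, hc.norm_eq x hx, tangentNormal]
    ring
  rw [e]
  refine (abs_add_le _ _).trans ?_
  rw [abs_neg, abs_mul]
  have h1 := hc.abs_coord_sub_le hx hy h
  have h2 := abs_real_inner_le_norm (outerNormal Ω x) (outerNormal Ω x - outerNormal Ω y)
  rw [hc.norm_eq x hx, one_mul] at h2
  have h3 := mul_le_mul (hc.abs_coord_le hx h) (h2.trans (hc.holder x hx y hy)) (abs_nonneg _)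
    zero_le_one
  linarith

lemma abs_tangentNormal_sub_le (hc : HasBoundaryBound α Ω c) {x' x'' y : RSpace n}
    (hx' : x' ∈ frontier Ω) (hx'' : x'' ∈ frontier Ω) (hy : y ∈ frontier Ω) (h : Fin n) :
    |tangentNormal Ω h x' y - tangentNormal Ω h x'' y| ≤ 2 * c * ‖x' - x''‖ ^ α := by
  have e : tangentNormal Ω h x' y - tangentNormal Ω h x'' y
      = -(outerNormal Ω x' h * inner ℝ (outerNormal Ω x' - outerNormal Ω x'') (outerNormal Ω y)
        + (outerNormal Ω x' h - outerNormal Ω x'' h)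
          * inner ℝ (outerNormal Ω x'') (outerNormal Ω y)) := by
    simp only [tangentNormal, inner_sub_left]
    ring
  rw [e, abs_neg]
  refine (abs_add_le _ _).trans ?_
  rw [abs_mul, abs_mul]
  have h1 := abs_real_inner_le_norm (outerNormal Ω x' - outerNormal Ω x'') (outerNormal Ω y)
  have h2 := abs_real_inner_le_norm (outerNormal Ω x'') (outerNormal Ω y)
  rw [hc.norm_eq y hy, mul_one] at h1 h2
  rw [hc.norm_eq x'' hx''] at h2
  have h3 := mul_le_mul (hc.abs_coord_le hx' h) (h1.trans (hc.holder x' hx' x'' hx''))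
    (abs_nonneg _) zero_le_one
  have h4 := mul_le_mul (hc.abs_coord_sub_le hx' hx'' h) h2 (abs_nonneg _)
    (mul_nonneg hc.nonneg (by positivity))
  linarith

end HasBoundaryBound

end NormalCoefficients

end

noncomputable section

/-! ### The kernel class of the tangential gradient -/

section Pieces

variable {n : ℕ} {α : ℝ} {Ω : Set (RSpace n)} {c R : ℝ} {f : RSpace n → ℂ}

lemma continuousOn_normal_fst (hc : HasBoundaryBound α Ω c) (hα : 0 < α) :
    ContinuousOn (fun q : RSpace n × RSpace n => outerNormal Ω q.1)
      (frontier Ω ×ˢ frontier Ω) :=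
  (hc.continuousOn hα).comp continuousOn_fst fun _ hq => hq.1

lemma continuousOn_normal_snd (hc : HasBoundaryBound α Ω c) (hα : 0 < α) :
    ContinuousOn (fun q : RSpace n × RSpace n => outerNormal Ω q.2)
      (frontier Ω ×ˢ frontier Ω) :=
  (hc.continuousOn hα).comp continuousOn_snd fun _ hq => hq.2

lemma ContinuousOn.coord {X : Type*} [TopologicalSpace X] {v : X → RSpace n} {s : Set X}
    (hv : ContinuousOn v s) (l : Fin n) : ContinuousOn (fun q => v q l) s :=
  (contDiff_coord l (m := 0)).continuous.comp_continuousOn hv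

lemma continuousOn_tangentProj_fst (hc : HasBoundaryBound α Ω c) (hα : 0 < α) (h l : Fin n) :
    ContinuousOn (fun q : RSpace n × RSpace n => tangentProj Ω h l q.1)
      (frontier Ω ×ˢ frontier Ω) :=
  continuousOn_const.sub (((continuousOn_normal_fst hc hα).coord h).mul
    ((continuousOn_normal_fst hc hα).coord l))

/-- The tangential part of ν(y) at x has order α and offsets a singularity of degree -n: this is the
product estimate with s = 0. -/
lemma memKernelClass_tangentNormal (hα0 : 0 < α) (hα1 : α ≤ 1) (hc : HasBoundaryBound α Ω c)
    (hR : ∀ x ∈ frontier Ω, ∀ y ∈ frontier Ω, ‖x - y‖ ≤ R) (hn : 2 ≤ n)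
    (hf : IsPolarLog (-(n : ℤ)) f) (h : Fin n) :
    MemKernelClass ((n : ℝ) - α) n α (frontier Ω) (frontier Ω)
      fun x y => (tangentNormal Ω h x y : ℂ) * f (x - y) := by
  refine memKernelClass_mul_polarLog (s := 0) (c := 2 * c) hα1 hR (by omega)
    (by simpa using hf) ?_ (by linarith [hc.nonneg]) ?_ ?_
  · refine Complex.continuous_ofReal.comp_continuousOn ?_
    exact ((continuousOn_normal_snd hc hα0).coord h).sub
      (((continuousOn_normal_fst hc hα0).coord h).mul
        ((continuousOn_normal_fst hc hα0).inner (continuousOn_normal_snd hc hα0)))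
  · intro x hx y hy _
    rw [Complex.norm_real, Real.norm_eq_abs]
    simpa using hc.abs_tangentNormal_le hx hy h
  · intro x' hx' x'' hx'' y hy _ _
    rw [← Complex.ofReal_sub, Complex.norm_real, Real.norm_eq_abs]
    simpa using hc.abs_tangentNormal_sub_le hx' hx'' hy h

/-- Flatness of the boundary gives (x - y)·ν(y) order 1 + α, against a singularity of degree -n - 1:
this is the product estimate with s = 1. -/
lemma memKernelClass_flat (hα0 : 0 < α) (hα1 : α ≤ 1) (hc : HasBoundaryBound α Ω c)
    (hR : ∀ x ∈ frontier Ω, ∀ y ∈ frontier Ω, ‖x - y‖ ≤ R)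
    (hf : IsPolarLog (-(n : ℤ) - 1) f) (h l : Fin n) :
    MemKernelClass ((n : ℝ) - α) n α (frontier Ω) (frontier Ω)
      fun x y => ((tangentProj Ω h l x * inner ℝ (outerNormal Ω y) (x - y) : ℝ) : ℂ)
        * f (x - y) := by
  have hc0 := hc.nonneg
  -- The Hölder estimate costs 2c from the projection and 2·(c + c) from the scalar product, 6c in
  -- all.
  refine memKernelClass_mul_polarLog (s := 1) (c := 6 * c) hα1 hR (by omega) hf ?_
    (by linarith) ?_ ?_
  · refine Complex.continuous_ofReal.comp_continuousOn ?_
    exact (continuousOn_tangentProj_fst hc hα0 h l).mul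
      ((continuousOn_normal_snd hc hα0).inner (continuousOn_fst.sub continuousOn_snd))
  · intro x hx y hy _
    rw [Complex.norm_real, Real.norm_eq_abs, abs_mul]
    have h1 := mul_le_mul (hc.abs_tangentProj_le hx h l) (hc.flat x hx y hy) (abs_nonneg _)
      zero_le_two
    have h2 : 0 ≤ ‖x - y‖ ^ (1 + α) := by positivity
    push_cast
    nlinarith [mul_nonneg hc0 h2]
  · intro x' hx' x'' hx'' y hy hne h2d
    have hd : 0 < ‖x' - x''‖ := norm_pos_iff.2 (sub_ne_zero.2 hne)
    have hr : 0 < ‖x' - y‖ := by linarith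
    rw [← Complex.ofReal_sub, Complex.norm_real, Real.norm_eq_abs]
    -- Bounding ν(y)·(x'' - x') by |x' - x''| alone would miss a factor |x' - y|^α. Comparison with
    -- ν(x') supplies it: ν(x') - ν(y) has order |x' - y|^α, and ν(x')·(x'' - x') has order |x' -
    -- x''|^(1+α) by flatness at x'.
    have e : tangentProj Ω h l x' * inner ℝ (outerNormal Ω y) (x' - y)
          - tangentProj Ω h l x'' * inner ℝ (outerNormal Ω y) (x'' - y)
        = (tangentProj Ω h l x' - tangentProj Ω h l x'') * inner ℝ (outerNormal Ω y) (x' - y)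
          + tangentProj Ω h l x'' * (inner ℝ (outerNormal Ω x' - outerNormal Ω y) (x'' - x')
            - inner ℝ (outerNormal Ω x') (x'' - x')) := by
      rw [show x'' - y = (x'' - x') + (x' - y) by abel, inner_add_right, inner_sub_left]
      ring
    have h1 : |inner ℝ (outerNormal Ω y) (x' - y)| ≤ ‖x' - y‖ := by
      have := abs_real_inner_le_norm (outerNormal Ω y) (x' - y)
      rwa [hc.norm_eq y hy, one_mul] at this
    have h2 : ‖x' - x''‖ ≤ ‖x' - x''‖ ^ α * ‖x' - y‖ ^ (1 - α) := by
      calc ‖x' - x''‖ = ‖x' - x''‖ ^ α * ‖x' - x''‖ ^ (1 - α) := by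
            rw [← Real.rpow_add hd, add_sub_cancel, Real.rpow_one]
        _ ≤ _ := by
            gcongr
            · linarith
    have h3 : |inner ℝ (outerNormal Ω x' - outerNormal Ω y) (x'' - x')|
        ≤ c * (‖x' - x''‖ ^ α * ‖x' - y‖) := by
      refine (abs_real_inner_le_norm _ _).trans ?_
      rw [norm_sub_rev x'' x']
      calc ‖outerNormal Ω x' - outerNormal Ω y‖ * ‖x' - x''‖
          ≤ (c * ‖x' - y‖ ^ α) * (‖x' - x''‖ ^ α * ‖x' - y‖ ^ (1 - α)) :=
            mul_le_mul (hc.holder x' hx' y hy) h2 (norm_nonneg _) (by positivity)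
        _ = c * (‖x' - x''‖ ^ α * (‖x' - y‖ ^ α * ‖x' - y‖ ^ (1 - α))) := by ring
        _ = _ := by rw [← Real.rpow_add hr, add_sub_cancel, Real.rpow_one]
    have h4 : |inner ℝ (outerNormal Ω x') (x'' - x')| ≤ c * (‖x' - x''‖ ^ α * ‖x' - y‖) := by
      refine (hc.flat x'' hx'' x' hx').trans ?_
      rw [norm_sub_rev x'' x', Real.rpow_add hd, Real.rpow_one, mul_comm ‖x' - x''‖]
      gcongr
      linarith
    have h5 := (abs_sub _ _).trans (add_le_add h3 h4)
    rw [e]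
    refine (abs_add_le _ _).trans ?_
    rw [abs_mul, abs_mul]
    have h6 := mul_le_mul (hc.abs_tangentProj_sub_le hx' hx'' h l) h1 (abs_nonneg _)
      (by positivity)
    have h7 := mul_le_mul (hc.abs_tangentProj_le hx'' h l) h5 (abs_nonneg _) zero_le_two
    push_cast
    rw [Real.rpow_one]
    linarith

/-- For degree 1 - n no cancellation is needed. A bounded Hölder coefficient fits s = -1 because the
boundary is bounded, so 1 is at most a constant times |x - y|^(α-1) or |x - y|⁻¹. -/
lemma memKernelClass_lower (hα0 : 0 < α) (hα1 : α ≤ 1) (hc : HasBoundaryBound α Ω c)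
    (hR : ∀ x ∈ frontier Ω, ∀ y ∈ frontier Ω, ‖x - y‖ ≤ R) (hn : 2 ≤ n)
    (hf : IsPolarLog (1 - (n : ℤ)) f) (h l z : Fin n) :
    MemKernelClass ((n : ℝ) - α) n α (frontier Ω) (frontier Ω)
      fun x y => ((tangentProj Ω h l x * outerNormal Ω y z : ℝ) : ℂ) * f (x - y) := by
  have hc0 := hc.nonneg
  -- Taking `R'` at least 1 gives `R'` ^ (1 - α) ≤ `R'`.
  set R' := max R 1 with hR'
  have hR1 : 1 ≤ R' := le_max_right _ _
  refine memKernelClass_mul_polarLog (s := -1) (c := (2 + 2 * c) * R') hα1 hR (by omega)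
    (by rwa [show -(n : ℤ) - -1 = 1 - n by ring]) ?_ (by positivity) ?_ ?_
  · refine Complex.continuous_ofReal.comp_continuousOn ?_
    exact (continuousOn_tangentProj_fst hc hα0 h l).mul ((continuousOn_normal_snd hc hα0).coord z)
  · intro x hx y hy hxy
    have hr : 0 < ‖x - y‖ := norm_pos_iff.2 (sub_ne_zero.2 hxy)
    have hrR : ‖x - y‖ ≤ R' := (hR x hx y hy).trans (le_max_left _ _)
    rw [Complex.norm_real, Real.norm_eq_abs, abs_mul]
    have h1 := mul_le_mul (hc.abs_tangentProj_le hx h l) (hc.abs_coord_le hy z) (abs_nonneg _)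
      zero_le_two
    have h2 : 1 ≤ R' * ‖x - y‖ ^ (((-1 : ℤ) : ℝ) + α) := by
      have e : ((-1 : ℤ) : ℝ) + α = -(1 - α) := by push_cast; ring
      rw [e, Real.rpow_neg hr.le, ← div_eq_mul_inv, one_le_div (by positivity)]
      calc ‖x - y‖ ^ (1 - α) ≤ R' ^ (1 - α) := Real.rpow_le_rpow hr.le hrR (by linarith)
        _ ≤ R' ^ (1 : ℝ) := Real.rpow_le_rpow_of_exponent_le hR1 (by linarith)
        _ = R' := Real.rpow_one _
    nlinarith
  · intro x' hx' x'' hx'' y hy hne h2d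
    have hd : 0 < ‖x' - x''‖ := norm_pos_iff.2 (sub_ne_zero.2 hne)
    have hr : 0 < ‖x' - y‖ := by linarith
    have hrR : ‖x' - y‖ ≤ R' := (hR x' hx' y hy).trans (le_max_left _ _)
    rw [← Complex.ofReal_sub, Complex.norm_real, Real.norm_eq_abs, ← sub_mul, abs_mul]
    have h1 := mul_le_mul (hc.abs_tangentProj_sub_le hx' hx'' h l) (hc.abs_coord_le hy z)
      (abs_nonneg _) (by positivity)
    have h2 : 1 ≤ R' * ‖x' - y‖ ^ (((-1 : ℤ) : ℝ)) := by
      push_cast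
      rw [Real.rpow_neg_one, ← div_eq_mul_inv, one_le_div hr]
      exact hrR
    have h3 : 0 < ‖x' - x''‖ ^ α := by positivity
    calc |tangentProj Ω h l x' - tangentProj Ω h l x''| * |outerNormal Ω y z|
        ≤ 2 * c * ‖x' - x''‖ ^ α * 1 := h1
      _ ≤ (2 + 2 * c) * ‖x' - x''‖ ^ α * (R' * ‖x' - y‖ ^ (((-1 : ℤ) : ℝ))) := by
          gcongr
          linarith
      _ = _ := by ring

end Pieces

/-! ### Further closure properties of functions of polar type. -/

section PolarClass

variable {n : ℕ} {k : ℤ}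

lemma isPolarLog_zero : IsPolarLog k fun _ : RSpace n => 0 :=
  ⟨fun _ => 0, fun _ => 0, analyticOnNhd_const, analyticOnNhd_const, fun _ _ => by simp⟩

lemma isPolarLog_sum {ι : Type*} (s : Finset ι) {f : ι → RSpace n → ℂ}
    (h : ∀ i ∈ s, IsPolarLog k (f i)) : IsPolarLog k fun x => ∑ i ∈ s, f i x := by
  classical
  induction s using Finset.induction_on with
  | empty => simpa using isPolarLog_zero
  | insert i s hi ih =>
    simp only [Finset.sum_insert hi]
    exact (h i (Finset.mem_insert_self i s)).add
      (ih fun j hj => h j (Finset.mem_insert_of_mem hj))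

/-- One factor r moves into the analytic coefficient, so terms of different degrees can be added in
the lowest one. -/
lemma IsPolarLog.sub_one {f : RSpace n → ℂ} (hf : IsPolarLog k f) : IsPolarLog (k - 1) f := by
  obtain ⟨A, B, hA, hB, h⟩ := hf
  refine ⟨fun p => (p.2 : ℂ) * A p, B, fun p hp => AnalyticAt.fun_mul ?_ (hA p hp), hB,
    fun x hx => ?_⟩
  · exact (contDiffAt_ofReal contDiffAt_snd).analyticAt
  · have h0 := norm_ne_zero_iff.2 hx
    have e : ‖x‖ ^ k = ‖x‖ ^ (k - 1) * (polar x).2 := by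
      conv_lhs => rw [show k = k - 1 + 1 by ring, zpow_add_one₀ h0]
      rfl
    rw [h x hx, e]
    push_cast
    ring

lemma isPolarLog_norm_invApply_zpow {T : Matrix (Fin n) (Fin n) ℝ} (hT : IsUnit T) (k : ℤ) :
    IsPolarLog k fun x => ((‖invApply T x‖ ^ k : ℝ) : ℂ) := by
  refine ⟨_, fun _ => 0, isAnalyticNearSphere_zpow hT k, analyticOnNhd_const, fun x hx => ?_⟩
  simp only [norm_invApply_polar hx, mul_zpow]
  push_cast
  ring

lemma IsPolarLog.mul_coord {f : RSpace n → ℂ} (hf : IsPolarLog k f) (i : Fin n) :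
    IsPolarLog (k + 1) fun x => (x i : ℂ) * f x := by
  obtain ⟨A, B, hA, hB, h⟩ := hf
  refine ⟨fun p => (p.1 i : ℂ) * A p, fun x => (x i : ℂ) * B x,
    fun p hp => AnalyticAt.fun_mul ?_ (hA p hp), fun x hx => AnalyticAt.fun_mul ?_ (hB x hx),
    fun x hx => ?_⟩
  · exact (contDiffAt_ofReal ((contDiff_coord i).comp contDiff_fst).contDiffAt).analyticAt
  · exact (contDiffAt_ofReal (contDiff_coord i).contDiffAt).analyticAt
  · have h0 := norm_ne_zero_iff.2 hx
    have e : ‖x‖ ^ (k + 1) * (polar x).1 i = ‖x‖ ^ k * x i := by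
      rw [zpow_add_one₀ h0]
      simp only [polar, PiLp.smul_apply, smul_eq_mul]
      field_simp
    have e' := congrArg (fun r : ℝ => (r : ℂ)) e
    simp only [Complex.ofReal_mul] at e'
    simp only [h x hx]
    linear_combination -A (polar x) * e'

end PolarClass

/-! ### The leading part of the Hessian and the kernel class of the tangential gradient. -/

section Main

variable {n : ℕ} {α : ℝ} {Ω : Set (RSpace n)} {a : (Fin n → ℕ) → ℂ} {S : RSpace n → ℂ}

/-- The structure of the second derivatives of a fundamental solution, up to terms of lower
order. -/
lemma exists_hessian_splitting (hn : 2 ≤ n) (ha : IsElliptic a) (har : HasRealPrincipalPart a)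
    (hS : IsFundamentalSolution a S) :
    ∃ (c₀ : ℂ) (g : RSpace n → ℂ) (Q : Fin n → Fin n → RSpace n → ℂ),
      IsPolarLog (-(n : ℤ)) g ∧ (∀ l z, IsPolarLog (1 - (n : ℤ)) (Q l z)) ∧
      ∀ w v : RSpace n, w ≠ 0 → ∀ l : Fin n,
        rowMatCol a (fun j => partialD l (partialD j S) w) v
            + (∑ z, (v z : ℂ) * coeffOne a z) * partialD l S w
          = c₀ * ((v l : ℂ) * g w + ((∑ i, w i * v i : ℝ) : ℂ) * partialD l g w)
            + ∑ z, (v z : ℂ) * Q l z w := by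
  obtain ⟨T, A₁, b₀, B₁, C, A₂, hE, hG⟩ := exists_expansion hn ha har hS
  have hT := hE.isUnit
  have hA := hE.factor
  obtain ⟨c₀, hc₀⟩ : ∃ c₀ : ℂ, ((1 / (sphereArea n * √(realCoeffTwo a).det) : ℝ) : ℂ) = c₀ :=
    ⟨_, rfl⟩
  set g : RSpace n → ℂ := fun x => ((‖invApply T x‖ ^ (-(n : ℤ)) : ℝ) : ℂ) with hg
  -- `V` collects everything in `DS` beyond the leading term. It is of polar type of degree 2 - n,
  -- so its derivatives have degree 1 - n and are harmless.
  set V : Fin n → RSpace n → ℂ := fun j x => ((‖x‖ ^ (2 - (n : ℤ)) : ℝ) : ℂ) * A₂ (polar x) j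
    + partialD j B₁ x * (Real.log ‖x‖ : ℂ) + partialD j C x with hV
  have hgP : IsPolarLog (-(n : ℤ)) g := isPolarLog_norm_invApply_zpow hT _
  have hAj : ∀ j, IsAnalyticNearSphere fun p => A₂ p j := fun j p hp =>
    analyticAt_pi_iff.1 (hG.analytic_A p hp) j
  have hVP : ∀ j, IsPolarLog (2 - (n : ℤ)) (V j) := fun j =>
    IsPolarLog.add ⟨_, _, hAj j, fun x hx => analyticAt_partialD (hE.analytic_B x hx) j,
      fun _ _ => rfl⟩
      (IsPolarLog.of_analytic (fun x hx => analyticAt_partialD (hE.analytic_C x hx) j) (by omega))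
  have hDS : ∀ j x, x ≠ 0 → partialD j S x
      = c₀ * ((invForm (realCoeffTwo a) x j : ℂ) * g x) + V j x := by
    intro j x hx
    rw [hG.expansion x hx j, ← hc₀, invForm]
    simp only [hg, hV]
    push_cast
    ring
  have hLP : ∀ j, IsPolarLog (1 - (n : ℤ)) fun x => (invForm (realCoeffTwo a) x j : ℂ) * g x := by
    intro j
    have h1 := isPolarLog_sum Finset.univ fun i _ =>
      (hgP.mul_coord i).const_mul ((realCoeffTwo a)⁻¹ i j : ℂ)
    rw [show -(n : ℤ) + 1 = 1 - n by ring] at h1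
    refine h1.congr fun x _ => ?_
    simp only [invForm, Complex.ofReal_sum, Complex.ofReal_mul, Finset.sum_mul]
    exact Finset.sum_congr rfl fun i _ => by ring
  have hDSP : ∀ j, IsPolarLog (1 - (n : ℤ)) (partialD j S) := by
    intro j
    have h1 := (hVP j).sub_one
    rw [show 2 - (n : ℤ) - 1 = 1 - n by ring] at h1
    exact (((hLP j).const_mul c₀).add h1).congr fun x hx => hDS j x hx
  have hVl : ∀ l j, IsPolarLog (1 - (n : ℤ)) (partialD l (V j)) := by
    intro l j
    have h1 := (hVP j).partialD (by omega) l
    rwa [show 2 - (n : ℤ) - 1 = 1 - n by ring] at h1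
  refine ⟨c₀, g, fun l z w => ∑ j, coeffTwo a j z * partialD l (V j) w
    + coeffOne a z * partialD l S w, hgP, fun l z =>
    (isPolarLog_sum Finset.univ fun j _ => (hVl l j).const_mul _).add ((hDSP l).const_mul _),
    fun w v hw l => ?_⟩
  have dI : ∀ j, DifferentiableAt ℝ (fun x => (invForm (realCoeffTwo a) x j : ℂ)) w := fun j =>
    (hasFDerivAt_invForm (realCoeffTwo a) j w).ofReal_comp'.differentiableAt
  have dg : DifferentiableAt ℝ g w := (hgP.analyticAt hw).differentiableAt
  have hH : (fun j => partialD l (partialD j S) w)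
      = (c₀ * g w) • (fun j => ((realCoeffTwo a)⁻¹ l j : ℂ))
        + (c₀ * partialD l g w) • (fun j => (invForm (realCoeffTwo a) w j : ℂ))
        + fun j => partialD l (V j) w := by
    ext j
    have e : partialD j S =ᶠ[𝓝 w] fun x =>
        c₀ * ((invForm (realCoeffTwo a) x j : ℂ) * g x) + V j x := by
      filter_upwards [eventually_ne_zero hw] with y hy using hDS j y hy
    rw [e.partialD_eq, partialD_add l (((dI j).fun_mul dg).const_mul _)
      ((hVP j).analyticAt hw).differentiableAt, partialD_const_mul l _ ((dI j).fun_mul dg),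
      partialD_mul l (dI j) dg, partialD_invForm]
    simp only [Pi.add_apply, Pi.smul_apply, smul_eq_mul]
    ring
  rw [hH, ← rowMatColL_apply, map_add, map_add, map_smul, map_smul]
  simp only [rowMatColL_apply, rowMatCol_inv har hT hA, rowMatCol_invForm har hT hA, smul_eq_mul]
  have e1 : rowMatCol a (fun j => partialD l (V j) w) v
      = ∑ z, (v z : ℂ) * ∑ j, coeffTwo a j z * partialD l (V j) w := by
    rw [rowMatCol, Finset.sum_comm]
    refine Finset.sum_congr rfl fun z _ => ?_
    rw [Finset.mul_sum]
    exact Finset.sum_congr rfl fun j _ => by ring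
  have e2 : (∑ z, (v z : ℂ) * coeffOne a z) * partialD l S w
      = ∑ z, (v z : ℂ) * (coeffOne a z * partialD l S w) := by
    rw [Finset.sum_mul]
    exact Finset.sum_congr rfl fun z _ => by ring
  simp only [mul_add, Finset.sum_add_distrib]
  rw [e1, e2]
  ring

/-- Projecting the split Hessian leaves three kinds of products: the tangential part of ν(y) with g,
the scalar product (x - y)·ν(y) with ∇g, and bounded coefficients with terms of degree 1 - n. Each
lies in the class for its own reason. -/
theorem memKernelClass_tangentialPart (hn : 2 ≤ n) (ha : IsElliptic a)
    (har : HasRealPrincipalPart a) (hS : IsFundamentalSolution a S)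
    (hSa : ∀ x, x ≠ 0 → AnalyticAt ℝ S x) (hα0 : 0 < α) (hα1 : α ≤ 1)
    (hΩo : IsOpen Ω) (hΩb : Bornology.IsBounded Ω) (hΩ : IsOfClassC1Holder α Ω) (h : Fin n) :
    MemKernelClass ((n : ℝ) - α) n α (frontier Ω) (frontier Ω)
      (fun x y => tangentialPart Ω x
        (fun l => partialD l (fun x' => doubleLayerKernel Ω a S x' y) x) h) := by
  obtain ⟨c₀, g, Q, hg, hQ, hsplit⟩ := exists_hessian_splitting hn ha har hS
  obtain ⟨c, hc0, hc'⟩ := exists_boundary_estimates hα0 hΩo hΩb hΩ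
  have hc : HasBoundaryBound α Ω c := ⟨hc0, fun x hx => norm_outerNormal hα0 hΩo hΩ hx,
    fun x hx y hy => (hc' x hx y hy).1, fun x hx y hy => (hc' x hx y hy).2⟩
  obtain ⟨R, hR'⟩ := Metric.isBounded_iff.1 (hΩb.closure.subset frontier_subset_closure)
  have hR : ∀ x ∈ frontier Ω, ∀ y ∈ frontier Ω, ‖x - y‖ ≤ R := fun x hx y hy => by
    rw [← dist_eq_norm]
    exact hR' hx hy
  have k1 := (memKernelClass_tangentNormal hα0 hα1 hc hR hn hg h).const_mul (-c₀)
  have k2 := (memKernelClass_sum Finset.univ fun l _ =>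
    memKernelClass_flat hα0 hα1 hc hR (hg.partialD (by omega) l) h l).const_mul (-c₀)
  have k3 := (memKernelClass_sum Finset.univ fun l _ => memKernelClass_sum Finset.univ fun z _ =>
    memKernelClass_lower hα0 hα1 hc hR hn (hQ l z) h l z).const_mul (-1)
  refine ((k1.add k2).add k3).congr fun x hx y hy hxy => ?_
  have hw : x - y ≠ 0 := sub_ne_zero.2 hxy
  rw [tangentialPart_eq_sum (hc.norm_eq x hx)]
  have e : ∀ l, partialD l (fun x' => doubleLayerKernel Ω a S x' y) x
      = -(c₀ * ((outerNormal Ω y l : ℂ) * g (x - y)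
        + (inner ℝ (outerNormal Ω y) (x - y) : ℂ) * partialD l g (x - y))
        + ∑ z, (outerNormal Ω y z : ℂ) * Q l z (x - y)) := by
    intro l
    have h1 := hsplit (x - y) (outerNormal Ω y) hw l
    have h2 : inner ℝ (outerNormal Ω y) (x - y) = ∑ i, (x - y) i * outerNormal Ω y i := by
      rw [real_inner_comm, inner_eq_sum]
    rw [partialD_doubleLayerKernel hSa hxy, h2, ← h1]
    ring
  simp only [e, tangentNormal_eq_sum, Complex.ofReal_sum, Complex.ofReal_mul, Finset.mul_sum,
    Finset.sum_mul, ← Finset.sum_add_distrib]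
  refine Finset.sum_congr rfl fun l _ => ?_
  rw [neg_add, mul_add]
  congr 1
  · ring
  · rw [mul_neg, Finset.mul_sum, ← Finset.sum_neg_distrib]
    exact Finset.sum_congr rfl fun z _ => by ring

end Main

end

/-! ### Assembly of the expansion, the tangential gradient and the kernel estimates. -/

theorem lemma4p7 (n : ℕ) (hn : 2 ≤ n) (a : (Fin n → ℕ) → ℂ) (ha : IsElliptic a)
    (har : HasRealPrincipalPart a) (S : RSpace n → ℂ) (hS : IsFundamentalSolution a S)
    (α : ℝ) (hα0 : 0 < α) (hα1 : α ≤ 1) (Ω : Set (RSpace n)) (hΩo : IsOpen Ω)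
    (hΩb : Bornology.IsBounded Ω) (hΩ : IsOfClassC1Holder α Ω) :
    (∃ (T : Matrix (Fin n) (Fin n) ℝ) (A₁ : RSpace n × ℝ → ℂ) (b₀ : ℂ) (B₁ C : RSpace n → ℂ)
        (A₂ : RSpace n × ℝ → Fin n → ℂ),
        IsExpansion a S T A₁ b₀ B₁ C ∧ IsGradientExpansion a S T B₁ C A₂) ∧
    (∀ x ∈ frontier Ω, ∀ y ∈ frontier Ω, x ≠ y →
      DifferentiableAt ℝ (fun x' => doubleLayerKernel Ω a S x' y) x ∧
      HasTangentialGradientAt Ω (fun x' => doubleLayerKernel Ω a S x' y) x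
        (tangentialGradient Ω (fun x' => doubleLayerKernel Ω a S x' y) x) ∧
      (∀ h : Fin n, tangentialGradient Ω (fun x' => doubleLayerKernel Ω a S x' y) x h =
        partialD h (fun x' => doubleLayerKernel Ω a S x' y) x
          - (outerNormal Ω x h : ℂ) * ∑ l, (outerNormal Ω x l : ℂ)
            * partialD l (fun x' => doubleLayerKernel Ω a S x' y) x) ∧
      (∀ (T : Matrix (Fin n) (Fin n) ℝ) (A₁ : RSpace n × ℝ → ℂ) (b₀ : ℂ) (B₁ C : RSpace n → ℂ)
        (A₂ : RSpace n × ℝ → Fin n → ℂ),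
        IsExpansion a S T A₁ b₀ B₁ C → IsGradientExpansion a S T B₁ C A₂ →
        ∀ h : Fin n, tangentialGradient Ω (fun x' => doubleLayerKernel Ω a S x' y) x h =
          gradientFormula Ω a S T B₁ C A₂ h x y)) ∧
    (∀ h : Fin n, MemKernelClass ((n : ℝ) - α) n α (frontier Ω) (frontier Ω)
      (fun x y => tangentialGradient Ω (fun x' => doubleLayerKernel Ω a S x' y) x h)) := by
  obtain ⟨T₀, A₀, b, B, C₀, A', hE₀, hG₀⟩ := exists_expansion hn ha har hS
  have hSa : ∀ x, x ≠ 0 → AnalyticAt ℝ S x := fun x hx => hE₀.analyticAt hx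
  have hdiff : ∀ x y : RSpace n, x ≠ y →
      DifferentiableAt ℝ (fun x' => doubleLayerKernel Ω a S x' y) x := fun x y hxy =>
    differentiableAt_doubleLayerKernel hSa hxy
  have htg : ∀ x ∈ frontier Ω, ∀ y, x ≠ y →
      tangentialGradient Ω (fun x' => doubleLayerKernel Ω a S x' y) x
        = tangentialPart Ω x fun l => partialD l (fun x' => doubleLayerKernel Ω a S x' y) x :=
    fun x hx y hxy => tangentialGradient_eq hα0 hΩo hΩ hx (hdiff x y hxy)
  refine ⟨⟨T₀, A₀, b, B, C₀, A', hE₀, hG₀⟩, fun x hx y _ hxy => ⟨hdiff x y hxy, ?_, fun h => ?_,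
    fun T A₁ b₀ B₁ C A₂ hE hG h => ?_⟩, fun h => ?_⟩
  · rw [htg x hx y hxy]
    exact hasTangentialGradientAt_tangentialPart hα0 hΩo hΩ hx (hdiff x y hxy)
  · rw [htg x hx y hxy, tangentialPart_eq (norm_outerNormal hα0 hΩo hΩ hx)]
  · rw [htg x hx y hxy, gradientFormula_eq har hE hG hxy]
  · refine (memKernelClass_tangentialPart hn ha har hS hSa hα0 hα1 hΩo hΩb hΩ h).congr
      fun x hx y _ hxy => ?_
    rw [htg x hx y hxy]
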